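/- **Setting.** Let $\chi_1,\bar\chi_1\in C^\infty([0,\infty);[0,1])$ satisfy $\chi_1^2+\bar\chi_1^2=1$, $\chi_1=1$ on $[0,3/4)$, $\operatorname{supp}\chi_1\subset[0,1]$; put $\chi_\rho(r)=\chi_1(r/\rho)$, $\bar\chi_\rho(r)=\bar\chi_1(r/\rho)$ and $C_\theta=3+2\|\partial_r\chi_1\|_\infty$. Let $B_1$ be the open unit ball of $\mathbb R^3$ and $D_{1/2}=\{z\in\mathbb C:|z|<1/2\}$. For $k=(k_1,\dots,k_m)\in B_1^m$ put $\Sigma[k]=\sum_i|k_i|$, $|k|_\Pi=\prod_i|k_i|$. *Kernels.* $\mathcal W^\#_{m,n}$ consists of the $w_{m,n}\in L^\infty(B_1^m\times B_1^n;C^1[0,1])$, written $w_{m,n}(r,k,\tilde k)$, that are symmetric in $k_1,\dots,k_m$ and in $\tilde k_1,\dots,\tilde k_n$ and vanish for $r>1-\max(\Sigma[k],\Sigma[\tilde k])$, with norm $\|w_{m,n}\|^\#=\operatorname{ess\,sup}_{k,\tilde k}\sup_r|w_{m,n}|+\operatorname{ess\,sup}_{k,\tilde k}\sup_r|\partial_rw_{m,n}|$.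 For $0<\xi<1$, $\mathcal W_\xi^\#$ is the space of sequences $w=(w_{m,n})_{m,n\ge0}$ with $\|w\|^\#_\xi=\sum_{m,n}\xi^{-(m+n)}\|w_{m,n}\|^\#<\infty$, and $\mathcal W_\xi$ is the space of bounded, strongly analytic functions $w:D_{1/2}\to\mathcal W_\xi^\#$. For $\alpha,\beta,\gamma\ge0$, $\mathcal B_0(\alpha,\beta,\gamma)$ is the set of $w\in\mathcal W_\xi$ such that for all $z\in D_{1/2}$: $\|\partial_rw_{0,0}(z)-1\|_\infty\le\alpha$, $|w_{0,0}(z,0)+z|\le\beta$, $\sum_{m+n\ge1}\xi^{-(m+n)}\|w_{m,n}(z)\|^\#\le\gamma$, and $w_{m,n}(z)=0$ whenever $m+n$ is odd. *The map $\mathcal R_\rho^\#$.* On the bosonic Fock space over $L^2(\mathbb R^3)$ with vacuum $\Omega$, annihilation and creation operators $a(k),a^*(k)$ and free energy $H_f=\int|k|a^*(k)a(k)\,d^3k$, let $P$ be the spectral projection of $H_f$ onto $[0,1]$ and $$W^{m,n}_{p,q}[w](r,k,\tilde k)=P\int_{B_1^{p+q}}\frac{dx\,d\tilde x}{(4\pi)^{p+q}\,|x|_\Pi^{1/2}|\tilde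 x|_\Pi^{1/2}}\;a^*(x_1)\cdots a^*(x_p)\,w_{p+m,q+n}(H_f+r,x,k,\tilde x,\tilde k)\,a(\tilde x_1)\cdots a(\tilde x_q)\,P ,$$ where $w_{p+m,q+n}$ is set to $0$ for energies outside $[0,1]$. For $L\ge1$ and $\underline m,\underline p,\underline n,\underline q\in\mathbb N_0^L$ split $k=(k_1,\dots,k_L)$ and $\tilde k=(\tilde k_1,\dots,\tilde k_L)$ into successive blocks $k_l\in B_1^{m_l}$, $\tilde k_l\in B_1^{n_l}$, and put $r_l=\sum_{j<l}\Sigma[\tilde k_j]+\sum_{j>l}\Sigma[k_j]$, $\tilde r_l=\sum_{j\le l}\Sigma[\tilde k_j]+\sum_{j>l}\Sigma[k_j]$, $F_0=F_L=\chi_\rho$, $F_l=\bar\chi_\rho^2/w_{0,0}$ for $1\le l\le L-1$, and $$v_{\underline m,\underline p,\underline n,\underline q}[w](r,k,\tilde k)=\Big\langle\Omega,F_0(H_f+\rho(r+\tilde r_0))\prod_{l=1}^L\big\{W^{m_l,n_l}_{p_l,q_l}[w](\rho(r+r_l),\rho k_l,\rho\tilde k_l)\,F_l(H_f+\rho(r+\tilde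 r_l))\big\}\Omega\Big\rangle .$$ Let $\hat w_{0,0}(r)=\rho^{-1}w_{0,0}(\rho r)+\rho^{-1}\sum_{L\ge2}(-1)^{L-1}\sum v_{\underline 0,\underline p,\underline0,\underline q}[w](r)$, and for $M+N\ge1$ $$\hat w_{M,N}=\sum_{L\ge1}(-1)^{L-1}\rho^{M+N-1}\sum\ \prod_{l=1}^L\binom{m_l+p_l}{p_l}\binom{n_l+q_l}{q_l}\ v_{\underline m,\underline p,\underline n,\underline q}[w],$$ where the inner sums run over all multi-indices in $\mathbb N_0^L$ with $|\underline m|=M$, $|\underline n|=N$ (in the first formula $M=N=0$) and $m_l+p_l+n_l+q_l\ge1$ for all $l$. $\mathcal R_\rho^\#(w)$ is the symmetrization of $\hat w$ in the variables $k$ and $\tilde k$ separately. *The renormalization map.* With $E_\rho[w](z)=-\rho^{-1}w_{0,0}(z,0)$ and $U[w]=\{z\in D_{1/2}:|w_{0,0}(z,0)|<\rho/2\}$ put $(\mathcal R_\rho w)(\zeta)=\mathcal R_\rho^\#\big(w(E_\rho[w]^{-1}(\zeta))\big)$, $\zeta\in D_{1/2}$, where $E_\rho[w]^{-1}$ is the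 inverse of $E_\rho[w]:U[w]\to D_{1/2}$. **Theorem.** Say that $(\rho,\xi,\epsilon_0)$ has the *contraction property* if for all $\epsilon,\delta_1,\delta_2\in[0,\epsilon_0)$ the map $\mathcal R_\rho$ is well defined on $\mathcal B_0(\epsilon,\delta_1,\delta_2)$ (that is, $E_\rho[w]:U[w]\to D_{1/2}$ is a bijection, and for each $z\in U[w]$ and each $(M,N)$ the series defining $\hat w_{M,N}$ for the kernel $w(z)$ converges absolutely in $\|\cdot\|^\#$) and $$\mathcal R_\rho:\ \mathcal B_0(\epsilon,\delta_1,\delta_2)\to\mathcal B_0\big(\epsilon+\tfrac{\delta_2}2,\ \tfrac{\delta_2}2,\ \tfrac{\delta_2}2\big).$$ 1. $(\rho,\xi,\epsilon_0)$ has the contraction property whenever $0<\rho\le\frac1{16C_\theta}$, $0<\xi\le\big(\frac{\rho}{2C_\theta}\big)^{1/4}$ and $0<\epsilon_0\le\frac\rho{32}$. 2. Consequently, for all $\rho_0,\xi_0\in(0,1/2]$ there are $\rho\in(0,\rho_0]$, $\xi\in(0,\xi_0]$ and $\epsilon_0\in(0,\rho/8]$ such that $(\rho,\xi,\epsilon_0)$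 has the contraction property. -/

import Mathlib

open MeasureTheory Filter Topology

noncomputable section

namespace SpinBoson

/-- Momentum space `ℝ³` with the Euclidean norm. -/
abbrev E3 : Type := EuclideanSpace ℝ (Fin 3)

/-- `Σ[k] = |k₁| + ⋯ + |k_n|`. -/
def sumNorm {n : ℕ} (k : Fin n → E3) : ℝ := ∑ i, ‖k i‖

/-- `B₁ⁿ`, the `n`-fold product of the open unit ball of `ℝ³`. -/
def ballPow (n : ℕ) : Set (Fin n → E3) := {k | ∀ i, ‖k i‖ < 1}

/-! ### Fock space: wave functions, creation and annihilation operators -/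

/-- A vector of the bosonic Fock space over `L²(ℝ³)`, given by its sequence of `n`-particle
wave functions `ψ_n(k₁, …, k_n)`. The operators below are given by their explicit action on
wave functions; `⟨Ω, ψ⟩` is the zero-particle component `ψ_0`. -/
abbrev Fock : Type := (n : ℕ) → (Fin n → E3) → ℂ

/-- The vacuum vector `Ω = (1, 0, 0, …)`. -/
def vacuum : Fock := fun n _ => if n = 0 then 1 else 0

/-- The function `g(H_f)` of the free field energy: multiplication of the `n`-particle wave
function by `g(|k₁| + ⋯ + |k_n|)`. -/
def funHf (g : ℝ → ℂ) (ψ : Fock) : Fock := fun n κ => g (sumNorm κ) * ψ n κ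

/-- The projection `P_red = χ(H_f ≤ 1)`. -/
def pRed (ψ : Fock) : Fock := funHf ((Set.Icc (0 : ℝ) 1).indicator 1) ψ

/-- `a(x)`, where `(a(x)ψ)_n(κ) = √(n+1) ψ_{n+1}(x, κ)`. -/
def annihilate (x : E3) (ψ : Fock) : Fock :=
  fun n κ => (Real.sqrt ((n : ℝ) + 1) : ℂ) * ψ (n + 1) (Fin.cons x κ)

/-- `a(x₁) ⋯ a(x_q)`. -/
def annihilateN : (q : ℕ) → (Fin q → E3) → Fock → Fock
  | 0, _, ψ => ψ
  | q + 1, x, ψ => annihilate (x 0) (annihilateN q (fun i => x i.succ) ψ)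

/-- The smeared creation operator `∫ d³x a*(x) Φ(x)` for a Fock space valued integrand `Φ`:
its `n`-particle wave function is `n^{-1/2} ∑_j Φ(k_j)_{n-1}(k₁, …, k_{j-1}, k_{j+1}, …, k_n)`. -/
def create (Φ : E3 → Fock) : Fock
  | 0, _ => 0
  | n + 1, κ => ((Real.sqrt ((n : ℝ) + 1))⁻¹ : ℂ) * ∑ j : Fin (n + 1), Φ (κ j) n (j.removeNth κ)

/-- `∫ d³x₁ ⋯ d³x_p a*(x₁) ⋯ a*(x_p) Φ(x₁, …, x_p)`. -/
def createN : (p : ℕ) → ((Fin p → E3) → Fock) → Fock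
  | 0, Φ => Φ Fin.elim0
  | p + 1, Φ => create fun x => createN p fun xs => Φ (Fin.cons x xs)

/-! ### Integral kernels and their norms -/

/-- A sequence `w = (w_{m,n})` of integral kernels `w_{m,n}(r, k^{(m)}, k̃^{(n)})`. Only the values
at `r ∈ [0,1]` and `k^{(m)} ∈ B₁^m`, `k̃^{(n)} ∈ B₁^n` matter, up to null sets of momenta. -/
abbrev Kernel : Type := (m n : ℕ) → ℝ → (Fin m → E3) → (Fin n → E3) → ℂ

/-- Lebesgue measure on `B₁^m × B₁^n`. -/
def momentumMeasure (m n : ℕ) : Measure ((Fin m → E3) × (Fin n → E3)) :=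
  volume.restrict (ballPow m ×ˢ ballPow n)

/-- `ess sup_K sup_{r ∈ [0,1]} |f(r, K)|`. -/
def supNorm {m n : ℕ} (f : ℝ → (Fin m → E3) → (Fin n → E3) → ℂ) : ENNReal :=
  essSup (fun K => ⨆ r ∈ Set.Icc (0 : ℝ) 1, ‖f r K.1 K.2‖ₑ) (momentumMeasure m n)

/-- `∂_r f` on `[0,1]` (one-sided at the end points). -/
def dr {m n : ℕ} (f : ℝ → (Fin m → E3) → (Fin n → E3) → ℂ) :
    ℝ → (Fin m → E3) → (Fin n → E3) → ℂ :=
  fun r k k' => derivWithin (fun s => f s k k') (Set.Icc 0 1) r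

/-- The norm `‖f‖^# = ‖f‖ + ‖∂_r f‖`. -/
def sharpNorm {m n : ℕ} (f : ℝ → (Fin m → E3) → (Fin n → E3) → ℂ) : ENNReal :=
  supNorm f + supNorm (dr f)

/-- Membership in `𝒲^#_{m,n}`: `f` is an essentially bounded function of the momenta with values
in `C¹[0,1]` (measurability into the separable space `C¹[0,1]` is measurability of
every evaluation), supported in `r ≤ 1 - max(Σ[k], Σ[k̃])`, and symmetric in the `k`'s and in
the `k̃`'s separately. -/
structure MemSharp {m n : ℕ} (f : ℝ → (Fin m → E3) → (Fin n → E3) → ℂ) : Prop where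
  meas : ∀ r ∈ Set.Icc (0 : ℝ) 1,
    AEStronglyMeasurable (fun K : (Fin m → E3) × (Fin n → E3) => f r K.1 K.2)
      (momentumMeasure m n)
  contDiff : ∀ᵐ K ∂(momentumMeasure m n),
    ContDiffOn ℝ 1 (fun r => f r K.1 K.2) (Set.Icc 0 1)
  support : ∀ᵐ K ∂(momentumMeasure m n), ∀ r ∈ Set.Icc (0 : ℝ) 1,
    1 - max (sumNorm K.1) (sumNorm K.2) < r → f r K.1 K.2 = 0
  symm : ∀ᵐ K ∂(momentumMeasure m n), ∀ r ∈ Set.Icc (0 : ℝ) 1,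
    ∀ (π : Equiv.Perm (Fin m)) (π' : Equiv.Perm (Fin n)),
      f r (fun i => K.1 (π i)) (fun j => K.2 (π' j)) = f r K.1 K.2
  norm_lt_top : sharpNorm f < ⊤

/-- The norm `‖w‖_ξ^# = ∑_{m,n} ξ^{-(m+n)} ‖w_{m,n}‖^#`. -/
def xiNorm (ξ : ℝ) (w : Kernel) : ENNReal :=
  ∑' mn : ℕ × ℕ, ENNReal.ofReal ξ⁻¹ ^ (mn.1 + mn.2) * sharpNorm (w mn.1 mn.2)

/-- Membership in the Banach space `𝒲_ξ^#`. -/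
def MemXi (ξ : ℝ) (w : Kernel) : Prop :=
  (∀ m n, MemSharp (w m n)) ∧ xiNorm ξ w < ⊤

/-- `w_{≥ 1}`. -/
def geOne (w : Kernel) : Kernel := fun m n => if 1 ≤ m + n then w m n else 0

/-- The disc `D_{1/2}` of spectral parameters. -/
def disc : Set ℂ := {z | ‖z‖ < 1 / 2}

/-- Membership in `𝒲_ξ`: bounded functions `z ↦ w(z)` from `D_{1/2}` to `𝒲_ξ^#` that are strongly
analytic, i.e. complex differentiable with respect to `‖·‖_ξ^#`. -/
structure MemAnalytic (ξ : ℝ) (w : ℂ → Kernel) : Prop where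
  mem : ∀ z ∈ disc, MemXi ξ (w z)
  bounded : (⨆ z ∈ disc, xiNorm ξ (w z)) < ⊤
  differentiable : ∀ z ∈ disc, ∃ w' : Kernel, MemXi ξ w' ∧
    Tendsto (fun h : ℂ => xiNorm ξ (h⁻¹ • (w (z + h) - w z) - w')) (𝓝[≠] 0) (𝓝 0)

/-- The value `w_{0,0}(r)`. -/
def Kernel.zero (w : Kernel) (r : ℝ) : ℂ := w 0 0 r Fin.elim0 Fin.elim0

/-- The ball `ℬ(α, β, γ)` in `𝒲_ξ`. -/
structure MemBall (ξ α β γ : ℝ) (w : ℂ → Kernel) : Prop where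
  analytic : MemAnalytic ξ w
  deriv_le : ∀ z ∈ disc, ∀ r ∈ Set.Icc (0 : ℝ) 1,
    ‖derivWithin (w z).zero (Set.Icc 0 1) r - 1‖ ≤ α
  value_le : ∀ z ∈ disc, ‖(w z).zero 0 + z‖ ≤ β
  norm_le : ∀ z ∈ disc, xiNorm ξ (geOne (w z)) ≤ ENNReal.ofReal γ

/-- The ball `ℬ₀(α, β, γ)` of even kernels: `w_{m,n} = 0` (as an element of `𝒲^#_{m,n}`)
whenever `m + n` is odd. -/
structure MemEvenBall (ξ α β γ : ℝ) (w : ℂ → Kernel) : Prop where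
  ball : MemBall ξ α β γ w
  even : ∀ z ∈ disc, ∀ m n : ℕ, Odd (m + n) →
    ∀ᵐ K ∂(momentumMeasure m n), ∀ r ∈ Set.Icc (0 : ℝ) 1, w z m n r K.1 K.2 = 0

/-! ### The cutoff functions -/

/-- Smooth functions `χ₁, χ̄₁ : [0,∞) → [0,1]` with `χ₁² + χ̄₁² = 1`, `χ₁ = 1` on `[0,3/4)` and
`supp χ₁ ⊂ [0,1]`. -/
structure IsCutoffPair (χ χbar : ℝ → ℝ) : Prop where
  smooth : ContDiffOn ℝ ((⊤ : ℕ∞) : WithTop ℕ∞) χ (Set.Ici 0)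
  smooth_bar : ContDiffOn ℝ ((⊤ : ℕ∞) : WithTop ℕ∞) χbar (Set.Ici 0)
  mem : ∀ r, 0 ≤ r → χ r ∈ Set.Icc (0 : ℝ) 1
  mem_bar : ∀ r, 0 ≤ r → χbar r ∈ Set.Icc (0 : ℝ) 1
  sq_add_sq : ∀ r, 0 ≤ r → χ r ^ 2 + χbar r ^ 2 = 1
  eq_one : ∀ r, 0 ≤ r → r < 3 / 4 → χ r = 1
  eq_zero : ∀ r, 1 < r → χ r = 0

/-- `C_θ = 3 + 2 ‖∂_r χ₁‖_∞`. -/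
def cTheta (χ : ℝ → ℝ) : ℝ :=
  3 + 2 * ⨆ r : Set.Ici (0 : ℝ), |derivWithin χ (Set.Ici 0) r|

/-! ### The renormalized kernels -/

/-- The density `∏_i |x_i|^{-1/2} / (4π)` on `B₁^p`. -/
def weight {p : ℕ} (x : Fin p → E3) : ℂ :=
  (ballPow p).indicator (fun y => ((∏ i, ‖y i‖ ^ (-(1 / 2) : ℝ) / (4 * Real.pi) : ℝ) : ℂ)) x

/-- The operator `W^{m,n}_{p,q}[w](r, k, k̃)`, that is
`P_red ∫ dX |X|^{-1/2} a*(x) w_{p+m,q+n}(H_f + r, x, k, x̃, k̃) a(x̃) P_red`, the integral being over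
`X = (x, x̃) ∈ B₁^{p+q}` with `dX = (4π)^{-(p+q)} dx dx̃`. The kernel counts as zero
where its energy argument is outside `[0,1]`. -/
def interaction (w : Kernel) {m n : ℕ} (p q : ℕ) (r : ℝ) (k : Fin m → E3) (k' : Fin n → E3)
    (ψ : Fock) : Fock :=
  pRed <| createN p fun x l κ =>
    weight x * ∫ x' : Fin q → E3,
      weight x' *
        ((Set.Icc (0 : ℝ) 1).indicator
          (fun s => w (p + m) (q + n) s (Fin.append x k) (Fin.append x' k')) (sumNorm κ + r)) *
        annihilateN q x' (pRed ψ) l κ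

/-- The multi-indices `(m, p, n, q) ∈ ℕ₀^{4L}` with `|m| = M`, `|n| = N` and
`m_l + p_l + n_l + q_l ≥ 1` for all `l`. -/
structure MultiIndex (L M N : ℕ) where
  m : Fin L → ℕ
  p : Fin L → ℕ
  n : Fin L → ℕ
  q : Fin L → ℕ
  sum_m : ∑ l, m l = M
  sum_n : ∑ l, n l = N
  pos : ∀ l, 1 ≤ m l + p l + n l + q l

/-- The combinatorial factor `∏_l binom(m_l + p_l, p_l) binom(n_l + q_l, q_l)`. -/
def MultiIndex.coeff {L M N : ℕ} (i : MultiIndex L M N) : ℕ :=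
  ∏ l, (i.m l + i.p l).choose (i.p l) * (i.n l + i.q l).choose (i.q l)

/-- The `l`-th block `k_l^{(m_l)}` of `k^{(M)} = (k_1^{(m_1)}, …, k_L^{(m_L)})`. -/
def block {L M : ℕ} {m : Fin L → ℕ} (h : ∑ l, m l = M) (k : Fin M → E3) (l : Fin L) :
    Fin (m l) → E3 :=
  fun j => k (Fin.cast h (finSigmaFinEquiv ⟨l, j⟩))

/-- The kernel `v_{m,p,n,q}[w](r, k, k̃)`, the vacuum expectation value
`⟨Ω, F₀(H_f + ρ(r + r̃₀)) ∏_{l=1}^L { W_l(ρ(r + r_l), ρ K_l) F_l(H_f + ρ(r + r̃_l)) } Ω⟩` with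
`F₀ = F_L = χ_ρ` and `F_l = χ̄_ρ² / w_{0,0}` otherwise. The factor with number `l + 1` in this product
has the index `l : Fin L` below. -/
def vKernel (χ χbar : ℝ → ℝ) (ρ : ℝ) (w : Kernel) {L M N : ℕ} (i : MultiIndex L M N)
    (r : ℝ) (k : Fin M → E3) (k' : Fin N → E3) : ℂ :=
  let κ : (l : Fin L) → Fin (i.m l) → E3 := block i.sum_m k
  let κ' : (l : Fin L) → Fin (i.n l) → E3 := block i.sum_n k'
  let shift : Fin L → ℝ := fun l =>
    ∑ j ∈ Finset.Iio l, sumNorm (κ' j) + ∑ j ∈ Finset.Ioi l, sumNorm (κ j)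
  let shift' : Fin L → ℝ := fun l =>
    ∑ j ∈ Finset.Iic l, sumNorm (κ' j) + ∑ j ∈ Finset.Ioi l, sumNorm (κ j)
  let F : Fin L → ℝ → ℂ := fun l s =>
    if (l : ℕ) + 1 = L then (χ (s / ρ) : ℂ) else (χbar (s / ρ) : ℂ) ^ 2 / w.zero s
  let factor : Fin L → Fock → Fock := fun l ψ =>
    interaction w (i.p l) (i.q l) (ρ * (r + shift l)) (ρ • κ l) (ρ • κ' l)
      (funHf (fun s => F l (s + ρ * (r + shift' l))) ψ)
  funHf (fun s => (χ ((s + ρ * (r + ∑ j, sumNorm (κ j))) / ρ) : ℂ))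
    ((List.ofFn factor).foldr (fun A ψ => A ψ) vacuum) 0 Fin.elim0

/-- The inner sum over multi-indices of length `L`. -/
def orderTerm (χ χbar : ℝ → ℝ) (ρ : ℝ) (w : Kernel) (L M N : ℕ)
    (r : ℝ) (k : Fin M → E3) (k' : Fin N → E3) : ℂ :=
  ∑' i : MultiIndex L M N, (i.coeff : ℂ) * vKernel χ χbar ρ w i r k k'

/-- The kernel `ŵ` before symmetrization: the series over `L ≥ 1` if `M + N ≥ 1`, and
`ρ⁻¹ w_{0,0}(ρ r)` plus the series over `L ≥ 2` if `M = N = 0`. -/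
def hatKernel (χ χbar : ℝ → ℝ) (ρ : ℝ) (w : Kernel) : Kernel := fun M N r k k' =>
  if M + N = 0 then
    (ρ : ℂ)⁻¹ * w.zero (ρ * r) +
      (ρ : ℂ)⁻¹ * ∑' L : ℕ, (-1) ^ (L + 1) * orderTerm χ χbar ρ w (L + 2) M N r k k'
  else
    ∑' L : ℕ, (-1) ^ L * (ρ : ℂ) ^ (M + N - 1) * orderTerm χ χbar ρ w (L + 1) M N r k k'

/-- Symmetrization in the variables `k` and `k̃` separately. -/
def symmetrize (w : Kernel) : Kernel := fun M N r k k' =>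
  ((M.factorial : ℂ) * (N.factorial : ℂ))⁻¹ *
    ∑ π : Equiv.Perm (Fin M), ∑ π' : Equiv.Perm (Fin N),
      w M N r (fun i => k (π i)) (fun j => k' (π' j))

/-- The map `ℛ_ρ^#` on kernels. -/
def renormSharp (χ χbar : ℝ → ℝ) (ρ : ℝ) (w : Kernel) : Kernel :=
  symmetrize (hatKernel χ χbar ρ w)

/-- `E_ρ[w](z) = -ρ⁻¹ w_{0,0}(z, 0)`. -/
def energy (ρ : ℝ) (w : ℂ → Kernel) (z : ℂ) : ℂ := -((ρ : ℂ)⁻¹ * (w z).zero 0)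

/-- `U[w] = {z ∈ D_{1/2} : |w_{0,0}(z, 0)| < ρ/2}`. -/
def energyDomain (ρ : ℝ) (w : ℂ → Kernel) : Set ℂ := {z ∈ disc | ‖(w z).zero 0‖ < ρ / 2}

/-- The renormalization transformation `(ℛ_ρ w)(ζ) = ℛ_ρ^#(w(E_ρ[w]⁻¹(ζ)))`, where `E_ρ[w]⁻¹` is
the inverse of `E_ρ[w] : U[w] → D_{1/2}`. -/
def renorm (χ χbar : ℝ → ℝ) (ρ : ℝ) (w : ℂ → Kernel) : ℂ → Kernel := fun ζ =>
  renormSharp χ χbar ρ (w (Function.invFunOn (energy ρ w) (energyDomain ρ w) ζ))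

/-- `ℛ_ρ w` is well defined: `E_ρ[w] : U[w] → D_{1/2}` is a bijection, and for `z ∈ U[w]` the series
defining `ℛ_ρ^#(w(z))` converge absolutely in the norms `‖·‖^#`. -/
def RenormWellDefined (χ χbar : ℝ → ℝ) (ρ : ℝ) (w : ℂ → Kernel) : Prop :=
  Set.BijOn (energy ρ w) (energyDomain ρ w) disc ∧
    ∀ z ∈ energyDomain ρ w, ∀ M N : ℕ,
      (∑' L : ℕ, ∑' i : MultiIndex (L + 1) M N,
        (i.coeff : ENNReal) * sharpNorm (vKernel χ χbar ρ (w z) i)) < ⊤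

/-- The contraction property
`ℛ_ρ : ℬ₀(ε, δ₁, δ₂) → ℬ₀(ε + δ₂/2, δ₂/2, δ₂/2)` for all `ε, δ₁, δ₂ ∈ [0, ε₀)`. -/
def ContractionProperty (χ χbar : ℝ → ℝ) (ρ ξ ε₀ : ℝ) : Prop :=
  ∀ ε ∈ Set.Ico 0 ε₀, ∀ δ₁ ∈ Set.Ico 0 ε₀, ∀ δ₂ ∈ Set.Ico 0 ε₀, ∀ w : ℂ → Kernel,
    MemEvenBall ξ ε δ₁ δ₂ w →
      RenormWellDefined χ χbar ρ w ∧
        MemEvenBall ξ (ε + δ₂ / 2) (δ₂ / 2) (δ₂ / 2) (renorm χ χbar ρ w)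

end SpinBoson

end

/-!
The renormalization map contracts because every term in the series for `ŵ_{M,N}` of length `L`
contains `L` interaction kernels, each of size `γ` or smaller, against `L - 1` resolvents
`χ̄_ρ²/w_{0,0}` of size `5/ρ`, and because even kernels carry at least two momenta, each of which
gains a factor `ρ` when it is an outer momentum and a factor `ξ` when it is integrated out.

*Bounds on wave functions.* Instead of operator norms on Fock space, the estimates use sup bounds on
wave functions relative to the weight `(n!)^{-1/2} ∏_i |κ_i|^{-3/2}` (`fockWeight`). Against this
weight an integrated annihilation operator has the mass `∫_{|x|<1} dx / (4π |x|²) = 1`, and the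
creation operators cost `∑_j |κ_j|`, which is at most one on the range of `P`. So an interaction
operator is bounded by the norm `‖w_{m,n}‖^#` of its kernel (`StateBound.interactOp`). The weight is
one on the vacuum sector, where the kernels `v` are read off. The dependence on the energy `r` is
carried along by the predicate `C1On S X Y`, which bounds a function by `X` and its derivative
by `X Y`; under products `X` is multiplicative and `Y` additive. Together with the lower bound `ρ/5`
on `w_{0,0}` on the support of `χ̄_ρ` (`GoodFree.le_norm_ext`) this gives `vKernel_bound`.

*Null sets.* Elements of `𝒲^#_{m,n}` are only determined up to null sets of momenta, while `v` is
computed pointwise. Kernels are therefore replaced by representatives without exceptional sets,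
extended by zero beyond energy one (`MemPre.exists_niceKernel`), and `w_{0,0}` is extended to all
energies (`ext`). The replacement changes `v` on null sets only (`ae_vKernel_eq_chainKernel`), since
each kernel is evaluated at surjective linear images of the momenta.

*Summation.* The binomial theorem turns the sum over multi-indices into a power of a sum over one
slot, with the weight `(ρ + ξ)/ξ` per momentum (`tsum_multiIndex_le`). Evenness gives a factor
`(ρ + ξ)²` per slot, and a geometric series remains. As `(ρ + ξ)⁴ C_θ ≤ ρ`, the total is at most
`γ/2` (`tsum_orderSum_le`). Evenness is preserved because the vacuum expectation of `p` creations and `q`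
annihilations vanishes unless `p = q` (`vKernel_odd`).

*Analyticity.* A product of operators is differentiable in a parameter if its factors are
(`chainKernel_differentiable`). The series may be differentiated termwise since each finite partial
sum is bounded on a disc by the same constant, so that a Cauchy estimate, transferred to seminormed
spaces by the Hahn–Banach theorem, controls its linearization error (`weighted_differentiable`).

*Spectral parameter.* The energy map is `ρ⁻¹` times a perturbation of the identity; by the Cauchy
estimate the perturbation contracts distances. Preimages are fixed points of a contraction
(`EnergyCond.bijOn`), and the inverse is holomorphic. At the preimage of `ζ` the free part has the
value `-ρ ζ` at energy zero, so that after rescaling only the error `γ/2` of the interacting terms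
is left.
-/

noncomputable section

namespace SpinBoson

/-! ### Continuously differentiable functions with weighted bounds -/

/-- `g` is continuously differentiable on `S` with `|g| ≤ X` and `|g'| ≤ X Y`. With the derivative
measured relative to the size, `X` is multiplicative and `Y` additive under products. -/
def C1On (S : Set ℝ) (X Y : ℝ) (g : ℝ → ℂ) : Prop :=
  ∃ g' : ℝ → ℂ, (∀ r ∈ S, HasDerivWithinAt g (g' r) S r) ∧ ContinuousOn g' S ∧
    ∀ r ∈ S, ‖g r‖ ≤ X ∧ ‖g' r‖ ≤ X * Y

namespace C1On

variable {S : Set ℝ} {X Y X₁ X₂ Y₁ Y₂ : ℝ} {g g₁ g₂ : ℝ → ℂ}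

lemma continuousOn (h : C1On S X Y g) : ContinuousOn g S := by
  obtain ⟨g', h1, -, -⟩ := h
  exact fun r hr => (h1 r hr).continuousWithinAt

lemma bound (h : C1On S X Y g) {r : ℝ} (hr : r ∈ S) : ‖g r‖ ≤ X := by
  obtain ⟨g', -, -, h3⟩ := h
  exact (h3 r hr).1

lemma mono (h : C1On S X₁ Y₁ g) (hX : X₁ ≤ X₂) (hY : Y₁ ≤ Y₂) (hY0 : 0 ≤ Y₂) :
    C1On S X₂ Y₂ g := by
  obtain ⟨g', h1, h2, h3⟩ := h
  refine ⟨g', h1, h2, fun r hr => ⟨(h3 r hr).1.trans hX, (h3 r hr).2.trans ?_⟩⟩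
  have : 0 ≤ X₁ := (norm_nonneg _).trans (h3 r hr).1
  exact (mul_le_mul_of_nonneg_left hY this).trans (mul_le_mul_of_nonneg_right hX hY0)

lemma congr (h : C1On S X Y g₁) (he : ∀ r ∈ S, g₂ r = g₁ r) : C1On S X Y g₂ := by
  obtain ⟨g', h1, h2, h3⟩ := h
  refine ⟨g', fun r hr => (h1 r hr).congr (fun y hy => he y hy) (he r hr), h2, fun r hr => ?_⟩
  rw [he r hr]
  exact h3 r hr

lemma zero (hX : 0 ≤ X) (hY : 0 ≤ Y) : C1On S X Y (fun _ => 0) :=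
  ⟨fun _ => 0, fun r _ => hasDerivWithinAt_const r S 0, continuousOn_const, fun r _ => by
    simp only [norm_zero]; exact ⟨hX, by positivity⟩⟩

lemma const (c : ℂ) (hX : ‖c‖ ≤ X) (hY : 0 ≤ Y) : C1On S X Y (fun _ => c) :=
  ⟨fun _ => 0, fun r _ => hasDerivWithinAt_const r S c, continuousOn_const, fun r _ => by
    have := (norm_nonneg c).trans hX
    simp only [norm_zero]; exact ⟨hX, by positivity⟩⟩

/-- The Leibniz rule: sizes multiply, logarithmic derivative bounds add up. -/
lemma mul (h₁ : C1On S X₁ Y₁ g₁) (h₂ : C1On S X₂ Y₂ g₂) :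
    C1On S (X₁ * X₂) (Y₁ + Y₂) (fun r => g₁ r * g₂ r) := by
  have c₁ := h₁.continuousOn
  have c₂ := h₂.continuousOn
  obtain ⟨g₁', d₁, e₁, b₁⟩ := h₁
  obtain ⟨g₂', d₂, e₂, b₂⟩ := h₂
  refine ⟨fun r => g₁' r * g₂ r + g₁ r * g₂' r, fun r hr => (d₁ r hr).mul (d₂ r hr),
    (e₁.mul c₂).add (c₁.mul e₂), fun r hr => ?_⟩
  obtain ⟨u₁, v₁⟩ := b₁ r hr
  obtain ⟨u₂, v₂⟩ := b₂ r hr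
  have n₁ := (norm_nonneg _).trans u₁
  constructor
  · rw [norm_mul]; exact mul_le_mul u₁ u₂ (norm_nonneg _) n₁
  · calc ‖g₁' r * g₂ r + g₁ r * g₂' r‖ ≤ ‖g₁' r‖ * ‖g₂ r‖ + ‖g₁ r‖ * ‖g₂' r‖ := by
          rw [← norm_mul, ← norm_mul]; exact norm_add_le _ _
      _ ≤ (X₁ * Y₁) * X₂ + X₁ * (X₂ * Y₂) := by
          gcongr
          exact (norm_nonneg _).trans v₁
      _ = _ := by ring

lemma add (h₁ : C1On S X₁ Y g₁) (h₂ : C1On S X₂ Y g₂) :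
    C1On S (X₁ + X₂) Y (fun r => g₁ r + g₂ r) := by
  obtain ⟨g₁', d₁, e₁, b₁⟩ := h₁
  obtain ⟨g₂', d₂, e₂, b₂⟩ := h₂
  refine ⟨fun r => g₁' r + g₂' r, fun r hr => (d₁ r hr).add (d₂ r hr), e₁.add e₂,
    fun r hr => ⟨(norm_add_le _ _).trans (add_le_add (b₁ r hr).1 (b₂ r hr).1), ?_⟩⟩
  rw [add_mul]
  exact (norm_add_le _ _).trans (add_le_add (b₁ r hr).2 (b₂ r hr).2)

lemma const_mul (c : ℂ) (h : C1On S X Y g) : C1On S (‖c‖ * X) Y (fun r => c * g r) := by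
  obtain ⟨g', d, e, b⟩ := h
  refine ⟨fun r => c * g' r, fun r hr => (d r hr).const_mul c, e.const_smul c, fun r hr => ?_⟩
  rw [norm_mul, norm_mul, mul_assoc]
  exact ⟨mul_le_mul_of_nonneg_left (b r hr).1 (norm_nonneg _),
    mul_le_mul_of_nonneg_left (b r hr).2 (norm_nonneg _)⟩

lemma sum {ι : Type*} (s : Finset ι) {g : ι → ℝ → ℂ} {X : ι → ℝ} (hY : 0 ≤ Y)
    (h : ∀ i ∈ s, C1On S (X i) Y (g i)) : C1On S (∑ i ∈ s, X i) Y (fun r => ∑ i ∈ s, g i r) := by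
  classical
  induction s using Finset.induction_on with
  | empty => simpa using zero le_rfl hY
  | insert a s ha ih =>
    simp only [Finset.sum_insert ha]
    exact (h a (Finset.mem_insert_self _ _)).add
      (ih fun i hi => h i (Finset.mem_insert_of_mem hi))

/-- Reparametrization by an affine map `r ↦ e + ρ (r + s)` of `[0,1]` into `[0,∞)`. -/
lemma comp_affine (h : C1On (Set.Ici 0) X Y g) {e ρ s : ℝ} (he : 0 ≤ e) (hρ : 0 ≤ ρ)
    (hs : 0 ≤ s) : C1On (Set.Icc 0 1) X (ρ * Y) (fun r => g (e + ρ * (r + s))) := by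
  obtain ⟨g', d, c, b⟩ := h
  have hm : Set.MapsTo (fun r : ℝ => e + ρ * (r + s)) (Set.Icc 0 1) (Set.Ici 0) := fun r hr => by
    have := hr.1
    simp only [Set.mem_Ici]; positivity
  refine ⟨fun r => ρ * g' (e + ρ * (r + s)), fun r hr => ?_, ?_, fun r hr => ?_⟩
  · have h1 : HasDerivWithinAt (fun r : ℝ => e + ρ * (r + s)) ρ (Set.Icc 0 1) r := by
      have := (((hasDerivAt_id r).add_const s).const_mul ρ).const_add e
      simpa using this.hasDerivWithinAt
    have := (d _ (hm hr)).scomp r h1 hm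
    simpa [Function.comp_def] using this
  · exact continuousOn_const.mul (c.comp (by fun_prop) hm)
  · obtain ⟨b1, b2⟩ := b _ (hm hr)
    refine ⟨b1, ?_⟩
    rw [norm_mul, Complex.norm_real, Real.norm_of_nonneg hρ]
    nlinarith [mul_le_mul_of_nonneg_left b2 hρ]

end C1On

/-- The slopes of a `C1On` function are bounded by the bound on the derivative. -/
lemma C1On.norm_sub_le {X Y : ℝ} {g : ℝ → ℂ} (h : C1On (Set.Icc 0 1) X Y g) {r s : ℝ}
    (hr : r ∈ Set.Icc (0 : ℝ) 1) (hs : s ∈ Set.Icc (0 : ℝ) 1) :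
    ‖g s - g r‖ ≤ X * Y * ‖s - r‖ := by
  obtain ⟨g', d, -, b⟩ := h
  exact (convex_Icc 0 1).norm_image_sub_le_of_norm_hasDerivWithin_le d (fun x hx => (b x hx).2)
    hr hs

lemma C1On.hasDerivWithinAt {X Y : ℝ} {g : ℝ → ℂ} (h : C1On (Set.Icc 0 1) X Y g) {r : ℝ}
    (hr : r ∈ Set.Icc (0 : ℝ) 1) :
    HasDerivWithinAt g (derivWithin g (Set.Icc 0 1) r) (Set.Icc 0 1) r := by
  obtain ⟨g', d, -, -⟩ := h
  exact (d r hr).differentiableWithinAt.hasDerivWithinAt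

lemma C1On.norm_derivWithin_le {X Y : ℝ} {g : ℝ → ℂ} (h : C1On (Set.Icc 0 1) X Y g) {r : ℝ}
    (hr : r ∈ Set.Icc (0 : ℝ) 1) : ‖derivWithin g (Set.Icc 0 1) r‖ ≤ X * Y := by
  obtain ⟨g', d, -, b⟩ := h
  rw [(d r hr).derivWithin (uniqueDiffOn_Icc_zero_one r hr)]
  exact (b r hr).2

lemma C1On.continuousOn_derivWithin {X Y : ℝ} {g : ℝ → ℂ} (h : C1On (Set.Icc 0 1) X Y g) :
    ContinuousOn (derivWithin g (Set.Icc 0 1)) (Set.Icc 0 1) := by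
  obtain ⟨g', d, c, -⟩ := h
  exact c.congr fun r hr => (d r hr).derivWithin (uniqueDiffOn_Icc_zero_one r hr)

lemma C1On.contDiffOn {X Y : ℝ} {g : ℝ → ℂ} (h : C1On (Set.Icc 0 1) X Y g) :
    ContDiffOn ℝ 1 g (Set.Icc 0 1) := by
  rw [show (1 : WithTop ℕ∞) = 0 + 1 from (zero_add 1).symm,
    contDiffOn_succ_iff_derivWithin uniqueDiffOn_Icc_zero_one]
  refine ⟨fun r hr => (h.hasDerivWithinAt hr).differentiableWithinAt, by simp, ?_⟩
  exact contDiffOn_zero.2 h.continuousOn_derivWithin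

lemma C1On.of_contDiffOn {X Y : ℝ} {g : ℝ → ℂ} (h : ContDiffOn ℝ 1 g (Set.Icc 0 1))
    (hb : ∀ r ∈ Set.Icc (0 : ℝ) 1, ‖g r‖ ≤ X)
    (hd : ∀ r ∈ Set.Icc (0 : ℝ) 1, ‖derivWithin g (Set.Icc 0 1) r‖ ≤ X * Y) :
    C1On (Set.Icc 0 1) X Y g :=
  ⟨derivWithin g (Set.Icc 0 1), fun r hr => (h.differentiableOn (by simp) r hr).hasDerivWithinAt,
    h.continuousOn_derivWithin uniqueDiffOn_Icc_zero_one (by simp), fun r hr => ⟨hb r hr, hd r hr⟩⟩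

/-- The points `r' ≠ r` of `[0,1]` accumulate at each `r ∈ [0,1]`. -/
lemma neBot_nhdsWithin_diff {r : ℝ} (hr : r ∈ Set.Icc (0 : ℝ) 1) :
    (𝓝[Set.Icc (0 : ℝ) 1 \ {r}] r).NeBot := by
  have := uniqueDiffOn_Icc_zero_one r hr
  exact accPt_principal_iff_nhdsWithin.1 this.accPt

/-- Differentiation under the integral sign for a family of `C1On` functions. -/
lemma C1On.integral {α : Type*} [MeasurableSpace α] {μ : Measure α} {g : α → ℝ → ℂ} {X : α → ℝ}
    {Y : ℝ} (hX : Integrable X μ) (hm : ∀ r, AEStronglyMeasurable (fun a => g a r) μ)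
    (h : ∀ a, C1On (Set.Icc 0 1) (X a) Y (g a)) :
    C1On (Set.Icc 0 1) (∫ a, X a ∂μ) Y (fun r => ∫ a, g a r ∂μ) := by
  have hi : ∀ r ∈ Set.Icc (0 : ℝ) 1, Integrable (fun a => g a r) μ := fun r hr =>
    hX.mono' (hm r) (Eventually.of_forall fun a => (h a).bound hr)
  have hslope : ∀ a, ∀ r ∈ Set.Icc (0 : ℝ) 1, Tendsto (fun s => slope (g a) r s)
      (𝓝[Set.Icc (0 : ℝ) 1 \ {r}] r) (𝓝 (derivWithin (g a) (Set.Icc 0 1) r)) := fun a r hr =>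
    hasDerivWithinAt_iff_tendsto_slope.1 ((h a).hasDerivWithinAt hr)
  have hdm : ∀ r ∈ Set.Icc (0 : ℝ) 1,
      AEStronglyMeasurable (fun a => derivWithin (g a) (Set.Icc 0 1) r) μ := fun r hr => by
    have := neBot_nhdsWithin_diff hr
    refine aestronglyMeasurable_of_tendsto_ae (𝓝[Set.Icc (0 : ℝ) 1 \ {r}] r)
      (f := fun s a => slope (g a) r s) (fun s => ?_)
      (Eventually.of_forall fun a => hslope a r hr)
    simp only [slope, vsub_eq_sub]
    exact ((hm s).sub (hm r)).const_smul _
  refine ⟨fun r => ∫ a, derivWithin (g a) (Set.Icc 0 1) r ∂μ, fun r hr => ?_, ?_, fun r hr => ?_⟩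
  · rw [hasDerivWithinAt_iff_tendsto_slope]
    have key : Tendsto (fun s => ∫ a, slope (g a) r s ∂μ) (𝓝[Set.Icc (0 : ℝ) 1 \ {r}] r)
        (𝓝 (∫ a, derivWithin (g a) (Set.Icc 0 1) r ∂μ)) := by
      refine tendsto_integral_filter_of_dominated_convergence (fun a => X a * Y) ?_ ?_
        (hX.mul_const Y) (Eventually.of_forall fun a => hslope a r hr)
      · refine Eventually.of_forall fun s => ?_
        simp only [slope, vsub_eq_sub]
        exact ((hm s).sub (hm r)).const_smul _
      · filter_upwards [self_mem_nhdsWithin] with s hs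
        refine Eventually.of_forall fun a => ?_
        have hne : s - r ≠ 0 := sub_ne_zero.2 hs.2
        rw [slope, vsub_eq_sub, norm_smul, norm_inv, inv_mul_le_iff₀ (norm_pos_iff.2 hne), mul_comm]
        exact (h a).norm_sub_le hr hs.1
    refine key.congr' ?_
    filter_upwards [self_mem_nhdsWithin] with s hs
    simp only [slope, vsub_eq_sub]
    rw [integral_smul, integral_sub (hi s hs.1) (hi r hr)]
  · intro r hr
    refine tendsto_integral_filter_of_dominated_convergence (fun a => X a * Y) ?_ ?_
        (hX.mul_const Y) (Eventually.of_forall fun a => (h a).continuousOn_derivWithin r hr)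
    · filter_upwards [self_mem_nhdsWithin] with s hs using hdm s hs
    · filter_upwards [self_mem_nhdsWithin] with s hs
      exact Eventually.of_forall fun a => (h a).norm_derivWithin_le hs
  · constructor
    · exact norm_integral_le_of_norm_le hX (Eventually.of_forall fun a => (h a).bound hr)
    · rw [← integral_mul_const]
      exact norm_integral_le_of_norm_le (hX.mul_const Y)
        (Eventually.of_forall fun a => (h a).norm_derivWithin_le hr)

lemma C1On.summable {ι : Type*} {g : ι → ℝ → ℂ} {X : ι → ℝ} {Y : ℝ} (hX : Summable X)
    (h : ∀ i, C1On (Set.Icc 0 1) (X i) Y (g i)) {r : ℝ} (hr : r ∈ Set.Icc (0 : ℝ) 1) :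
    Summable fun i => g i r :=
  Summable.of_norm_bounded hX fun i => (h i).bound hr

/-- Termwise differentiation of a series of `C1On` functions. -/
lemma C1On.hasDerivWithinAt_tsum {ι : Type*} {g : ι → ℝ → ℂ} {X : ι → ℝ} {Y : ℝ} (hX : Summable X)
    (h : ∀ i, C1On (Set.Icc 0 1) (X i) Y (g i)) {r : ℝ} (hr : r ∈ Set.Icc (0 : ℝ) 1) :
    HasDerivWithinAt (fun r => ∑' i, g i r) (∑' i, derivWithin (g i) (Set.Icc 0 1) r)
      (Set.Icc 0 1) r := by
  rw [hasDerivWithinAt_iff_tendsto_slope]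
  have key : Tendsto (fun s => ∑' i, slope (g i) r s) (𝓝[Set.Icc (0 : ℝ) 1 \ {r}] r)
      (𝓝 (∑' i, derivWithin (g i) (Set.Icc 0 1) r)) := by
    refine tendsto_tsum_of_dominated_convergence (hX.mul_right Y) (fun i =>
      hasDerivWithinAt_iff_tendsto_slope.1 ((h i).hasDerivWithinAt hr)) ?_
    filter_upwards [self_mem_nhdsWithin] with s hs i
    have hne : s - r ≠ 0 := sub_ne_zero.2 hs.2
    rw [slope, vsub_eq_sub, norm_smul, norm_inv, inv_mul_le_iff₀ (norm_pos_iff.2 hne), mul_comm]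
    exact (h i).norm_sub_le hr hs.1
  refine key.congr' ?_
  filter_upwards [self_mem_nhdsWithin] with s hs
  simp only [slope, vsub_eq_sub]
  rw [← (C1On.summable hX h hs.1).tsum_sub (C1On.summable hX h hr), tsum_const_smul'']

lemma C1On.tsum {ι : Type*} {g : ι → ℝ → ℂ} {X : ι → ℝ} {Y : ℝ} (hX : Summable X)
    (h : ∀ i, C1On (Set.Icc 0 1) (X i) Y (g i)) :
    C1On (Set.Icc 0 1) (∑' i, X i) Y (fun r => ∑' i, g i r) := by
  refine ⟨fun r => ∑' i, derivWithin (g i) (Set.Icc 0 1) r,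
    fun r hr => C1On.hasDerivWithinAt_tsum hX h hr, ?_, fun r hr => ?_⟩
  · intro r hr
    refine tendsto_tsum_of_dominated_convergence (hX.mul_right Y)
      (fun i => (h i).continuousOn_derivWithin r hr) ?_
    filter_upwards [self_mem_nhdsWithin] with s hs i using (h i).norm_derivWithin_le hs
  · constructor
    · exact tsum_of_norm_bounded hX.hasSum fun i => (h i).bound hr
    · rw [← hX.tsum_mul_right Y]
      exact tsum_of_norm_bounded (hX.mul_right Y).hasSum fun i => (h i).norm_derivWithin_le hr

/-! ### Measure theory of momenta -/

/-- Null sets pull back to null sets under surjective linear maps. -/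
lemma ae_comp_of_surjective {E F : Type*} [NormedAddCommGroup E] [NormedSpace ℝ E]
    [FiniteDimensional ℝ E] [MeasurableSpace E] [BorelSpace E]
    [NormedAddCommGroup F] [NormedSpace ℝ F] [MeasurableSpace F] [BorelSpace F]
    {μ : Measure E} {ν : Measure F} [μ.IsAddHaarMeasure] [ν.IsAddHaarMeasure]
    (T : E →ₗ[ℝ] F) (hT : Function.Surjective T) {p : F → Prop} (h : ∀ᵐ y ∂ν, p y) :
    ∀ᵐ x ∂μ, p (T x) := by
  have hs : ∀ᵐ y ∂ν, y ∈ (toMeasurable ν {y | ¬ p y})ᶜ := by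
    rw [ae_iff]
    simp only [Set.mem_compl_iff, not_not, Set.ofPred_mem_eq, measure_toMeasurable]
    exact ae_iff.1 h
  rw [← ae_comp_linearMap_mem_iff T μ ν hT (measurableSet_toMeasurable _ _).compl] at hs
  filter_upwards [hs] with x hx
  by_contra hn
  exact hx (subset_toMeasurable ν _ hn)

-- The four instances below shorten the instance search on iterated products of momentum spaces.

instance isAddHaarMeasure_prod_volume {E F : Type*}
    [AddGroup E] [TopologicalSpace E] [MeasureSpace E] [BorelSpace E]
    [(volume : Measure E).IsAddHaarMeasure] [SFinite (volume : Measure E)]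
    [AddGroup F] [TopologicalSpace F] [MeasureSpace F] [BorelSpace F]
    [(volume : Measure F).IsAddHaarMeasure] [SFinite (volume : Measure F)]
    [ContinuousAdd E] [ContinuousAdd F] :
    (volume : Measure (E × F)).IsAddHaarMeasure :=
  Measure.prod.instIsAddHaarMeasure volume volume

instance sFinite_prod_volume {E F : Type*} [MeasureSpace E] [SFinite (volume : Measure E)]
    [MeasureSpace F] [SFinite (volume : Measure F)] : SFinite (volume : Measure (E × F)) :=
  inferInstanceAs (SFinite ((volume : Measure E).prod (volume : Measure F)))

instance isAddHaarMeasure_pi_volume (n : ℕ) :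
    (volume : Measure (Fin n → E3)).IsAddHaarMeasure := inferInstance

instance sFinite_pi_volume (n : ℕ) : SFinite (volume : Measure (Fin n → E3)) := inferInstance

/-- The one-particle density `|x|⁻² / 4π` on the unit ball, which has total mass one. -/
def unitDensity (x : E3) : ℝ :=
  (Metric.ball (0 : E3) 1).indicator (fun x => ‖x‖ ^ (-2 : ℝ) / (4 * Real.pi)) x

lemma integral_unitDensity : ∫ x, unitDensity x = 1 := by
  have h1 : unitDensity = fun x : E3 => (fun y : ℝ => (Set.Iio 1).indicator
      (fun y => y ^ (-2 : ℝ) / (4 * Real.pi)) y) ‖x‖ := by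
    funext x
    simp [unitDensity, Set.indicator]
  rw [h1, integral_fun_norm_addHaar volume (fun y : ℝ => (Set.Iio 1).indicator
      (fun y => y ^ (-2 : ℝ) / (4 * Real.pi)) y)]
  have h2 : ∫ y in Set.Ioi (0 : ℝ), y ^ (Module.finrank ℝ E3 - 1) • (Set.Iio (1 : ℝ)).indicator
      (fun y => y ^ (-2 : ℝ) / (4 * Real.pi)) y = 1 / (4 * Real.pi) := by
    have : ∀ y ∈ Set.Ioi (0 : ℝ), y ^ (Module.finrank ℝ E3 - 1) • (Set.Iio (1 : ℝ)).indicator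
      (fun y => y ^ (-2 : ℝ) / (4 * Real.pi)) y =
        (Set.Ioo (0 : ℝ) 1).indicator (fun _ => 1 / (4 * Real.pi)) y := by
      intro y hy
      have hy0 : (0 : ℝ) < y := hy
      by_cases h : y < 1
      · have e : y ^ 2 * y ^ (-2 : ℝ) = 1 := by
          rw [Real.rpow_neg hy0.le, Real.rpow_two]
          field_simp
        simp only [Set.indicator, Set.mem_Iio, h, Set.mem_Ioo, hy0, and_self, if_true, smul_eq_mul]
        rw [finrank_euclideanSpace, Fintype.card_fin, ← mul_div_assoc, e]
      · simp [h, Set.indicator]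
    rw [setIntegral_congr_fun measurableSet_Ioi this, setIntegral_indicator measurableSet_Ioo]
    simp [Set.inter_eq_right.2 (Set.Ioo_subset_Ioi_self), Set.inter_comm]
  rw [h2]
  have h3 : (volume : Measure E3).real (Metric.ball 0 1) = Real.pi * 4 / 3 := by
    rw [Measure.real, EuclideanSpace.volume_ball_fin_three]
    simp
    positivity
  rw [h3, finrank_euclideanSpace, Fintype.card_fin]
  have := Real.pi_ne_zero
  simp only [nsmul_eq_mul, smul_eq_mul]
  push_cast
  field_simp

lemma integrable_unitDensity : Integrable unitDensity := by
  by_contra h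
  have := integral_unitDensity
  rw [integral_undef h] at this
  exact zero_ne_one this

lemma measurableSet_ballPow (p : ℕ) : MeasurableSet (ballPow p) := by
  have : ballPow p = Set.univ.pi fun _ => Metric.ball 0 1 := by
    ext; simp [ballPow]
  rw [this]
  exact MeasurableSet.univ_pi fun _ => Metric.isOpen_ball.measurableSet

lemma measurable_weight (p : ℕ) : Measurable (weight (p := p)) := by
  refine Measurable.indicator ?_ (measurableSet_ballPow p)
  refine Complex.measurable_ofReal.comp ?_
  fun_prop

lemma norm_weight_eq {p : ℕ} (x : Fin p → E3) :
    ‖weight x‖ = ∏ i, (Metric.ball (0 : E3) 1).indicator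
      (fun x => ‖x‖ ^ (-(1 / 2) : ℝ) / (4 * Real.pi)) (x i) := by
  unfold weight
  by_cases h : x ∈ ballPow p
  · rw [Set.indicator_of_mem h, Complex.norm_real, Real.norm_of_nonneg (by positivity)]
    refine Finset.prod_congr rfl fun i _ => ?_
    rw [Set.indicator_of_mem]
    simpa using h i
  · rw [Set.indicator_of_notMem h, norm_zero]
    simp only [ballPow, Set.mem_ofPred_eq, not_forall] at h
    obtain ⟨i, hi⟩ := h
    rw [eq_comm, Finset.prod_eq_zero (Finset.mem_univ i)]
    rw [Set.indicator_of_notMem]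
    simpa using hi

/-- The product of the weights `|x_i|^{-3/2}`. Multiplied by the form factor `|x|^{-1/2}/4π` of the
interaction it gives the density `unitDensity` of total mass one. -/
def singWeight {n : ℕ} (κ : Fin n → E3) : ℝ := ∏ i, ‖κ i‖ ^ (-(3 / 2) : ℝ)

lemma singWeight_nonneg {n : ℕ} (κ : Fin n → E3) : 0 ≤ singWeight κ :=
  Finset.prod_nonneg fun _ _ => by positivity

lemma singWeight_cons {n : ℕ} (x : E3) (κ : Fin n → E3) :
    singWeight (Fin.cons x κ : Fin (n + 1) → E3) = ‖x‖ ^ (-(3 / 2) : ℝ) * singWeight κ := by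
  simp [singWeight, Fin.prod_univ_succ]

lemma singWeight_removeNth {n : ℕ} (κ : Fin (n + 1) → E3) (j : Fin (n + 1)) :
    singWeight κ = ‖κ j‖ ^ (-(3 / 2) : ℝ) * singWeight (j.removeNth κ) := by
  simp [singWeight, Fin.prod_univ_succAbove _ j, Fin.removeNth]

-- At `x i = 0` both sides vanish, since `0 ^ a = 0` for `a ≠ 0`.
lemma norm_weight_mul_singWeight {q : ℕ} (x : Fin q → E3) :
    ‖weight x‖ * singWeight x = ∏ i, unitDensity (x i) := by
  rw [norm_weight_eq, singWeight, ← Finset.prod_mul_distrib]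
  refine Finset.prod_congr rfl fun i _ => ?_
  unfold unitDensity
  by_cases h : x i ∈ Metric.ball (0 : E3) 1
  · rw [Set.indicator_of_mem h, Set.indicator_of_mem h]
    rcases eq_or_ne (x i) 0 with h0 | h0
    · rw [h0, norm_zero, Real.zero_rpow (by norm_num), Real.zero_rpow (by norm_num)]; simp
    · have : 0 < ‖x i‖ := norm_pos_iff.2 h0
      rw [div_mul_eq_mul_div, ← Real.rpow_add this]
      norm_num
  · rw [Set.indicator_of_notMem h, Set.indicator_of_notMem h, zero_mul]

lemma integrable_weight_singWeight (q : ℕ) :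
    Integrable (fun x : Fin q → E3 => ‖weight x‖ * singWeight x) := by
  simp only [norm_weight_mul_singWeight]
  exact Integrable.fintype_prod (fun _ => integrable_unitDensity)

lemma integral_weight_singWeight (q : ℕ) :
    ∫ x : Fin q → E3, ‖weight x‖ * singWeight x = 1 := by
  simp only [norm_weight_mul_singWeight]
  rw [integral_fintype_prod_volume_eq_pow, integral_unitDensity, one_pow]

lemma sumNorm_nonneg {n : ℕ} (k : Fin n → E3) : 0 ≤ sumNorm k :=
  Finset.sum_nonneg fun _ _ => norm_nonneg _

lemma continuous_sumNorm (n : ℕ) : Continuous (sumNorm (n := n)) := by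
  unfold sumNorm
  fun_prop

lemma measurable_sumNorm (n : ℕ) : Measurable (sumNorm (n := n)) :=
  (continuous_sumNorm n).measurable

lemma sumNorm_cons {n : ℕ} (x : E3) (κ : Fin n → E3) :
    sumNorm (Fin.cons x κ : Fin (n + 1) → E3) = ‖x‖ + sumNorm κ := by
  simp [sumNorm, Fin.sum_univ_succ]

lemma sumNorm_removeNth {n : ℕ} (κ : Fin (n + 1) → E3) (j : Fin (n + 1)) :
    sumNorm κ = ‖κ j‖ + sumNorm (j.removeNth κ) := by
  simp [sumNorm, Fin.sum_univ_succAbove _ j, Fin.removeNth]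

lemma sumNorm_append {p m : ℕ} (x : Fin p → E3) (k : Fin m → E3) :
    sumNorm (Fin.append x k) = sumNorm x + sumNorm k := by
  simp [sumNorm, Fin.sum_univ_add]

lemma sumNorm_smul {m : ℕ} {ρ : ℝ} (hρ : 0 ≤ ρ) (k : Fin m → E3) :
    sumNorm (ρ • k) = ρ * sumNorm k := by
  simp [sumNorm, norm_smul, Finset.mul_sum, abs_of_nonneg hρ]

lemma measurable_append {α : Type*} [MeasurableSpace α] {p m : ℕ} {f : α → Fin p → E3}
    {g : α → Fin m → E3} (hf : Measurable f) (hg : Measurable g) :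
    Measurable fun a => Fin.append (f a) (g a) := by
  refine measurable_pi_iff.2 fun i => ?_
  refine Fin.addCases (fun i => ?_) (fun i => ?_) i
  · simp only [Fin.append_left]; exact (measurable_pi_apply i).comp hf
  · simp only [Fin.append_right]; exact (measurable_pi_apply i).comp hg

lemma measurable_cons {α : Type*} [MeasurableSpace α] {n : ℕ} {f : α → E3}
    {g : α → Fin n → E3} (hf : Measurable f) (hg : Measurable g) :
    Measurable fun a => (Fin.cons (f a) (g a) : Fin (n + 1) → E3) := by
  refine measurable_pi_iff.2 fun i => ?_
  refine Fin.cases ?_ (fun i => ?_) i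
  · simpa using hf
  · simp only [Fin.cons_succ]; exact (measurable_pi_apply i).comp hg

/-! ### Kernels and the norms `‖·‖^#` -/

/-- Functions of one energy and `m + n` momenta. -/
abbrev KerFun (m n : ℕ) : Type := ℝ → (Fin m → E3) → (Fin n → E3) → ℂ

lemma ae_momentumMeasure {m n : ℕ} {p : (Fin m → E3) × (Fin n → E3) → Prop} :
    (∀ᵐ K ∂(momentumMeasure m n), p K) ↔
      ∀ᵐ K : (Fin m → E3) × (Fin n → E3), K ∈ ballPow m ×ˢ ballPow n → p K :=
  ae_restrict_iff' ((measurableSet_ballPow m).prod (measurableSet_ballPow n))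

section Norms

variable {m n : ℕ} {f g : KerFun m n}

lemma supNorm_le {c : ENNReal}
    (h : ∀ᵐ K ∂(momentumMeasure m n), ∀ r ∈ Set.Icc (0 : ℝ) 1, ‖f r K.1 K.2‖ₑ ≤ c) :
    supNorm f ≤ c :=
  essSup_le_of_ae_le c (h.mono fun _ hK => iSup₂_le hK)

lemma ae_le_supNorm (f : KerFun m n) :
    ∀ᵐ K ∂(momentumMeasure m n), ∀ r ∈ Set.Icc (0 : ℝ) 1, ‖f r K.1 K.2‖ₑ ≤ supNorm f := by
  filter_upwards [ENNReal.ae_le_essSup (μ := momentumMeasure m n)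
    (fun K => ⨆ r ∈ Set.Icc (0 : ℝ) 1, ‖f r K.1 K.2‖ₑ)] with K hK r hr
  exact (le_iSup₂ (f := fun r (_ : r ∈ Set.Icc (0 : ℝ) 1) => ‖f r K.1 K.2‖ₑ) r hr).trans hK

/-- The elements of `𝒲^#_{m,n}` without the symmetry requirement. -/
structure MemPre (f : KerFun m n) : Prop where
  meas : ∀ r ∈ Set.Icc (0 : ℝ) 1,
    AEStronglyMeasurable (fun K : (Fin m → E3) × (Fin n → E3) => f r K.1 K.2)
      (momentumMeasure m n)
  contDiff : ∀ᵐ K ∂(momentumMeasure m n),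
    ContDiffOn ℝ 1 (fun r => f r K.1 K.2) (Set.Icc 0 1)
  support : ∀ᵐ K ∂(momentumMeasure m n), ∀ r ∈ Set.Icc (0 : ℝ) 1,
    1 - max (sumNorm K.1) (sumNorm K.2) < r → f r K.1 K.2 = 0
  norm_lt_top : sharpNorm f < ⊤

lemma MemSharp.memPre (h : MemSharp f) : MemPre f :=
  ⟨h.meas, h.contDiff, h.support, h.norm_lt_top⟩

lemma MemPre.differentiable (h : MemPre f) : ∀ᵐ K ∂(momentumMeasure m n),
    ∀ r ∈ Set.Icc (0 : ℝ) 1, DifferentiableWithinAt ℝ (fun r => f r K.1 K.2) (Set.Icc 0 1) r :=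
  h.contDiff.mono fun _ hK => hK.differentiableOn (by simp)

lemma MemPre.ae_c1On (h : MemPre f) : ∀ᵐ K ∂(momentumMeasure m n),
    C1On (Set.Icc 0 1) (sharpNorm f).toReal 1 (fun r => f r K.1 K.2) := by
  filter_upwards [h.contDiff, ae_le_supNorm f, ae_le_supNorm (dr f)] with K h1 h2 h3
  have hle : ∀ {c : ENNReal} {z : ℂ}, ‖z‖ₑ ≤ c → c ≤ sharpNorm f → ‖z‖ ≤ (sharpNorm f).toReal :=
    fun {c z} hz hc => by
      rw [← toReal_enorm]
      exact ENNReal.toReal_mono h.norm_lt_top.ne (hz.trans hc)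
  refine C1On.of_contDiffOn h1 (fun r hr => hle (h2 r hr) le_self_add) fun r hr => ?_
  rw [mul_one]
  exact hle (h3 r hr) le_add_self

lemma sharpNorm_le_of_c1On {X Y : ℝ} (hX : 0 ≤ X) (hY : 0 ≤ Y)
    (h : ∀ᵐ K ∂(momentumMeasure m n), C1On (Set.Icc 0 1) X Y (fun r => f r K.1 K.2)) :
    sharpNorm f ≤ ENNReal.ofReal (X * (1 + Y)) := by
  rw [mul_add, mul_one, ENNReal.ofReal_add hX (by positivity)]
  refine add_le_add (supNorm_le (h.mono fun K hK r hr => ?_))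
    (supNorm_le (h.mono fun K hK r hr => ?_))
  · rw [← ofReal_norm]; exact ENNReal.ofReal_le_ofReal (hK.bound hr)
  · rw [← ofReal_norm]; exact ENNReal.ofReal_le_ofReal (hK.norm_derivWithin_le hr)

lemma MemPre.of_c1On {X Y : ℝ} (hX : 0 ≤ X) (hY : 0 ≤ Y)
    (hm : ∀ r ∈ Set.Icc (0 : ℝ) 1,
      AEStronglyMeasurable (fun K : (Fin m → E3) × (Fin n → E3) => f r K.1 K.2)
        (momentumMeasure m n))
    (h : ∀ᵐ K ∂(momentumMeasure m n), C1On (Set.Icc 0 1) X Y (fun r => f r K.1 K.2))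
    (hs : ∀ᵐ K ∂(momentumMeasure m n), ∀ r ∈ Set.Icc (0 : ℝ) 1,
      1 - max (sumNorm K.1) (sumNorm K.2) < r → f r K.1 K.2 = 0) : MemPre f :=
  ⟨hm, h.mono fun _ hK => hK.contDiffOn, hs,
    (sharpNorm_le_of_c1On hX hY h).trans_lt ENNReal.ofReal_lt_top⟩

lemma supNorm_congr (h : ∀ᵐ K ∂(momentumMeasure m n), ∀ r ∈ Set.Icc (0 : ℝ) 1,
    f r K.1 K.2 = g r K.1 K.2) : supNorm f = supNorm g :=
  essSup_congr_ae (h.mono fun K hK => by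
    simp only
    exact iSup_congr fun r => iSup_congr fun hr => by rw [hK r hr])

lemma sharpNorm_congr (h : ∀ᵐ K ∂(momentumMeasure m n), ∀ r ∈ Set.Icc (0 : ℝ) 1,
    f r K.1 K.2 = g r K.1 K.2) : sharpNorm f = sharpNorm g := by
  unfold sharpNorm
  rw [supNorm_congr h]
  congr 1
  exact supNorm_congr (h.mono fun K hK r hr => derivWithin_congr (fun s hs => hK s hs) (hK r hr))

lemma MemPre.congr (hf : MemPre f) (h : ∀ᵐ K ∂(momentumMeasure m n), ∀ r ∈ Set.Icc (0 : ℝ) 1,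
    g r K.1 K.2 = f r K.1 K.2) : MemPre g where
  meas r hr := (hf.meas r hr).congr (h.mono fun K hK => (hK r hr).symm)
  contDiff := by
    filter_upwards [h, hf.contDiff] with K hK h2 using h2.congr hK
  support := by
    filter_upwards [h, hf.support] with K hK h2 r hr hlt
    rw [hK r hr, h2 r hr hlt]
  norm_lt_top := by rw [sharpNorm_congr h]; exact hf.norm_lt_top

lemma sharpNorm_zero : sharpNorm (0 : KerFun m n) = 0 := by
  refine le_antisymm ?_ zero_le
  have := sharpNorm_le_of_c1On (f := (0 : KerFun m n)) le_rfl le_rfl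
    (Eventually.of_forall fun _ => C1On.zero le_rfl le_rfl)
  simpa using this

lemma memPre_zero : MemPre (0 : KerFun m n) :=
  MemPre.of_c1On le_rfl le_rfl (fun _ _ => aestronglyMeasurable_const)
    (Eventually.of_forall fun _ => C1On.zero le_rfl le_rfl)
    (Eventually.of_forall fun _ _ _ _ => rfl)

lemma MemPre.sharpNorm_add_le (hf : MemPre f) (hg : MemPre g) :
    sharpNorm (f + g) ≤ sharpNorm f + sharpNorm g := by
  unfold sharpNorm
  rw [add_add_add_comm]
  refine add_le_add (supNorm_le ?_) (supNorm_le ?_)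
  · filter_upwards [ae_le_supNorm f, ae_le_supNorm g] with K h1 h2 r hr
    exact (enorm_add_le _ _).trans (add_le_add (h1 r hr) (h2 r hr))
  · filter_upwards [ae_le_supNorm (dr f), ae_le_supNorm (dr g), hf.differentiable,
      hg.differentiable] with K h1 h2 h3 h4 r hr
    have : dr (f + g) r K.1 K.2 = dr f r K.1 K.2 + dr g r K.1 K.2 :=
      derivWithin_add (h3 r hr) (h4 r hr)
    rw [this]
    exact (enorm_add_le _ _).trans (add_le_add (h1 r hr) (h2 r hr))

lemma MemPre.add (hf : MemPre f) (hg : MemPre g) : MemPre (f + g) where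
  meas r hr := (hf.meas r hr).add (hg.meas r hr)
  contDiff := by
    filter_upwards [hf.contDiff, hg.contDiff] with K h1 h2 using h1.add h2
  support := by
    filter_upwards [hf.support, hg.support] with K h1 h2 r hr hlt
    simp [h1 r hr hlt, h2 r hr hlt]
  norm_lt_top := (hf.sharpNorm_add_le hg).trans_lt
    (ENNReal.add_lt_top.2 ⟨hf.norm_lt_top, hg.norm_lt_top⟩)

lemma sharpNorm_smul_le (c : ℂ) (f : KerFun m n) :
    sharpNorm (c • f) ≤ ‖c‖ₑ * sharpNorm f := by
  unfold sharpNorm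
  rw [mul_add]
  refine add_le_add (supNorm_le ?_) (supNorm_le ?_)
  · filter_upwards [ae_le_supNorm f] with K h1 r hr
    simp only [Pi.smul_apply, enorm_smul]
    gcongr
    exact h1 r hr
  · filter_upwards [ae_le_supNorm (dr f)] with K h1 r hr
    have : dr (c • f) r K.1 K.2 = c * dr f r K.1 K.2 := by
      simp only [dr, Pi.smul_apply, smul_eq_mul]
      exact derivWithin_const_mul_field c
    rw [this, enorm_mul]
    gcongr
    exact h1 r hr

lemma MemPre.smul (c : ℂ) (hf : MemPre f) : MemPre (c • f) where
  meas r hr := (hf.meas r hr).const_smul c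
  contDiff := by
    filter_upwards [hf.contDiff] with K h1 using h1.const_smul c
  support := by
    filter_upwards [hf.support] with K h1 r hr hlt
    simp [h1 r hr hlt]
  norm_lt_top := (sharpNorm_smul_le c f).trans_lt (ENNReal.mul_lt_top enorm_lt_top hf.norm_lt_top)

lemma MemPre.sub (hf : MemPre f) (hg : MemPre g) : MemPre (f - g) := by
  have := hf.add (hg.smul (-1))
  rwa [neg_one_smul, ← sub_eq_add_neg] at this

lemma MemPre.sum {ι : Type*} (s : Finset ι) {f : ι → KerFun m n} (h : ∀ i ∈ s, MemPre (f i)) :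
    MemPre (∑ i ∈ s, f i) ∧ sharpNorm (∑ i ∈ s, f i) ≤ ∑ i ∈ s, sharpNorm (f i) := by
  classical
  induction s using Finset.induction_on with
  | empty => simpa [sharpNorm_zero] using memPre_zero
  | insert a s ha ih =>
    simp only [Finset.sum_insert ha]
    obtain ⟨h1, h2⟩ := ih fun i hi => h i (Finset.mem_insert_of_mem hi)
    have h3 := h a (Finset.mem_insert_self _ _)
    exact ⟨h3.add h1, (h3.sharpNorm_add_le h1).trans (by gcongr)⟩

lemma MemSharp.smul (c : ℂ) (hf : MemSharp f) : MemSharp (c • f) := by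
  have := hf.memPre.smul c
  refine ⟨this.meas, this.contDiff, this.support, ?_, this.norm_lt_top⟩
  filter_upwards [hf.symm] with K h1 r hr π π'
  simp [h1 r hr π π']

end Norms

/-- A series of kernels that converges absolutely in `‖·‖^#` converges almost everywhere. -/
lemma ae_summable_of_tsum_sharpNorm {m n : ℕ} {ι : Type*} [Countable ι] {u : ι → KerFun m n}
    (h : ∀ i, MemPre (u i)) (hs : ∑' i, sharpNorm (u i) ≠ ⊤) :
    ∀ᵐ K ∂(momentumMeasure m n), ∀ r ∈ Set.Icc (0 : ℝ) 1, Summable fun i => u i r K.1 K.2 := by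
  filter_upwards [ae_all_iff.2 fun i => (h i).ae_c1On] with K hK r hr
  exact C1On.summable (ENNReal.summable_toReal hs) hK hr

/-- The sum of a series of kernels that converges absolutely in `‖·‖^#`. -/
lemma MemPre.tsum {m n : ℕ} {ι : Type*} [Countable ι] {u : ι → KerFun m n}
    (h : ∀ i, MemPre (u i)) (hs : ∑' i, sharpNorm (u i) ≠ ⊤) :
    MemPre (fun r k k' => ∑' i, u i r k k') ∧
      sharpNorm (fun r k k' => ∑' i, u i r k k') ≤ ∑' i, sharpNorm (u i) := by
  have hc := ae_all_iff.2 fun i => (h i).ae_c1On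
  have hS := ENNReal.summable_toReal hs
  have hle : sharpNorm (fun r k k' => ∑' i, u i r k k') ≤ ∑' i, sharpNorm (u i) := by
    unfold sharpNorm
    rw [ENNReal.tsum_add]
    refine add_le_add (supNorm_le ?_) (supNorm_le ?_)
    · filter_upwards [ae_all_iff.2 fun i => ae_le_supNorm (u i)] with K h2 r hr
      exact (enorm_tsum_le_tsum_enorm).trans (ENNReal.tsum_le_tsum fun i => h2 i r hr)
    · filter_upwards [hc, ae_all_iff.2 fun i => ae_le_supNorm (dr (u i))] with K h1 h2 r hr
      have : dr (fun r k k' => ∑' i, u i r k k') r K.1 K.2 = ∑' i, dr (u i) r K.1 K.2 :=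
        (C1On.hasDerivWithinAt_tsum hS h1 hr).derivWithin (uniqueDiffOn_Icc_zero_one r hr)
      rw [this]
      exact (enorm_tsum_le_tsum_enorm).trans (ENNReal.tsum_le_tsum fun i => h2 i r hr)
  refine ⟨⟨fun r hr => ?_, ?_, ?_, hle.trans_lt hs.lt_top⟩, hle⟩
  · have hsum := ae_summable_of_tsum_sharpNorm h hs
    refine aestronglyMeasurable_of_tendsto_ae (atTop : Filter (Finset ι))
      (f := fun s K => ∑ i ∈ s, u i r K.1 K.2) (fun s => ?_) ?_
    · exact Finset.aestronglyMeasurable_fun_sum _ fun i _ => (h i).meas r hr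
    · filter_upwards [hsum] with K hK using (hK r hr).hasSum
  · filter_upwards [hc] with K hK using (C1On.tsum hS hK).contDiffOn
  · filter_upwards [ae_all_iff.2 fun i => (h i).support] with K hK r hr hlt
    simp [fun i => hK i r hr hlt]

/-! ### Symmetrization -/

/-- Permuting momenta preserves the null sets of `B₁^m × B₁^n`. -/
lemma ae_comp_perm {m n : ℕ} (π : Equiv.Perm (Fin m)) (π' : Equiv.Perm (Fin n))
    {p : (Fin m → E3) × (Fin n → E3) → Prop} (h : ∀ᵐ K ∂(momentumMeasure m n), p K) :
    ∀ᵐ K ∂(momentumMeasure m n), p (fun i => K.1 (π i), fun i => K.2 (π' i)) := by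
  rw [ae_momentumMeasure] at h ⊢
  have := ae_comp_of_surjective (μ := (volume : Measure ((Fin m → E3) × (Fin n → E3))))
    ((LinearMap.funLeft ℝ E3 π).prodMap (LinearMap.funLeft ℝ E3 π'))
    (Prod.map_surjective.2 ⟨LinearMap.funLeft_surjective_of_injective ℝ E3 _ π.injective,
      LinearMap.funLeft_surjective_of_injective ℝ E3 _ π'.injective⟩) h
  filter_upwards [this] with K hK hb
  exact hK ⟨fun i => hb.1 _, fun i => hb.2 _⟩

lemma sumNorm_perm {m : ℕ} (π : Equiv.Perm (Fin m)) (k : Fin m → E3) :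
    sumNorm (fun i => k (π i)) = sumNorm k :=
  Equiv.sum_comp π fun i => ‖k i‖

lemma quasiMeasurePreserving_perm {m n : ℕ} (π : Equiv.Perm (Fin m)) (π' : Equiv.Perm (Fin n)) :
    Measure.QuasiMeasurePreserving
      (fun K : (Fin m → E3) × (Fin n → E3) =>
        ((fun i => K.1 (π i), fun i => K.2 (π' i)) : (Fin m → E3) × (Fin n → E3)))
      (momentumMeasure m n) (momentumMeasure m n) := by
  have hm : Measurable (fun K : (Fin m → E3) × (Fin n → E3) =>
        ((fun i => K.1 (π i), fun i => K.2 (π' i)) : (Fin m → E3) × (Fin n → E3))) := by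
    fun_prop
  refine ⟨hm, Measure.AbsolutelyContinuous.mk fun s hs h0 => ?_⟩
  rw [Measure.map_apply hm hs]
  have h1 : ∀ᵐ K ∂(momentumMeasure m n), K ∉ s := measure_eq_zero_iff_ae_notMem.1 h0
  exact measure_eq_zero_iff_ae_notMem.2 (ae_comp_perm π π' h1)

lemma MemPre.perm {m n : ℕ} {f : KerFun m n} (h : MemPre f) (π : Equiv.Perm (Fin m))
    (π' : Equiv.Perm (Fin n)) :
    MemPre (fun r k k' => f r (fun i => k (π i)) (fun j => k' (π' j))) ∧
      sharpNorm (fun r k k' => f r (fun i => k (π i)) (fun j => k' (π' j))) ≤ sharpNorm f := by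
  have hle : sharpNorm (fun r k k' => f r (fun i => k (π i)) (fun j => k' (π' j))) ≤
      sharpNorm f :=
    add_le_add (supNorm_le (ae_comp_perm π π' (ae_le_supNorm f)))
      (supNorm_le (ae_comp_perm π π' (ae_le_supNorm (dr f))))
  refine ⟨⟨fun r hr => ?_, ae_comp_perm π π' h.contDiff, ?_, hle.trans_lt h.norm_lt_top⟩, hle⟩
  · exact (h.meas r hr).comp_quasiMeasurePreserving (quasiMeasurePreserving_perm π π')
  · filter_upwards [ae_comp_perm π π' h.support] with K hK r hr hlt
    exact hK r hr (by simpa only [sumNorm_perm] using hlt)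

lemma symmetrize_apply (w : Kernel) (M N : ℕ) : symmetrize w M N =
    ((M.factorial : ℂ) * (N.factorial : ℂ))⁻¹ • ∑ π : Equiv.Perm (Fin M) × Equiv.Perm (Fin N),
      (fun r k k' => w M N r (fun i => k (π.1 i)) (fun j => k' (π.2 j)) : KerFun M N) := by
  funext r k k'
  simp only [symmetrize, Pi.smul_apply, Finset.sum_apply, smul_eq_mul]
  rw [Fintype.sum_prod_type]

/-- Symmetrization is an average over permutations, so it does not increase the norm. -/
lemma memSharp_symmetrize {w : Kernel} {M N : ℕ} (h : MemPre (w M N)) :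
    MemSharp (symmetrize w M N) ∧ sharpNorm (symmetrize w M N) ≤ sharpNorm (w M N) := by
  have h1 := MemPre.sum Finset.univ (f := fun π : Equiv.Perm (Fin M) × Equiv.Perm (Fin N) =>
    (fun r k k' => w M N r (fun i => k (π.1 i)) (fun j => k' (π.2 j)) : KerFun M N))
    (fun π _ => (h.perm π.1 π.2).1)
  have h2 : MemPre (symmetrize w M N) := by
    rw [symmetrize_apply]
    exact h1.1.smul _
  refine ⟨⟨h2.meas, h2.contDiff, h2.support, ?_, h2.norm_lt_top⟩, ?_⟩
  · refine Eventually.of_forall fun K r _ σ σ' => ?_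
    simp only [symmetrize]
    congr 1
    rw [← Equiv.sum_comp (Equiv.mulLeft σ)
      (fun π => ∑ π' : Equiv.Perm (Fin N), w M N r (fun i => K.1 (π i)) (fun j => K.2 (π' j)))]
    refine Finset.sum_congr rfl fun π _ => ?_
    rw [← Equiv.sum_comp (Equiv.mulLeft σ')
      (fun π' => w M N r _ (fun j => K.2 (π' j)))]
    rfl
  · rw [symmetrize_apply]
    refine (sharpNorm_smul_le _ _).trans ?_
    have h3 : ∑ π : Equiv.Perm (Fin M) × Equiv.Perm (Fin N),
        sharpNorm (fun r k k' => w M N r (fun i => k (π.1 i)) (fun j => k' (π.2 j)) : KerFun M N)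
        ≤ (M.factorial * N.factorial : ℕ) * sharpNorm (w M N) := by
      refine (Finset.sum_le_card_nsmul _ _ _ fun π _ => (h.perm π.1 π.2).2).trans ?_
      rw [nsmul_eq_mul]
      simp [Fintype.card_perm]
    have hne : ((M.factorial * N.factorial : ℕ) : ENNReal) ≠ 0 := by
      simp [Nat.factorial_ne_zero]
    have he : ‖((M.factorial : ℂ) * (N.factorial : ℂ))⁻¹‖ₑ =
        ((M.factorial * N.factorial : ℕ) : ENNReal)⁻¹ := by
      rw [enorm_inv (by simp [Nat.factorial_ne_zero]), ← Nat.cast_mul]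
      congr 1
      rw [← ofReal_norm, Complex.norm_natCast, ENNReal.ofReal_natCast]
    calc _ ≤ ((M.factorial * N.factorial : ℕ) : ENNReal)⁻¹ *
          ((M.factorial * N.factorial : ℕ) * sharpNorm (w M N)) := by
          rw [he]; gcongr; exact h1.2.trans h3
      _ = sharpNorm (w M N) := by
          rw [← mul_assoc, ENNReal.inv_mul_cancel hne (ENNReal.natCast_ne_top _), one_mul]

/-! ### Good representatives of kernels -/

/-- A kernel which has all properties of an element of `𝒲^#_{m,n}`, `m + n ≥ 1`, without exceptional
null sets, and which is extended by zero to energies above one. The number `X` bounds the kernel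
and its derivative with respect to the energy. -/
structure NiceKernel {a b : ℕ} (X : ℝ) (f : KerFun a b) : Prop where
  meas : Measurable fun q : ℝ × (Fin a → E3) × (Fin b → E3) => f q.1 q.2.1 q.2.2
  c1 : ∀ k k', C1On (Set.Ici 0) X 1 fun s => f s k k'
  supp : ∀ k k' s, 0 ≤ s → 1 - max (sumNorm k) (sumNorm k') < s → f s k k' = 0

lemma NiceKernel.add {a b : ℕ} {X X' : ℝ} {f g : KerFun a b} (hf : NiceKernel X f)
    (hg : NiceKernel X' g) : NiceKernel (X + X') (f + g) :=
  ⟨hf.meas.add hg.meas, fun k k' => (hf.c1 k k').add (hg.c1 k k'), fun k k' s h0 hs => by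
    simp [hf.supp k k' s h0 hs, hg.supp k k' s h0 hs]⟩

lemma NiceKernel.smul {a b : ℕ} {X : ℝ} {f : KerFun a b} (c : ℂ) (hf : NiceKernel X f) :
    NiceKernel (‖c‖ * X) (c • f) :=
  ⟨hf.meas.const_smul c, fun k k' => (hf.c1 k k').const_mul c, fun k k' s h0 hs => by
    simp [hf.supp k k' s h0 hs]⟩

lemma ae_sumNorm_pos (a b : ℕ) (hab : 1 ≤ a + b) :
    ∀ᵐ K : (Fin a → E3) × (Fin b → E3), 0 < max (sumNorm K.1) (sumNorm K.2) := by
  have hE : ∀ᵐ x : E3, x ≠ 0 := by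
    simp [ae_iff]
  rcases Nat.eq_zero_or_pos a with ha | ha
  · have hb : 0 < b := by omega
    have := ae_comp_of_surjective (μ := (volume : Measure ((Fin a → E3) × (Fin b → E3))))
      ((LinearMap.proj (R := ℝ) (φ := fun _ : Fin b => E3) ⟨0, hb⟩).comp (LinearMap.snd ℝ _ _))
      ((Function.surjective_eval _).comp Prod.snd_surjective) hE
    filter_upwards [this] with K hK
    refine lt_max_of_lt_right ((norm_pos_iff.2 hK).trans_le ?_)
    exact Finset.single_le_sum (f := fun i => ‖K.2 i‖) (fun _ _ => norm_nonneg _)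
      (Finset.mem_univ _)
  · have := ae_comp_of_surjective (μ := (volume : Measure ((Fin a → E3) × (Fin b → E3))))
      ((LinearMap.proj (R := ℝ) (φ := fun _ : Fin a => E3) ⟨0, ha⟩).comp (LinearMap.fst ℝ _ _))
      ((Function.surjective_eval _).comp Prod.fst_surjective) hE
    filter_upwards [this] with K hK
    refine lt_max_of_lt_left ((norm_pos_iff.2 hK).trans_le ?_)
    exact Finset.single_le_sum (f := fun i => ‖K.1 i‖) (fun _ _ => norm_nonneg _)
      (Finset.mem_univ _)

/-- Extension by zero of a `C¹` function on `[0,1]` that vanishes near one. -/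
lemma c1On_Ici_of_vanish {X : ℝ} {g : ℝ → ℂ} (hg : C1On (Set.Icc 0 1) X 1 g) {δ : ℝ} (hδ : 0 < δ)
    (h0 : ∀ r ∈ Set.Icc (0 : ℝ) 1, 1 - δ < r → g r = 0) :
    C1On (Set.Ici 0) X 1 (fun s => g (Set.projIcc (0 : ℝ) 1 zero_le_one s)) := by
  have hpr : ∀ s ∈ Set.Icc (0 : ℝ) 1, (Set.projIcc (0 : ℝ) 1 zero_le_one s : ℝ) = s :=
      fun s hs => by
    rw [Set.projIcc_of_mem _ hs]
  have h1 : ∀ s, 1 - δ < s → 0 ≤ s → g (Set.projIcc (0 : ℝ) 1 zero_le_one s) = 0 :=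
      fun s hs hs0 => by
    rcases le_or_gt s 1 with hs1 | hs1
    · rw [hpr s ⟨hs0, hs1⟩]; exact h0 s ⟨hs0, hs1⟩ hs
    · rw [Set.projIcc_of_right_le _ hs1.le]; exact h0 1 ⟨zero_le_one, le_rfl⟩ (by linarith)
  refine ⟨fun s => derivWithin g (Set.Icc 0 1) (Set.projIcc (0 : ℝ) 1 zero_le_one s), ?_, ?_, ?_⟩
  · intro s hs
    have hs : (0 : ℝ) ≤ s := hs
    rcases lt_or_ge s 1 with hs1 | hs1
    · have hm : s ∈ Set.Icc (0 : ℝ) 1 := ⟨hs, hs1.le⟩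
      simp only [hpr s hm]
      have hd : HasDerivWithinAt (fun s => g (Set.projIcc (0 : ℝ) 1 zero_le_one s))
          (derivWithin g (Set.Icc 0 1) s) (Set.Icc 0 1) s :=
        (hg.hasDerivWithinAt hm).congr (fun y hy => by rw [hpr y hy]) (by rw [hpr s hm])
      refine hd.mono_of_mem_nhdsWithin ?_
      filter_upwards [self_mem_nhdsWithin, mem_nhdsWithin_of_mem_nhds (Iio_mem_nhds hs1)]
        with y h h'
      exact ⟨h, le_of_lt h'⟩
    · have hz : derivWithin g (Set.Icc 0 1) (Set.projIcc (0 : ℝ) 1 zero_le_one s) = 0 := by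
        rw [Set.projIcc_of_right_le _ hs1]
        have : HasDerivWithinAt g 0 (Set.Icc 0 1) 1 := by
          refine (hasDerivWithinAt_const (1 : ℝ) (Set.Icc (0 : ℝ) 1) (0 : ℂ)).congr_of_eventuallyEq
            ?_ (h0 1 ⟨zero_le_one, le_rfl⟩ (by linarith))
          filter_upwards [self_mem_nhdsWithin, mem_nhdsWithin_of_mem_nhds
            (Ioi_mem_nhds (show 1 - δ < 1 by linarith))] with y h h' using h0 y h h'
        exact this.derivWithin (uniqueDiffOn_Icc_zero_one 1 ⟨zero_le_one, le_rfl⟩)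
      simp only [hz]
      refine (hasDerivWithinAt_const s (Set.Ici (0 : ℝ)) (0 : ℂ)).congr_of_eventuallyEq
            ?_ (h1 s (by linarith) hs)
      filter_upwards [self_mem_nhdsWithin, mem_nhdsWithin_of_mem_nhds
            (Ioi_mem_nhds (show 1 - δ < s by linarith))] with y h h' using h1 y h' h
  · exact (hg.continuousOn_derivWithin.comp_continuous
      (continuous_subtype_val.comp continuous_projIcc) (fun s => Subtype.coe_prop _)).continuousOn
  · exact fun s _ => ⟨hg.bound (Subtype.coe_prop _), hg.norm_derivWithin_le (Subtype.coe_prop _)⟩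

/-- Every kernel in `𝒲^#_{a,b}`, `a + b ≥ 1`, has a good representative. The support condition makes
almost every kernel function vanish near energy one, as `max(Σ[k], Σ[k̃]) > 0` almost everywhere, so
that the extension by zero is `C¹`. -/
lemma MemPre.exists_niceKernel {a b : ℕ} {f : KerFun a b} (h : MemPre f) (hab : 1 ≤ a + b) :
    ∃ f' : KerFun a b, NiceKernel (sharpNorm f).toReal f' ∧
      ∀ᵐ K ∂(momentumMeasure a b), ∀ r ∈ Set.Icc (0 : ℝ) 1, f r K.1 K.2 = f' r K.1 K.2 := by
  classical
  set X := (sharpNorm f).toReal with hX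
  -- measurable versions are only compared with `f` at the energies of a countable dense set `D`;
  -- continuity determines the other energies
  obtain ⟨D, hDc, hDd⟩ := TopologicalSpace.exists_countable_dense (Set.Icc (0 : ℝ) 1)
  have hm : ∀ r : Set.Icc (0 : ℝ) 1, AEStronglyMeasurable
    (fun K : (Fin a → E3) × (Fin b → E3) => f r K.1 K.2) (momentumMeasure a b) :=
    fun r => h.meas r r.2
  set g : Set.Icc (0 : ℝ) 1 → (Fin a → E3) × (Fin b → E3) → ℂ := fun r => (hm r).mk _ with hg
  have hgood : ∀ᵐ K ∂(momentumMeasure a b), C1On (Set.Icc 0 1) X 1 (fun r => f r K.1 K.2) ∧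
      (∀ r ∈ Set.Icc (0 : ℝ) 1, 1 - max (sumNorm K.1) (sumNorm K.2) < r → f r K.1 K.2 = 0) ∧
      0 < max (sumNorm K.1) (sumNorm K.2) ∧ ∀ r ∈ D, f r K.1 K.2 = g r K := by
    have h4 : ∀ᵐ K ∂(momentumMeasure a b), ∀ r ∈ D, f r K.1 K.2 = g r K :=
      (ae_ball_iff hDc).2 fun r _ => (hm r).ae_eq_mk
    filter_upwards [h.ae_c1On, h.support, ae_restrict_of_ae (ae_sumNorm_pos a b hab), h4]
      with K h1 h2 h3 h4 using ⟨h1, h2, h3, h4⟩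
  -- `G` is a measurable set of full measure on which all properties hold; the kernel is set to zero
  -- outside of it
  set G := (toMeasurable (momentumMeasure a b) {K | ¬ (
      C1On (Set.Icc 0 1) X 1 (fun r => f r K.1 K.2) ∧
      (∀ r ∈ Set.Icc (0 : ℝ) 1, 1 - max (sumNorm K.1) (sumNorm K.2) < r → f r K.1 K.2 = 0) ∧
      0 < max (sumNorm K.1) (sumNorm K.2) ∧ ∀ r ∈ D, f r K.1 K.2 = g r K)})ᶜ with hG
  have hGm : MeasurableSet G := (measurableSet_toMeasurable _ _).compl
  have hGae : ∀ᵐ K ∂(momentumMeasure a b), K ∈ G := by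
    rw [ae_iff]
    simp only [hG, Set.mem_compl_iff, not_not, Set.ofPred_mem_eq, measure_toMeasurable]
    exact ae_iff.1 hgood
  have hGp : ∀ K ∈ G, C1On (Set.Icc 0 1) X 1 (fun r => f r K.1 K.2) ∧
      (∀ r ∈ Set.Icc (0 : ℝ) 1, 1 - max (sumNorm K.1) (sumNorm K.2) < r → f r K.1 K.2 = 0) ∧
      0 < max (sumNorm K.1) (sumNorm K.2) ∧ ∀ r ∈ D, f r K.1 K.2 = g r K := fun K hK => by
    by_contra hn
    exact hK (subset_toMeasurable _ _ hn)
  set f' : ℝ → (Fin a → E3) × (Fin b → E3) → ℂ := fun s K =>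
    G.indicator (fun K => f (Set.projIcc (0 : ℝ) 1 zero_le_one s) K.1 K.2) K with hf'
  have hcont : ∀ K, Continuous fun s => f' s K := fun K => by
    by_cases hK : K ∈ G
    · simp only [hf', Set.indicator_of_mem hK]
      exact (hGp K hK).1.continuousOn.comp_continuous
        (continuous_subtype_val.comp continuous_projIcc) (fun s => Subtype.coe_prop _)
    · simp only [hf', Set.indicator_of_notMem hK]; exact continuous_const
  have hmD : ∀ r ∈ D, Measurable (f' (r : ℝ)) := fun r hr => by
    have : f' (r : ℝ) = G.indicator (g r) := by
      funext K
      by_cases hK : K ∈ G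
      · simp only [hf', Set.indicator_of_mem hK, Set.projIcc_val]
        exact (hGp K hK).2.2.2 r hr
      · simp only [hf', Set.indicator_of_notMem hK]
    rw [this]
    exact (hm r).stronglyMeasurable_mk.measurable.indicator hGm
  have hmeas : ∀ s, Measurable (f' s) := fun s => by
    obtain ⟨u, hu, hlim⟩ := mem_closure_iff_seq_limit.1 (hDd (Set.projIcc (0 : ℝ) 1 zero_le_one s))
    refine measurable_of_tendsto_metrizable (fun n => hmD _ (hu n)) (tendsto_pi_nhds.2 fun K => ?_)
    have h1 : Tendsto (fun n => f' (u n : ℝ) K) atTop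
        (𝓝 (f' (Set.projIcc (0 : ℝ) 1 zero_le_one s : ℝ) K)) :=
      ((hcont K).tendsto _).comp ((continuous_subtype_val.tendsto _).comp hlim)
    have h2 : f' (Set.projIcc (0 : ℝ) 1 zero_le_one s : ℝ) K = f' s K := by
      simp only [hf', Set.projIcc_val]
    rwa [h2] at h1
  refine ⟨fun s k k' => f' s (k, k'), ⟨?_, fun k k' => ?_, fun k k' s hs0 hs => ?_⟩, ?_⟩
  · exact measurable_uncurry_of_continuous_of_measurable hcont hmeas
  · by_cases hK : (k, k') ∈ G
    · simp only [hf', Set.indicator_of_mem hK]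
      obtain ⟨h1, h2, h3, -⟩ := hGp _ hK
      exact c1On_Ici_of_vanish h1 h3 h2
    · simp only [hf', Set.indicator_of_notMem hK]
      exact C1On.zero ENNReal.toReal_nonneg zero_le_one
  · by_cases hK : (k, k') ∈ G
    · simp only [hf', Set.indicator_of_mem hK]
      obtain ⟨h1, h2, h3, -⟩ := hGp _ hK
      refine h2 _ (Subtype.coe_prop _) ?_
      simp only [Set.coe_projIcc]
      simp only at h3
      refine lt_max_of_lt_right (lt_min (by linarith) hs)
    · simp only [hf', Set.indicator_of_notMem hK]
  · filter_upwards [hGae] with K hK r hr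
    simp only [hf', Prod.mk.eta, Set.indicator_of_mem hK, Set.projIcc_of_mem _ hr]

/-- On `B₁⁰ × B₁⁰` there are no null sets. -/
lemma of_ae_zero_zero {p : (Fin 0 → E3) × (Fin 0 → E3) → Prop}
    (h : ∀ᵐ K ∂(momentumMeasure 0 0), p K) (K : (Fin 0 → E3) × (Fin 0 → E3)) : p K := by
  rw [ae_momentumMeasure] at h
  obtain ⟨K', hK'⟩ := h.exists
  rw [Subsingleton.elim K K']
  exact hK' ⟨fun i => i.elim0, fun i => i.elim0⟩

/-! ### Creation and annihilation operators on weighted wave functions -/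

/-- The weight `(n!)^{-1/2} ∏_i |κ_i|^{-3/2}`. Sup bounds relative to this weight are preserved both
by smeared creation operators (on energies at most one) and by smeared annihilation operators. -/
def fockWeight {n : ℕ} (κ : Fin n → E3) : ℝ := (Real.sqrt n.factorial)⁻¹ * singWeight κ

lemma fockWeight_nonneg {n : ℕ} (κ : Fin n → E3) : 0 ≤ fockWeight κ :=
  mul_nonneg (by positivity) (singWeight_nonneg κ)

lemma sqrt_succ_mul_inv_sqrt_factorial (l : ℕ) :
    Real.sqrt ((l : ℝ) + 1) * (Real.sqrt (l + 1).factorial)⁻¹ = (Real.sqrt l.factorial)⁻¹ := by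
  rw [Nat.factorial_succ]
  push_cast
  rw [Real.sqrt_mul (by positivity)]
  have h1 : Real.sqrt ((l : ℝ) + 1) ≠ 0 := by positivity
  field_simp

lemma norm_complex_sqrt (l : ℕ) :
    ‖((Real.sqrt ((l : ℝ) + 1) : ℝ) : ℂ)‖ = Real.sqrt ((l : ℝ) + 1) := by
  rw [Complex.norm_real, Real.norm_of_nonneg (Real.sqrt_nonneg _)]

/-- The particle number factor `(l + 1)^{1/2}` of an annihilation operator is compensated by the
`(n!)^{-1/2}` in `fockWeight`. -/
lemma c1On_annihilateN {X Y : ℝ} {ψ : ℝ → Fock}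
    (h : ∀ n κ, C1On (Set.Icc 0 1) (X * fockWeight κ) Y fun r => ψ r n κ) (q : ℕ) :
    ∀ (x : Fin q → E3) (l : ℕ) (κ : Fin l → E3),
      C1On (Set.Icc 0 1) (X * (singWeight x * fockWeight κ)) Y
        fun r => annihilateN q x (ψ r) l κ := by
  induction q with
  | zero => intro x l κ; simpa [annihilateN, singWeight] using h l κ
  | succ q ih =>
    intro x l κ
    have h1 := (ih (fun i => x i.succ) (l + 1) (Fin.cons (x 0) κ)).const_mul
      (Real.sqrt ((l : ℝ) + 1) : ℂ)
    have hs : singWeight x = ‖x 0‖ ^ (-(3 / 2) : ℝ) * singWeight (fun i => x i.succ) := by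
      simp [singWeight, Fin.prod_univ_succ]
    have : ‖((Real.sqrt ((l : ℝ) + 1) : ℝ) : ℂ)‖ *
        (X * (singWeight (fun i => x i.succ) *
          fockWeight (Fin.cons (x 0) κ : Fin (l + 1) → E3))) =
        X * (singWeight x * fockWeight κ) := by
      rw [norm_complex_sqrt, fockWeight, fockWeight, singWeight_cons, hs,
        ← sqrt_succ_mul_inv_sqrt_factorial l]
      ring
    rw [this] at h1
    exact h1

lemma measurable_annihilateN {α : Type*} [MeasurableSpace α] {ψ : α → Fock}
    (h : ∀ n, Measurable fun q : α × (Fin n → E3) => ψ q.1 n q.2) {β : Type*} [MeasurableSpace β]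
    {A : β → α} (hA : Measurable A) (q : ℕ) :
    ∀ {x : β → Fin q → E3} (_ : Measurable x) {l : ℕ} {κ : β → Fin l → E3} (_ : Measurable κ),
      Measurable fun b => annihilateN q (x b) (ψ (A b)) l (κ b) := by
  induction q with
  | zero => intro x _ l κ hκ; exact (h l).comp (hA.prodMk hκ)
  | succ q ih =>
    intro x hx l κ hκ
    simp only [annihilateN, annihilate]
    refine measurable_const.mul (ih (x := fun b i => x b i.succ) ?_
      (κ := fun b => Fin.cons (x b 0) (κ b)) ?_)
    · exact measurable_pi_iff.2 fun i => (measurable_pi_apply i.succ).comp hx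
    · exact measurable_cons ((measurable_pi_apply 0).comp hx) hκ

lemma annihilateN_add (q : ℕ) (x : Fin q → E3) (ψ φ : Fock) :
    annihilateN q x (ψ + φ) = annihilateN q x ψ + annihilateN q x φ := by
  induction q with
  | zero => rfl
  | succ q ih =>
    funext l κ
    simp only [annihilateN, ih, annihilate, Pi.add_apply, mul_add]

lemma annihilateN_smul (q : ℕ) (x : Fin q → E3) (c : ℂ) (ψ : Fock) :
    annihilateN q x (c • ψ) = c • annihilateN q x ψ := by
  induction q with
  | zero => rfl
  | succ q ih =>
    funext l κ
    simp only [annihilateN, ih, annihilate, Pi.smul_apply, smul_eq_mul]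
    ring

lemma annihilateN_of_number {ψ : Fock} {a : ℕ} (h : ∀ n κ, n ≠ a → ψ n κ = 0) (q : ℕ) :
    ∀ (x : Fin q → E3) (l : ℕ) (κ : Fin l → E3), l + q ≠ a → annihilateN q x ψ l κ = 0 := by
  induction q with
  | zero => intro x l κ hl; exact h l κ hl
  | succ q ih =>
    intro x l κ hl
    simp only [annihilateN, annihilate]
    rw [ih _ _ _ (by omega), mul_zero]

/-- `a(x₁) ⋯ a(x_q) ψ` only involves values of `ψ` at rearrangements of all its arguments. -/
lemma annihilateN_congr {ψ φ : Fock} (q : ℕ) : ∀ (x : Fin q → E3) (l : ℕ) (κ : Fin l → E3),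
    (∀ n (e : Fin n → Fin q ⊕ Fin l), Function.Injective e →
      ψ n (Sum.elim x κ ∘ e) = φ n (Sum.elim x κ ∘ e)) →
    annihilateN q x ψ l κ = annihilateN q x φ l κ := by
  induction q with
  | zero =>
    intro x l κ h
    exact h l Sum.inr Sum.inr_injective
  | succ q ih =>
    intro x l κ h
    simp only [annihilateN, annihilate]
    congr 1
    refine ih _ _ _ fun n e he => ?_
    let σ : Fin q ⊕ Fin (l + 1) → Fin (q + 1) ⊕ Fin l :=
      Sum.elim (fun i => Sum.inl i.succ)
        (Fin.cases (motive := fun _ => Fin (q + 1) ⊕ Fin l) (Sum.inl 0) Sum.inr)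
    have hσ : Function.Injective σ := by
      rintro (i | i) (j | j) hij
      · simpa [σ] using hij
      · revert hij
        refine Fin.cases ?_ (fun j => ?_) j <;> simp [σ, Fin.succ_ne_zero]
      · revert hij
        refine Fin.cases ?_ (fun i => ?_) i <;> simp [σ, (Fin.succ_ne_zero _).symm]
      · revert hij
        refine Fin.cases ?_ (fun i => ?_) i <;> refine Fin.cases ?_ (fun j => ?_) j <;> simp [σ]
    have he' : Sum.elim (fun i => x i.succ) (Fin.cons (x 0) κ : Fin (l + 1) → E3) =
        Sum.elim x κ ∘ σ := by
      funext i
      rcases i with i | i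
      · simp [σ]
      · refine Fin.cases ?_ (fun i => ?_) i <;> simp [σ]
    rw [he', Function.comp_assoc]
    exact h n (σ ∘ e) (hσ.comp he)

lemma createN_add (p : ℕ) : ∀ (Φ Ψ : (Fin p → E3) → Fock),
    createN p (fun x => Φ x + Ψ x) = createN p Φ + createN p Ψ := by
  induction p with
  | zero => intro Φ Ψ; rfl
  | succ p ih =>
    intro Φ Ψ
    simp only [createN, ih]
    funext n κ
    cases n with
    | zero => simp [create]
    | succ n => simp [create, Finset.sum_add_distrib, mul_add]

lemma createN_smul (p : ℕ) (c : ℂ) : ∀ (Φ : (Fin p → E3) → Fock),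
    createN p (fun x => c • Φ x) = c • createN p Φ := by
  induction p with
  | zero => intro Φ; rfl
  | succ p ih =>
    intro Φ
    simp only [createN, ih]
    funext n κ
    cases n with
    | zero => simp [create]
    | succ n =>
      simp only [create, Pi.smul_apply, smul_eq_mul, ← Finset.mul_sum]
      ring

lemma createN_of_number {a : ℕ} (p : ℕ) : ∀ {Φ : (Fin p → E3) → Fock}
    (_ : ∀ x l κ, l ≠ a → Φ x l κ = 0) (n : ℕ) (κ : Fin n → E3), n ≠ a + p →
      createN p Φ n κ = 0 := by
  induction p with
  | zero => intro Φ h n κ hn; exact h _ n κ hn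
  | succ p ih =>
    intro Φ h n κ hn
    cases n with
    | zero => rfl
    | succ n =>
      simp only [createN, create]
      rw [Finset.sum_eq_zero, mul_zero]
      intro j _
      exact ih (fun xs l κ hl => h _ l κ hl) _ _ (by omega)

lemma createN_of_energy {τ : ℝ} (p : ℕ) : ∀ {Φ : (Fin p → E3) → Fock} {c : ℝ}
    (_ : ∀ x l κ, τ < c + (sumNorm x + sumNorm κ) → Φ x l κ = 0) (n : ℕ) (κ : Fin n → E3),
      τ < c + sumNorm κ → createN p Φ n κ = 0 := by
  induction p with
  | zero => intro Φ c h n κ hn; exact h _ n κ (by simpa [sumNorm] using hn)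
  | succ p ih =>
    intro Φ c h n κ hn
    cases n with
    | zero => rfl
    | succ n =>
      simp only [createN, create]
      rw [Finset.sum_eq_zero, mul_zero]
      intro j _
      refine ih (c := c + ‖κ j‖) (fun xs l κ' hl => h _ l κ' ?_) _ _ ?_
      · rw [sumNorm_cons]; linarith
      · rw [sumNorm_removeNth κ j] at hn; linarith

/-- Smeared creation operators only evaluate their integrand at subfamilies of the arguments. -/
lemma createN_congr (p : ℕ) : ∀ {Φ Ψ : (Fin p → E3) → Fock} (n : ℕ) (κ : Fin n → E3),
    (∀ l (e : Fin p → Fin n) (e' : Fin l → Fin n), Function.Injective (Sum.elim e e') →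
      Φ (κ ∘ e) l (κ ∘ e') = Ψ (κ ∘ e) l (κ ∘ e')) →
    createN p Φ n κ = createN p Ψ n κ := by
  induction p with
  | zero =>
    intro Φ Ψ n κ h
    have := h n Fin.elim0 id (by
      rintro (i | i) (j | j) hij
      · exact i.elim0
      · exact i.elim0
      · exact j.elim0
      · simpa using hij)
    rwa [Subsingleton.elim (κ ∘ Fin.elim0) (Fin.elim0 : Fin 0 → E3)] at this
  | succ p ih =>
    intro Φ Ψ n κ h
    cases n with
    | zero => rfl
    | succ n =>
      simp only [createN, create]
      congr 1
      refine Finset.sum_congr rfl fun j _ => ih n _ fun l e e' he => ?_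
      have h1 : (Fin.cons (κ j) (j.removeNth κ ∘ e) : Fin (p + 1) → E3) =
          κ ∘ (Fin.cons j (fun i => j.succAbove (e i)) : Fin (p + 1) → Fin (n + 1)) := by
        funext i
        refine Fin.cases ?_ (fun i => ?_) i <;> simp [Fin.removeNth]
      have h2 : j.removeNth κ ∘ e' = κ ∘ fun i => j.succAbove (e' i) := by
        funext i; simp [Fin.removeNth]
      rw [h1, h2]
      refine h l _ _ ?_
      have hne := Fin.succAbove_ne j
      have hinj := Fin.succAbove_right_injective (p := j)
      rintro (a | a) (b | b) hab
      · revert hab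
        refine Fin.cases ?_ (fun a => ?_) a <;> refine Fin.cases ?_ (fun b => ?_) b
        · simp
        · intro hab; exact absurd hab.symm (hne _)
        · intro hab; exact absurd hab (hne _)
        · intro hab
          have := he (a₁ := Sum.inl a) (a₂ := Sum.inl b) (hinj hab)
          simpa using this
      · revert hab
        refine Fin.cases ?_ (fun a => ?_) a
        · intro hab; exact absurd hab.symm (hne _)
        · intro hab
          have := he (a₁ := Sum.inl a) (a₂ := Sum.inr b) (hinj hab)
          simp at this
      · revert hab
        refine Fin.cases ?_ (fun b => ?_) b
        · intro hab; exact absurd hab (hne _)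
        · intro hab
          have := he (a₁ := Sum.inr a) (a₂ := Sum.inl b) (hinj hab)
          simp at this
      · have := he (a₁ := Sum.inr a) (a₂ := Sum.inr b) (hinj hab)
        simpa using this

lemma measurable_createN (p : ℕ) : ∀ {α : Type} [MeasurableSpace α] {Φ : α → (Fin p → E3) → Fock}
    (_ : ∀ l, Measurable fun q : (α × (Fin p → E3)) × (Fin l → E3) => Φ q.1.1 q.1.2 l q.2) (n : ℕ),
      Measurable fun q : α × (Fin n → E3) => createN p (Φ q.1) n q.2 := by
  induction p with
  | zero =>
    intro α _ Φ h n
    exact (h n).comp ((measurable_fst.prodMk measurable_const).prodMk measurable_snd)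
  | succ p ih =>
    intro α _ Φ h n
    cases n with
    | zero => exact measurable_const
    | succ n =>
      simp only [createN, create]
      refine measurable_const.mul (Finset.measurable_fun_sum _ fun j _ => ?_)
      have h1 := ih (α := α × E3) (Φ := fun a xs => Φ a.1 (Fin.cons a.2 xs)) (fun l =>
        (h l).comp (((measurable_fst.comp (measurable_fst.comp measurable_fst)).prodMk
          (measurable_cons (measurable_snd.comp (measurable_fst.comp measurable_fst))
            (measurable_snd.comp measurable_fst))).prodMk measurable_snd)) n
      refine h1.comp (f := fun q : α × (Fin (n + 1) → E3) => ((q.1, q.2 j), j.removeNth q.2)) ?_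
      refine (measurable_fst.prodMk ((measurable_pi_apply j).comp measurable_snd)).prodMk ?_
      exact measurable_pi_iff.2 fun i => (measurable_pi_apply (j.succAbove i)).comp measurable_snd

lemma norm_weight_cons {p : ℕ} (x : E3) (xs : Fin p → E3) :
    ‖weight (Fin.cons x xs : Fin (p + 1) → E3)‖ = (Metric.ball (0 : E3) 1).indicator
      (fun x => ‖x‖ ^ (-(1 / 2) : ℝ) / (4 * Real.pi)) x * ‖weight xs‖ := by
  simp only [norm_weight_eq, Fin.prod_univ_succ, Fin.cons_zero, Fin.cons_succ]

/-- The density of a creation operator costs a factor `|x|` relative to the weight `|x|^{-3/2}`. -/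
lemma creation_density_le (x : E3) : (Metric.ball (0 : E3) 1).indicator
      (fun x => ‖x‖ ^ (-(1 / 2) : ℝ) / (4 * Real.pi)) x ≤ ‖x‖ * ‖x‖ ^ (-(3 / 2) : ℝ) := by
  have h0 : 0 ≤ ‖x‖ * ‖x‖ ^ (-(3 / 2) : ℝ) := by positivity
  by_cases h : x ∈ Metric.ball (0 : E3) 1
  · rw [Set.indicator_of_mem h]
    have h4 : 1 ≤ 4 * Real.pi := by linarith [Real.pi_gt_three]
    refine (div_le_self (by positivity) h4).trans ?_
    rcases eq_or_ne x 0 with h0 | h0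
    · rw [h0, norm_zero, Real.zero_rpow (by norm_num)]; simp
    · have : 0 < ‖x‖ := norm_pos_iff.2 h0
      nth_rewrite 2 [← Real.rpow_one ‖x‖]
      rw [← Real.rpow_add this]
      norm_num
  · rwa [Set.indicator_of_notMem h]

/-- The sum over the created particle costs `∑_j |κ_j|` per creation operator, which is at most one
on the range of `P`. -/
lemma c1On_createN {Y : ℝ} (hY : 0 ≤ Y) (p : ℕ) : ∀ {X : ℝ} (_ : 0 ≤ X)
    {Φ : ℝ → (Fin p → E3) → Fock}
    (_ : ∀ x l κ, C1On (Set.Icc 0 1) (X * (‖weight x‖ * fockWeight κ)) Y fun r => Φ r x l κ)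
    (n : ℕ) (κ : Fin n → E3),
      C1On (Set.Icc 0 1) (X * (sumNorm κ ^ p * fockWeight κ)) Y fun r => createN p (Φ r) n κ := by
  induction p with
  | zero =>
    intro X _ Φ h n κ
    have := h Fin.elim0 n κ
    simpa [createN, norm_weight_eq] using this
  | succ p ih =>
    intro X hX Φ h n κ
    cases n with
    | zero =>
      refine C1On.zero ?_ hY
      have := fockWeight_nonneg κ
      have := sumNorm_nonneg κ
      positivity
    | succ n =>
      simp only [createN, create]
      set d : E3 → ℝ := (Metric.ball (0 : E3) 1).indicator
        (fun x => ‖x‖ ^ (-(1 / 2) : ℝ) / (4 * Real.pi)) with hd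
      have hd0 : ∀ x, 0 ≤ d x := fun x => Set.indicator_nonneg (fun _ _ => by positivity) _
      have h1 : ∀ j ∈ Finset.univ, C1On (Set.Icc 0 1)
          ((X * d (κ j)) * (sumNorm (j.removeNth κ) ^ p * fockWeight (j.removeNth κ))) Y
          fun r => createN p (fun xs => Φ r (Fin.cons (κ j) xs)) n (j.removeNth κ) := fun j _ => by
        refine ih (mul_nonneg hX (hd0 _)) (Φ := fun r xs => Φ r (Fin.cons (κ j) xs))
          (fun xs l κ' => ?_) n _
        have h2 := h (Fin.cons (κ j) xs) l κ'
        rw [norm_weight_cons] at h2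
        exact h2.mono (le_of_eq (by ring)) le_rfl hY
      refine ((C1On.sum Finset.univ hY h1).const_mul _).mono ?_ le_rfl hY
      rw [Finset.mul_sum]
      have hw : ∀ j : Fin (n + 1), fockWeight κ = (Real.sqrt ((n : ℝ) + 1))⁻¹ *
          (‖κ j‖ ^ (-(3 / 2) : ℝ) * fockWeight (j.removeNth κ)) := fun j => by
        unfold fockWeight
        rw [← sqrt_succ_mul_inv_sqrt_factorial n, singWeight_removeNth κ j]
        have : Real.sqrt ((n : ℝ) + 1) ≠ 0 := by positivity
        field_simp
      have hnorm : ‖((Real.sqrt ((n : ℝ) + 1))⁻¹ : ℂ)‖ = (Real.sqrt ((n : ℝ) + 1))⁻¹ := by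
        rw [norm_inv, norm_complex_sqrt]
      rw [hnorm]
      calc ∑ j, (Real.sqrt ((n : ℝ) + 1))⁻¹ * (X * d (κ j) *
            (sumNorm (j.removeNth κ) ^ p * fockWeight (j.removeNth κ)))
          ≤ ∑ j, X * (sumNorm κ ^ p * (‖κ j‖ * fockWeight κ)) := by
            refine Finset.sum_le_sum fun j _ => ?_
            have e1 : sumNorm (j.removeNth κ) ≤ sumNorm κ := by
              rw [sumNorm_removeNth κ j]; linarith [norm_nonneg (κ j)]
            have e2 := creation_density_le (κ j)
            have e3 := fockWeight_nonneg (j.removeNth κ)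
            have e4 := sumNorm_nonneg (j.removeNth κ)
            have e5 := sumNorm_nonneg κ
            rw [hw j]
            calc _ = X * (sumNorm (j.removeNth κ) ^ p * ((Real.sqrt ((n : ℝ) + 1))⁻¹ *
                  (d (κ j) * fockWeight (j.removeNth κ)))) := by ring
              _ ≤ X * (sumNorm κ ^ p * ((Real.sqrt ((n : ℝ) + 1))⁻¹ *
                  ((‖κ j‖ * ‖κ j‖ ^ (-(3 / 2) : ℝ)) * fockWeight (j.removeNth κ)))) := by
                  have := hd0 (κ j)
                  gcongr
              _ = _ := by ring
        _ = _ := by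
            rw [← Finset.mul_sum, ← Finset.mul_sum, ← Finset.sum_mul, pow_succ]
            unfold sumNorm
            ring

/-! ### The interaction operators as bilinear maps -/

/-- The interaction operator with a single kernel `f` in place of `w_{p+m,q+n}`. -/
def interactOp {m n : ℕ} (p q : ℕ) (f : KerFun (p + m) (q + n)) (r : ℝ) (k : Fin m → E3)
    (k' : Fin n → E3) (ψ : Fock) : Fock :=
  pRed <| createN p fun x l κ => weight x * ∫ x' : Fin q → E3,
    weight x' * f (sumNorm κ + r) (Fin.append x k) (Fin.append x' k') *
      annihilateN q x' (pRed ψ) l κ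

/-- Extension of a kernel by zero to energies outside `[0,1]`. -/
def cutKernel {a b : ℕ} (f : KerFun a b) : KerFun a b :=
  fun s k k' => (Set.Icc (0 : ℝ) 1).indicator (fun s => f s k k') s

/-- A Fock space vector depending on `r ∈ [0,1]` and a parameter `K`, with wave functions
measurable in the momenta and continuously differentiable in `r`, bounded by `X` relative to
`fockWeight`, and with logarithmic derivative bound `Y`. -/
structure StateBound {P : Type} [MeasurableSpace P] (X Y : ℝ) (ψ : ℝ → P → Fock) : Prop where
  meas : ∀ r n, Measurable fun q : P × (Fin n → E3) => ψ r q.1 n q.2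
  c1 : ∀ K n κ, C1On (Set.Icc 0 1) (X * fockWeight κ) Y fun r => ψ r K n κ

section Bilinear

variable {P : Type} [MeasurableSpace P] {X X' Y Y' ρ : ℝ} {ψ φ : ℝ → P → Fock}

lemma StateBound.zero (hY : 0 ≤ Y) : StateBound 0 Y (0 : ℝ → P → Fock) :=
  ⟨fun _ _ => measurable_const, fun _ _ _ => C1On.zero (by simp) hY⟩

lemma StateBound.add (h : StateBound X Y ψ) (h' : StateBound X' Y φ) :
    StateBound (X + X') Y (ψ + φ) :=
  ⟨fun r n => (h.meas r n).add (h'.meas r n), fun K n κ => by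
    rw [add_mul]; exact (h.c1 K n κ).add (h'.c1 K n κ)⟩

lemma StateBound.smul (c : ℂ) (h : StateBound X Y ψ) : StateBound (‖c‖ * X) Y (c • ψ) :=
  ⟨fun r n => (h.meas r n).const_smul c, fun K n κ => by
    rw [mul_assoc]; exact (h.c1 K n κ).const_mul c⟩

lemma stateBound_vacuum : StateBound 1 0 (fun (_ : ℝ) (_ : P) => vacuum) :=
  ⟨fun _ _ => measurable_const, fun K n κ => by
    refine C1On.const _ ?_ le_rfl
    unfold vacuum
    split_ifs with hn
    · subst hn; simp [fockWeight, singWeight]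
    · simpa using fockWeight_nonneg κ⟩

lemma StateBound.pRed (h : StateBound X Y ψ) :
    StateBound X Y (fun r K => pRed (ψ r K)) where
  meas r n := by
    refine Measurable.mul ?_ (h.meas r n)
    exact (measurable_one.indicator measurableSet_Icc).comp
      ((measurable_sumNorm n).comp measurable_snd)
  c1 K n κ := by
    have h0 := h.c1 K n κ
    have := h0.const_mul ((Set.Icc (0 : ℝ) 1).indicator 1 (sumNorm κ) : ℂ)
    by_cases hk : sumNorm κ ∈ Set.Icc (0 : ℝ) 1
    · simpa [SpinBoson.pRed, SpinBoson.funHf, hk] using h0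
    · simp only [SpinBoson.pRed, SpinBoson.funHf, Set.indicator_of_notMem hk, zero_mul]
      obtain ⟨g', -, -, hb⟩ := h0
      have hb := hb 0 ⟨le_rfl, zero_le_one⟩
      refine ⟨fun _ => 0, fun r _ => hasDerivWithinAt_const _ _ _, continuousOn_const,
        fun r _ => ?_⟩
      rw [norm_zero]
      exact ⟨(norm_nonneg _).trans hb.1, (norm_nonneg _).trans hb.2⟩

lemma StateBound.funHf {G : ℝ → ℂ} {T Z : ℝ} (hG : Measurable G)
    (hc : C1On (Set.Ici 0) T Z G) (hρ : 0 ≤ ρ) {s : P → ℝ} (hs : Measurable s)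
    (hs0 : ∀ K, 0 ≤ s K) (h : StateBound X Y ψ) :
    StateBound (T * X) (ρ * Z + Y) (fun r K => funHf (fun t => G (t + ρ * (r + s K))) (ψ r K)) where
  meas r n := by
    refine Measurable.mul (hG.comp ?_) (h.meas r n)
    have := measurable_sumNorm n
    fun_prop
  c1 K n κ := by
    rw [mul_assoc]
    exact (hc.comp_affine (sumNorm_nonneg κ) hρ (hs0 K)).mul (h.c1 K n κ)

variable {m n : ℕ} {p q : ℕ} {f f' : KerFun (p + m) (q + n)} {F F' : ℝ} {s : P → ℝ}
  {k : P → Fin m → E3} {k' : P → Fin n → E3}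

/-- The integrand of an annihilation integral. -/
def annIntegrand (q : ℕ) (f : KerFun (p + m) (q + n)) (ψ : Fock) (r : ℝ) (k : Fin m → E3)
    (k' : Fin n → E3) (x : Fin p → E3) {l : ℕ} (κ : Fin l → E3) (x' : Fin q → E3) : ℂ :=
  weight x' * f (sumNorm κ + r) (Fin.append x k) (Fin.append x' k') *
    annihilateN q x' (pRed ψ) l κ

lemma measurable_annIntegrand (hf : NiceKernel F f) (h : StateBound X Y ψ) (hs : Measurable s)
    (hk : Measurable k) (hk' : Measurable k') (ρ r : ℝ) (l : ℕ) :
    Measurable fun z : ((P × (Fin p → E3)) × (Fin l → E3)) × (Fin q → E3) =>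
      annIntegrand q f (ψ r z.1.1.1) (ρ * (r + s z.1.1.1)) (k z.1.1.1) (k' z.1.1.1) z.1.1.2
        z.1.2 z.2 := by
  unfold annIntegrand
  refine Measurable.mul (Measurable.mul ((measurable_weight q).comp measurable_snd) ?_) ?_
  · have h1 := (measurable_sumNorm l)
    refine hf.meas.comp (f := fun z : ((P × (Fin p → E3)) × (Fin l → E3)) × (Fin q → E3) =>
      (sumNorm z.1.2 + ρ * (r + s z.1.1.1), Fin.append z.1.1.2 (k z.1.1.1),
        Fin.append z.2 (k' z.1.1.1))) ?_
    refine Measurable.prodMk (by fun_prop) (Measurable.prodMk ?_ ?_)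
    · exact measurable_append (by fun_prop) (by fun_prop)
    · exact measurable_append (by fun_prop) (by fun_prop)
  · exact measurable_annihilateN (ψ := fun K => pRed (ψ r K)) (fun n => h.pRed.meas r n)
      (A := fun z : ((P × (Fin p → E3)) × (Fin l → E3)) × (Fin q → E3) => z.1.1.1)
      (by fun_prop) q (by fun_prop) (by fun_prop)

lemma c1On_annIntegrand (hf : NiceKernel F f) (h : StateBound X Y ψ) (hρ : 0 ≤ ρ)
    (hs0 : ∀ K, 0 ≤ s K) (K : P) (x : Fin p → E3) {l : ℕ} (κ : Fin l → E3) (x' : Fin q → E3) :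
    C1On (Set.Icc 0 1) ((‖weight x'‖ * singWeight x') * (F * X * fockWeight κ)) (ρ + Y)
      fun r => annIntegrand q f (ψ r K) (ρ * (r + s K)) (k K) (k' K) x κ x' := by
  unfold annIntegrand
  have h1 := (hf.c1 (Fin.append x (k K)) (Fin.append x' (k' K))).comp_affine (sumNorm_nonneg κ) hρ
    (hs0 K)
  have h2 := c1On_annihilateN (ψ := fun r => pRed (ψ r K)) (fun n κ => h.pRed.c1 K n κ) q x' l κ
  have h3 := (h1.const_mul (weight x')).mul h2
  rw [mul_one] at h3
  have e : ‖weight x'‖ * F * (X * (singWeight x' * fockWeight κ)) =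
    (‖weight x'‖ * singWeight x') * (F * X * fockWeight κ) := by ring
  rwa [e] at h3

lemma measurable_annIntegrand_snd (hf : NiceKernel F f) (h : StateBound X Y ψ) (hs : Measurable s)
    (hk : Measurable k) (hk' : Measurable k') (ρ r : ℝ) (K : P) (x : Fin p → E3) {l : ℕ}
    (κ : Fin l → E3) :
    Measurable fun x' => annIntegrand q f (ψ r K) (ρ * (r + s K)) (k K) (k' K) x κ x' :=
  (measurable_annIntegrand hf h hs hk hk' ρ r l).comp
    (f := fun x' : Fin q → E3 => (((K, x), κ), x')) (by fun_prop)

lemma integrable_annIntegrand (hf : NiceKernel F f) (h : StateBound X Y ψ) (hρ : 0 ≤ ρ)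
    (hs : Measurable s) (hs0 : ∀ K, 0 ≤ s K) (hk : Measurable k) (hk' : Measurable k') {r : ℝ}
    (hr : r ∈ Set.Icc (0 : ℝ) 1) (K : P) (x : Fin p → E3) {l : ℕ} (κ : Fin l → E3) :
    Integrable fun x' => annIntegrand q f (ψ r K) (ρ * (r + s K)) (k K) (k' K) x κ x' :=
  ((integrable_weight_singWeight q).mul_const (F * X * fockWeight κ)).mono'
    (measurable_annIntegrand_snd hf h hs hk hk' ρ r K x κ).aestronglyMeasurable
    (Eventually.of_forall fun x' => (c1On_annIntegrand hf h hρ hs0 K x κ x').bound hr)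

lemma interactOp_eq (f : KerFun (p + m) (q + n)) (r : ℝ) (k : Fin m → E3) (k' : Fin n → E3)
    (ψ : Fock) : interactOp p q f r k k' ψ = pRed (createN p fun x _ κ =>
      weight x * ∫ x' : Fin q → E3, annIntegrand q f ψ r k k' x κ x') := rfl

/-- The interaction operator is bounded with respect to the weighted sup norms by the norm of its
kernel. -/
lemma StateBound.interactOp (hf : NiceKernel F f) (h : StateBound X Y ψ) (hF : 0 ≤ F) (hX : 0 ≤ X)
    (hY : 0 ≤ Y) (hρ : 0 ≤ ρ) (hs : Measurable s) (hs0 : ∀ K, 0 ≤ s K) (hk : Measurable k)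
    (hk' : Measurable k') :
    StateBound (F * X) (ρ + Y)
      (fun r K => interactOp p q f (ρ * (r + s K)) (k K) (k' K) (ψ r K)) where
  meas r n := by
    simp only [interactOp_eq]
    refine Measurable.mul ?_ ?_
    · exact (measurable_one.indicator measurableSet_Icc).comp
        ((measurable_sumNorm n).comp measurable_snd)
    · refine measurable_createN p (Φ := fun K x l κ => weight x * ∫ x' : Fin q → E3,
        annIntegrand q f (ψ r K) (ρ * (r + s K)) (k K) (k' K) x κ x') (fun l => ?_) n
      refine ((measurable_weight p).comp (measurable_snd.comp measurable_fst)).mul ?_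
      exact ((measurable_annIntegrand hf h hs hk hk' ρ r l).stronglyMeasurable.integral_prod_right
        (ν := volume)).measurable
  c1 K n κ := by
    have h1 : ∀ x (l : ℕ) (κ : Fin l → E3), C1On (Set.Icc 0 1)
        (F * X * (‖weight x‖ * fockWeight κ)) (ρ + Y)
        fun r => weight x * ∫ x' : Fin q → E3,
          annIntegrand q f (ψ r K) (ρ * (r + s K)) (k K) (k' K) x κ x' := fun x _ κ => by
      have h2 := C1On.integral (μ := volume)
        ((integrable_weight_singWeight q).mul_const (F * X * fockWeight κ))
        (fun r => (measurable_annIntegrand_snd hf h hs hk hk' ρ r K x κ).aestronglyMeasurable)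
        (fun x' => c1On_annIntegrand hf h hρ hs0 K x κ x')
      rw [integral_mul_const, integral_weight_singWeight, one_mul] at h2
      have h3 := h2.const_mul (weight x)
      have e : ‖weight x‖ * (F * X * fockWeight κ) = F * X * (‖weight x‖ * fockWeight κ) := by ring
      rwa [e] at h3
    have hFX : 0 ≤ F * X := mul_nonneg hF hX
    have h4 := c1On_createN (add_nonneg hρ hY) p hFX h1 n κ
    simp only [interactOp_eq, SpinBoson.pRed, SpinBoson.funHf]
    have hw := fockWeight_nonneg κ
    by_cases hk : sumNorm κ ∈ Set.Icc (0 : ℝ) 1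
    · simp only [Set.indicator_of_mem hk, Pi.one_apply, one_mul]
      refine h4.mono ?_ le_rfl (add_nonneg hρ hY)
      refine mul_le_mul_of_nonneg_left ?_ hFX
      exact mul_le_of_le_one_left hw (pow_le_one₀ hk.1 hk.2)
    · simp only [Set.indicator_of_notMem hk, zero_mul]
      exact C1On.zero (mul_nonneg hFX hw) (add_nonneg hρ hY)

lemma pRed_add (ψ φ : Fock) : pRed (ψ + φ) = pRed ψ + pRed φ := by
  funext n κ; simp [pRed, funHf, mul_add]

lemma pRed_smul (c : ℂ) (ψ : Fock) : pRed (c • ψ) = c • pRed ψ := by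
  funext n κ; simp only [pRed, funHf, Pi.smul_apply, smul_eq_mul]; ring

lemma interactOp_smul_right (c : ℂ) (r : ℝ) (k : Fin m → E3) (k' : Fin n → E3) (ψ : Fock) :
    interactOp p q f r k k' (c • ψ) = c • interactOp p q f r k k' ψ := by
  simp only [interactOp_eq]
  rw [← pRed_smul, ← createN_smul]
  congr 2
  funext x l κ
  simp only [Pi.smul_apply, smul_eq_mul, annIntegrand, pRed_smul, annihilateN_smul]
  rw [mul_left_comm c]
  congr 1
  rw [← integral_const_mul]
  congr 1
  funext x'
  ring

lemma interactOp_smul_left (c : ℂ) (r : ℝ) (k : Fin m → E3) (k' : Fin n → E3) (ψ : Fock) :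
    interactOp p q (c • f) r k k' ψ = c • interactOp p q f r k k' ψ := by
  simp only [interactOp_eq]
  rw [← pRed_smul, ← createN_smul]
  congr 2
  funext x l κ
  simp only [Pi.smul_apply, smul_eq_mul, annIntegrand]
  rw [mul_left_comm c]
  congr 1
  rw [← integral_const_mul]
  congr 1
  funext x'
  ring

lemma interactOp_add_right (hf : NiceKernel F f) (h : StateBound X Y ψ) (h' : StateBound X' Y' φ)
    (hρ : 0 ≤ ρ) (hs : Measurable s) (hs0 : ∀ K, 0 ≤ s K) (hk : Measurable k)
    (hk' : Measurable k') {r : ℝ} (hr : r ∈ Set.Icc (0 : ℝ) 1) (K : P) :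
    interactOp p q f (ρ * (r + s K)) (k K) (k' K) (ψ r K + φ r K) =
      interactOp p q f (ρ * (r + s K)) (k K) (k' K) (ψ r K) +
        interactOp p q f (ρ * (r + s K)) (k K) (k' K) (φ r K) := by
  simp only [interactOp_eq]
  rw [← pRed_add, ← createN_add]
  congr 2
  funext x l κ
  simp only [Pi.add_apply]
  rw [← mul_add, ← integral_add (integrable_annIntegrand hf h hρ hs hs0 hk hk' hr K x κ)
    (integrable_annIntegrand hf h' hρ hs hs0 hk hk' hr K x κ)]
  congr 2
  funext x'
  simp only [annIntegrand, pRed_add, annihilateN_add, Pi.add_apply]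
  ring

lemma interactOp_add_left (hf : NiceKernel F f) (hf' : NiceKernel F' f') (h : StateBound X Y ψ)
    (hρ : 0 ≤ ρ) (hs : Measurable s) (hs0 : ∀ K, 0 ≤ s K) (hk : Measurable k)
    (hk' : Measurable k') {r : ℝ} (hr : r ∈ Set.Icc (0 : ℝ) 1) (K : P) :
    interactOp p q (f + f') (ρ * (r + s K)) (k K) (k' K) (ψ r K) =
      interactOp p q f (ρ * (r + s K)) (k K) (k' K) (ψ r K) +
        interactOp p q f' (ρ * (r + s K)) (k K) (k' K) (ψ r K) := by
  simp only [interactOp_eq]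
  rw [← pRed_add, ← createN_add]
  congr 2
  funext x l κ
  simp only [Pi.add_apply]
  rw [← mul_add, ← integral_add (integrable_annIntegrand hf h hρ hs hs0 hk hk' hr K x κ)
    (integrable_annIntegrand hf' h hρ hs hs0 hk hk' hr K x κ)]
  congr 2
  funext x'
  simp only [annIntegrand, Pi.add_apply]
  ring

/-- Energy support of the range of an interaction operator. -/
lemma interactOp_of_energy (hf : NiceKernel F f) {r : ℝ} (hr : 0 ≤ r) (k : Fin m → E3)
    (k' : Fin n → E3) (ψ : Fock) {l : ℕ} (κ : Fin l → E3) (h : 1 < r + sumNorm k + sumNorm κ) :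
    interactOp p q f r k k' ψ l κ = 0 := by
  simp only [interactOp_eq, pRed, funHf]
  rw [createN_of_energy (τ := 1) (c := r + sumNorm k) p _ _ _ h, mul_zero]
  intro x l κ hx
  have : (fun x' : Fin q → E3 => annIntegrand q f ψ r k k' x κ x') = fun _ => 0 := by
    funext x'
    have hn := sumNorm_nonneg κ
    rw [annIntegrand, hf.supp _ _ _ (by positivity)]
    · ring
    · have := le_max_left (sumNorm (Fin.append x k)) (sumNorm (Fin.append x' k'))
      have e := sumNorm_append x k
      linarith
  rw [this]
  simp

/-- Particle numbers in the range of an interaction operator. -/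
lemma interactOp_of_number (f : KerFun (p + m) (q + n)) (r : ℝ) (k : Fin m → E3) (k' : Fin n → E3)
    {ψ : Fock} {a : ℕ} (h : ∀ n κ, n ≠ a → ψ n κ = 0) {N : ℕ} (κ : Fin N → E3)
    (hN : N + q ≠ a + p) : interactOp p q f r k k' ψ N κ = 0 := by
  simp only [interactOp_eq, pRed, funHf]
  have h1 : ∀ n (κ : Fin n → E3), n ≠ a → pRed ψ n κ = 0 := fun n κ hn => by
    simp [pRed, funHf, h n κ hn]
  have h2 : ∀ (x : Fin p → E3) l (κ : Fin l → E3), l + q ≠ a →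
      weight x * ∫ x' : Fin q → E3, annIntegrand q f ψ r k k' x κ x' = 0 := fun x l κ hl => by
    simp [annIntegrand, annihilateN_of_number h1 q _ l κ hl]
  by_cases hq : q ≤ a
  · rw [createN_of_number (a := a - q) p (fun x l κ hl => h2 x l κ (by omega)) N κ (by omega),
      mul_zero]
  · rw [createN_of_number (a := N + 1) p (fun x l κ _ => h2 x l κ (by omega)) N κ (by omega),
      mul_zero]

/-- More annihilation operators than particles. -/
lemma interactOp_of_lt (f : KerFun (p + m) (q + n)) (r : ℝ) (k : Fin m → E3) (k' : Fin n → E3)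
    {ψ : Fock} {a : ℕ} (h : ∀ n κ, n ≠ a → ψ n κ = 0) {N : ℕ} (κ : Fin N → E3)
    (hq : a < q) : interactOp p q f r k k' ψ N κ = 0 := by
  simp only [interactOp_eq, pRed, funHf]
  have h1 : ∀ n (κ : Fin n → E3), n ≠ a → pRed ψ n κ = 0 := fun n κ hn => by
    simp [pRed, funHf, h n κ hn]
  have h2 : ∀ (x : Fin p → E3) l (κ : Fin l → E3),
      weight x * ∫ x' : Fin q → E3, annIntegrand q f ψ r k k' x κ x' = 0 := fun x l κ => by
    simp [annIntegrand, annihilateN_of_number h1 q _ l κ (by omega)]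
  rw [createN_of_number (a := N + 1) p (fun x l κ _ => h2 x l κ) N κ (by omega), mul_zero]

end Bilinear

/-! ### Chains of interaction operators -/

/-- The pairs `(k, k̃)` of outer momenta. -/
abbrev Pt (M N : ℕ) : Type := (Fin M → E3) × (Fin N → E3)

/-- The data of one factor `W^{m,n}_{p,q}(ρ(r + s), ρk_l, ρk̃_l) F(H_f + ρ(r + s'))` except for the
kernel and the function `F`. The maps `e` and `e'` select the outer momenta `k_l`, `k̃_l`. -/
structure Geom (M N : ℕ) where
  m : ℕ
  p : ℕ
  n : ℕ
  q : ℕ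
  e : Fin m → Fin M
  e' : Fin n → Fin N
  s : Pt M N → ℝ
  s' : Pt M N → ℝ

namespace Geom

variable {M N : ℕ}

/-- The type of kernels that fit to a factor. -/
abbrev Ker (g : Geom M N) : Type := KerFun (g.p + g.m) (g.q + g.n)

/-- The outer momenta `k_l` of a factor. -/
def k (g : Geom M N) (K : Pt M N) : Fin g.m → E3 := fun j => K.1 (g.e j)

/-- The outer momenta `k̃_l` of a factor. -/
def k' (g : Geom M N) (K : Pt M N) : Fin g.n → E3 := fun j => K.2 (g.e' j)

/-- The properties of the selections and energy shifts used throughout. -/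
structure Valid (g : Geom M N) : Prop where
  inj : Function.Injective g.e
  inj' : Function.Injective g.e'
  meas_s : Measurable g.s
  meas_s' : Measurable g.s'
  s_nonneg : ∀ K, 0 ≤ g.s K
  s'_nonneg : ∀ K, 0 ≤ g.s' K

/-- A factor as an operator, at given `r` and outer momenta. -/
def op (g : Geom M N) (ρ : ℝ) (f : g.Ker) (G : ℝ → ℂ) (r : ℝ) (K : Pt M N) (ψ : Fock) : Fock :=
  interactOp g.p g.q f (ρ * (r + g.s K)) (ρ • g.k K) (ρ • g.k' K)
    (funHf (fun t => G (t + ρ * (r + g.s' K))) ψ)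

end Geom

section

variable {M N : ℕ} {ρ : ℝ}

lemma Geom.Valid.stateBound {g : Geom M N} (hg : g.Valid) (hρ : 0 ≤ ρ) {F X Y T Z : ℝ} {f : g.Ker}
    (hf : NiceKernel F f) (hF : 0 ≤ F) {G : ℝ → ℂ} (hG : Measurable G) (hc : C1On (Set.Ici 0) T Z G)
    (hZ : 0 ≤ Z) (hX : 0 ≤ X) (hY : 0 ≤ Y) {ψ : ℝ → Pt M N → Fock} (h : StateBound X Y ψ) :
    StateBound (F * (T * X)) (ρ + (ρ * Z + Y)) (fun r K => g.op ρ f G r K (ψ r K)) := by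
  have hT : 0 ≤ T := (norm_nonneg _).trans (hc.bound (Set.mem_Ici.2 le_rfl))
  refine StateBound.interactOp hf (StateBound.funHf hG hc hρ hg.meas_s' hg.s'_nonneg h) hF
    (mul_nonneg hT hX) (by positivity) hρ hg.meas_s hg.s_nonneg ?_ ?_
  · unfold Geom.k; fun_prop
  · unfold Geom.k'; fun_prop

/-- The vacuum vector, acted upon by `L` factors. -/
def chain (ρ : ℝ) : (L : ℕ) → (g : Fin L → Geom M N) → (∀ l, (g l).Ker) → (Fin L → ℝ → ℂ) →
    ℝ → Pt M N → Fock
  | 0, _, _, _ => fun _ _ => vacuum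
  | L + 1, g, f, G => fun r K => (g 0).op ρ (f 0) (G 0) r K
      (chain ρ L (fun l => g l.succ) (fun l => f l.succ) (fun l => G l.succ) r K)

lemma foldr_ofFn_eq_chain {L : ℕ} (g : Fin L → Geom M N) (f : ∀ l, (g l).Ker) (G : Fin L → ℝ → ℂ)
    (r : ℝ) (K : Pt M N) :
    (List.ofFn fun l => (g l).op ρ (f l) (G l) r K).foldr (fun A ψ => A ψ) vacuum =
      chain ρ L g f G r K := by
  induction L with
  | zero => rfl
  | succ L ih =>
    rw [List.ofFn_succ, List.foldr_cons, chain]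
    congr 1
    exact ih (fun l => g l.succ) (fun l => f l.succ) (fun l => G l.succ)

lemma stateBound_chain (hρ : 0 ≤ ρ) {L : ℕ} {g : Fin L → Geom M N} {f : ∀ l, (g l).Ker}
    {G : Fin L → ℝ → ℂ} {F T Z : Fin L → ℝ} (hg : ∀ l, (g l).Valid)
    (hf : ∀ l, NiceKernel (F l) (f l)) (hF : ∀ l, 0 ≤ F l) (hG : ∀ l, Measurable (G l))
    (hc : ∀ l, C1On (Set.Ici 0) (T l) (Z l) (G l)) (hZ : ∀ l, 0 ≤ Z l) :
    StateBound (∏ l, F l * T l) (∑ l, (ρ + ρ * Z l)) (chain ρ L g f G) := by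
  induction L with
  | zero => simpa [chain] using stateBound_vacuum
  | succ L ih =>
    have hT : ∀ l, 0 ≤ T l := fun l => (norm_nonneg _).trans ((hc l).bound (Set.mem_Ici.2 le_rfl))
    have h1 := (hg 0).stateBound hρ (hf 0) (hF 0) (hG 0) (hc 0) (hZ 0)
      (Finset.prod_nonneg fun l _ => mul_nonneg (hF l.succ) (hT l.succ))
      (Finset.sum_nonneg fun l _ => add_nonneg hρ (mul_nonneg hρ (hZ l.succ)))
      (ih (g := fun l => g l.succ) (f := fun l => f l.succ) (G := fun l => G l.succ)
        (F := fun l => F l.succ) (T := fun l => T l.succ) (Z := fun l => Z l.succ)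
        (fun l => hg _) (fun l => hf _) (fun l => hF _) (fun l => hG _) (fun l => hc _)
        (fun l => hZ _))
    rw [Fin.prod_univ_succ, Fin.sum_univ_succ, mul_assoc, add_assoc]
    exact h1

/-- Only states with total energy at most one are reached, so that the functions `G l` with `l` not
the last index are only needed on `[0,1]`. -/
lemma chain_congr_G (hρ : 0 ≤ ρ) {L : ℕ} {g : Fin L → Geom M N} {f : ∀ l, (g l).Ker}
    {G G' : Fin L → ℝ → ℂ} {F : Fin L → ℝ} (hg : ∀ l, (g l).Valid)
    (hf : ∀ l, NiceKernel (F l) (f l))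
    (hs : ∀ l l' : Fin L, (l' : ℕ) = l + 1 → ∀ K, (g l).s' K = (g l').s K + sumNorm ((g l').k K))
    (hG : ∀ (l : Fin L) s, 0 ≤ s → s ≤ 1 ∨ (l : ℕ) + 1 = L → G l s = G' l s) {r : ℝ} (hr : 0 ≤ r)
    (K : Pt M N) : chain ρ L g f G r K = chain ρ L g f G' r K := by
  induction L with
  | zero => rfl
  | succ L ih =>
    have ih' := ih (g := fun l => g l.succ) (f := fun l => f l.succ) (G := fun l => G l.succ)
      (G' := fun l => G' l.succ) (F := fun l => F l.succ) (fun l => hg _) (fun l => hf _)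
      (fun l l' h => hs _ _ (by simp [h])) (fun l s h0 h => hG _ _ h0 (by simpa using h))
    simp only [chain, ih', Geom.op]
    congr 1
    funext n κ
    simp only [funHf]
    have h0 : 0 ≤ sumNorm κ + ρ * (r + (g 0).s' K) := by
      have := sumNorm_nonneg κ
      have := (hg 0).s'_nonneg K
      positivity
    by_cases h1 : sumNorm κ + ρ * (r + (g 0).s' K) ≤ 1
    · rw [hG 0 _ h0 (Or.inl h1)]
    · cases L with
      | zero => rw [hG 0 _ h0 (Or.inr (by simp))]
      | succ L =>
        have : chain ρ (L + 1) (fun l => g l.succ) (fun l => f l.succ) (fun l => G' l.succ) r K n κ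
            = 0 := by
          simp only [chain, Geom.op]
          have h2 := (hg (Fin.succ 0)).s_nonneg K
          refine interactOp_of_energy (hf _) (by positivity) _ _ _ _ ?_
          rw [sumNorm_smul hρ]
          have := hs 0 (Fin.succ 0) (by simp) K
          rw [this] at h1
          push Not at h1
          linarith
        rw [this, mul_zero, mul_zero]

/-- Conservation of the particle number: `N = ∑ p - ∑ q`. -/
lemma chain_of_number {L : ℕ} {g : Fin L → Geom M N} {f : ∀ l, (g l).Ker}
    {G : Fin L → ℝ → ℂ} (r : ℝ) (K : Pt M N) {n : ℕ} (κ : Fin n → E3)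
    (h : n + ∑ l, (g l).q ≠ ∑ l, (g l).p) : chain ρ L g f G r K n κ = 0 := by
  induction L generalizing n with
  | zero =>
    simp only [Finset.univ_eq_empty, Finset.sum_empty, add_zero] at h
    simp [chain, vacuum, h]
  | succ L ih =>
    simp only [chain, Geom.op]
    by_cases ha : ∑ l : Fin L, (g l.succ).q ≤ ∑ l : Fin L, (g l.succ).p
    · refine interactOp_of_number (a := ∑ l : Fin L, (g l.succ).p - ∑ l : Fin L, (g l.succ).q)
        _ _ _ _ (fun n κ hn => ?_) κ ?_
      · rw [funHf, ih (g := fun l => g l.succ) κ (by omega), mul_zero]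
      · rw [Fin.sum_univ_succ, Fin.sum_univ_succ] at h
        omega
    · refine interactOp_of_number (a := n + (g 0).q + 1) _ _ _ _ (fun n κ hn => ?_) κ (by omega)
      rw [funHf, ih (g := fun l => g l.succ) κ (by omega), mul_zero]

/-- A single factor acting on the vacuum annihilates it unless `q = 0`. -/
lemma chain_one_of_pos {g : Fin 1 → Geom M N} {f : ∀ l, (g l).Ker}
    {G : Fin 1 → ℝ → ℂ} (r : ℝ) (K : Pt M N) {n : ℕ} (κ : Fin n → E3)
    (h : 0 < (g 0).q) : chain ρ 1 g f G r K n κ = 0 := by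
  simp only [chain, Geom.op]
  exact interactOp_of_lt (a := 0) _ _ _ _ (fun n κ hn => by simp [funHf, vacuum, hn]) κ h

/-! ### Changing the kernels on null sets -/

lemma surjective_comp_of_injective {a b : ℕ} {e : Fin a → Fin b} (he : Function.Injective e)
    (y : Fin a → E3) : ∃ x : Fin b → E3, ∀ i, x (e i) = y i := by
  obtain ⟨x, hx⟩ := he.surjective_comp_right (γ := E3) y
  exact ⟨x, fun i => congrFun hx i⟩

set_option synthInstance.maxSize 100000 in
set_option synthInstance.maxHeartbeats 400000 in
/-- Changing the kernel and the state of a factor on null sets only changes the resulting state on a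
null set: the momenta at which the kernel and the state are evaluated are surjective linear images
of the collection of all momenta, as no momentum is used twice. -/
lemma Geom.Valid.ae_eq_op {g : Geom M N} (hg : g.Valid) (hρ : 0 < ρ) (hρ1 : ρ ≤ 1) {f f' : g.Ker}
    (hf : ∀ᵐ y : (Fin (g.p + g.m) → E3) × (Fin (g.q + g.n) → E3),
      y ∈ ballPow (g.p + g.m) ×ˢ ballPow (g.q + g.n) → ∀ s, 0 ≤ s → f s y.1 y.2 = f' s y.1 y.2)
    (G : ℝ → ℂ) {ψ φ : ℝ → Pt M N → Fock}
    (h : ∀ n, ∀ᵐ z : Pt M N × (Fin n → E3), z.1 ∈ ballPow M ×ˢ ballPow N →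
      ∀ r ∈ Set.Icc (0 : ℝ) 1, ψ r z.1 n z.2 = φ r z.1 n z.2) (n : ℕ) :
    ∀ᵐ z : Pt M N × (Fin n → E3), z.1 ∈ ballPow M ×ˢ ballPow N →
      ∀ r ∈ Set.Icc (0 : ℝ) 1,
        g.op ρ f G r z.1 (ψ r z.1) n z.2 = g.op ρ f' G r z.1 (φ r z.1) n z.2 := by
  -- the annihilation integrals agree for almost all momenta
  have step1 : ∀ l, ∀ᵐ z : (Pt M N × (Fin g.p → E3)) × (Fin l → E3),
      z.1.1 ∈ ballPow M ×ˢ ballPow N → ∀ r ∈ Set.Icc (0 : ℝ) 1,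
      weight z.1.2 * ∫ x', annIntegrand g.q f (funHf (fun t => G (t + ρ * (r + g.s' z.1.1)))
        (ψ r z.1.1)) (ρ * (r + g.s z.1.1)) (ρ • g.k z.1.1) (ρ • g.k' z.1.1) z.1.2 z.2 x' =
      weight z.1.2 * ∫ x', annIntegrand g.q f' (funHf (fun t => G (t + ρ * (r + g.s' z.1.1)))
        (φ r z.1.1)) (ρ * (r + g.s z.1.1)) (ρ • g.k z.1.1) (ρ • g.k' z.1.1) z.1.2 z.2 x' := by
    intro l
    let T : (((Pt M N × (Fin g.p → E3)) × (Fin l → E3)) × (Fin g.q → E3)) →ₗ[ℝ]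
        (Fin (g.p + g.m) → E3) × (Fin (g.q + g.n) → E3) :=
      { toFun := fun z => (Fin.append z.1.1.2 (ρ • g.k z.1.1.1), Fin.append z.2 (ρ • g.k' z.1.1.1))
        map_add' := fun z z' => by
          ext1
          · funext i
            refine Fin.addCases (fun i => ?_) (fun i => ?_) i <;> simp [Geom.k]
          · funext i
            refine Fin.addCases (fun i => ?_) (fun i => ?_) i <;> simp [Geom.k']
        map_smul' := fun c z => by
          ext1
          · funext i
            refine Fin.addCases (fun i => ?_) (fun i => ?_) i <;> simp [Geom.k, smul_comm ρ c]
          · funext i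
            refine Fin.addCases (fun i => ?_) (fun i => ?_) i <;> simp [Geom.k', smul_comm ρ c] }
    have hT : Function.Surjective T := fun y => by
      obtain ⟨a, ha⟩ := surjective_comp_of_injective hg.inj fun i => ρ⁻¹ • y.1 (Fin.natAdd g.p i)
      obtain ⟨b, hb⟩ := surjective_comp_of_injective hg.inj' fun i => ρ⁻¹ • y.2 (Fin.natAdd g.q i)
      refine ⟨((((a, b), fun i => y.1 (Fin.castAdd g.m i)), 0),
        fun i => y.2 (Fin.castAdd g.n i)), ?_⟩
      ext1
      · funext i
        refine Fin.addCases (fun i => ?_) (fun i => ?_) i <;> simp [T, Geom.k, ha, hρ.ne']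
      · funext i
        refine Fin.addCases (fun i => ?_) (fun i => ?_) i <;> simp [T, Geom.k', hb, hρ.ne']
    have h1 := ae_comp_of_surjective
      (μ := (volume : Measure (((Pt M N × (Fin g.p → E3)) × (Fin l → E3)) × (Fin g.q → E3))))
      T hT hf
    have h2 : ∀ᵐ z : (((Pt M N × (Fin g.p → E3)) × (Fin l → E3)) × (Fin g.q → E3)),
        ∀ n (e : Fin n → Fin g.q ⊕ Fin l), Function.Injective e →
          z.1.1.1 ∈ ballPow M ×ˢ ballPow N → ∀ r ∈ Set.Icc (0 : ℝ) 1,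
            ψ r z.1.1.1 n (Sum.elim z.2 z.1.2 ∘ e) = φ r z.1.1.1 n (Sum.elim z.2 z.1.2 ∘ e) := by
      refine ae_all_iff.2 fun n => ae_all_iff.2 fun e => ?_
      by_cases he : Function.Injective e
      swap
      · exact Eventually.of_forall fun _ h => absurd h he
      let A : (((Pt M N × (Fin g.p → E3)) × (Fin l → E3)) × (Fin g.q → E3)) →ₗ[ℝ]
          Pt M N × (Fin n → E3) :=
        { toFun := fun z => (z.1.1.1, Sum.elim z.2 z.1.2 ∘ e)
          map_add' := fun z z' => by
            ext1
            · rfl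
            · funext i
              simp only [Function.comp_apply, Prod.fst_add, Prod.snd_add, Pi.add_apply]
              rcases e i with j | j <;> rfl
          map_smul' := fun c z => by
            ext1
            · rfl
            · funext i
              simp only [Function.comp_apply, Prod.smul_fst, Prod.smul_snd, Pi.smul_apply]
              rcases e i with j | j <;> rfl }
      have hA : Function.Surjective A := fun y => by
        obtain ⟨u, hu⟩ := he.surjective_comp_right (γ := E3) y.2
        refine ⟨(((y.1, 0), u ∘ Sum.inr), u ∘ Sum.inl), ?_⟩
        ext1
        · rfl
        · simp only [A, LinearMap.coe_mk, AddHom.coe_mk, Sum.elim_comp_inl_inr]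
          exact hu
      have h3 := ae_comp_of_surjective
        (μ := (volume : Measure (((Pt M N × (Fin g.p → E3)) × (Fin l → E3)) × (Fin g.q → E3))))
        A hA (h n)
      filter_upwards [h3] with z hz _ using hz
    have h3 := Measure.ae_ae_of_ae_prod
      (μ := (volume : Measure ((Pt M N × (Fin g.p → E3)) × (Fin l → E3))))
      (ν := (volume : Measure (Fin g.q → E3))) (h1.and h2)
    filter_upwards [h3] with z hz hB r hr
    by_cases hx : z.1.2 ∈ ballPow g.p
    swap
    · simp [weight, Set.indicator_of_notMem hx]
    congr 1
    refine integral_congr_ae ?_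
    filter_upwards [hz] with x' hx'
    obtain ⟨u1, u2⟩ := hx'
    simp only [annIntegrand]
    by_cases hxb : x' ∈ ballPow g.q
    swap
    · simp [weight, Set.indicator_of_notMem hxb]
    have hlt : ∀ y : E3, ‖y‖ < 1 → ‖ρ • y‖ < 1 := fun y hy => by
      rw [norm_smul, Real.norm_of_nonneg hρ.le]
      nlinarith [norm_nonneg y]
    have e1 : f (sumNorm z.2 + ρ * (r + g.s z.1.1)) (Fin.append z.1.2 (ρ • g.k z.1.1))
        (Fin.append x' (ρ • g.k' z.1.1)) = f' (sumNorm z.2 + ρ * (r + g.s z.1.1))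
        (Fin.append z.1.2 (ρ • g.k z.1.1)) (Fin.append x' (ρ • g.k' z.1.1)) := by
      refine u1 ⟨fun i => ?_, fun i => ?_⟩ _ ?_
      · refine Fin.addCases (fun i => ?_) (fun i => ?_) i
        · simpa [T] using hx i
        · simpa [T, Geom.k] using hlt _ (hB.1 (g.e i))
      · refine Fin.addCases (fun i => ?_) (fun i => ?_) i
        · simpa [T] using hxb i
        · simpa [T, Geom.k'] using hlt _ (hB.2 (g.e' i))
      · have := sumNorm_nonneg z.2
        have := hg.s_nonneg z.1.1
        have := hr.1
        positivity
    rw [e1]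
    congr 1
    refine annihilateN_congr _ _ _ _ fun n e he => ?_
    simp only [pRed, funHf]
    rw [u2 n e he hB r hr]
  -- the creation operators distribute distinct momenta among the arguments
  have step2 : ∀ᵐ z : Pt M N × (Fin n → E3), ∀ l (e : Fin g.p → Fin n) (e' : Fin l → Fin n),
      Function.Injective (Sum.elim e e') → z.1 ∈ ballPow M ×ˢ ballPow N →
      ∀ r ∈ Set.Icc (0 : ℝ) 1,
      weight (z.2 ∘ e) * ∫ x', annIntegrand g.q f (funHf (fun t => G (t + ρ * (r + g.s' z.1)))
        (ψ r z.1)) (ρ * (r + g.s z.1)) (ρ • g.k z.1) (ρ • g.k' z.1) (z.2 ∘ e) (z.2 ∘ e') x' =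
      weight (z.2 ∘ e) * ∫ x', annIntegrand g.q f' (funHf (fun t => G (t + ρ * (r + g.s' z.1)))
        (φ r z.1)) (ρ * (r + g.s z.1)) (ρ • g.k z.1) (ρ • g.k' z.1) (z.2 ∘ e) (z.2 ∘ e') x' := by
    refine ae_all_iff.2 fun l => ae_all_iff.2 fun e => ae_all_iff.2 fun e' => ?_
    by_cases he : Function.Injective (Sum.elim e e')
    swap
    · exact Eventually.of_forall fun _ h => absurd h he
    let A : (Pt M N × (Fin n → E3)) →ₗ[ℝ] (Pt M N × (Fin g.p → E3)) × (Fin l → E3) :=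
      { toFun := fun z => ((z.1, z.2 ∘ e), z.2 ∘ e')
        map_add' := fun z z' => rfl
        map_smul' := fun c z => rfl }
    have hA : Function.Surjective A := fun y => by
      obtain ⟨u, hu⟩ := he.surjective_comp_right (γ := E3) (Sum.elim y.1.2 y.2)
      refine ⟨(y.1.1, u), ?_⟩
      have e1 : u ∘ e = y.1.2 := funext fun i => congrFun hu (Sum.inl i)
      have e2 : u ∘ e' = y.2 := funext fun i => congrFun hu (Sum.inr i)
      simp only [A, LinearMap.coe_mk, AddHom.coe_mk, e1, e2]
    have h3 := ae_comp_of_surjective (μ := (volume : Measure (Pt M N × (Fin n → E3))))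
      A hA (step1 l)
    filter_upwards [h3] with z hz _ using hz
  filter_upwards [step2] with z hz hB r hr
  simp only [Geom.op, interactOp_eq]
  rw [pRed, pRed, funHf, funHf]
  congr 1
  exact createN_congr _ _ _ fun l e e' he => hz l e e' he hB r hr

/-- Changing the kernels of a chain on null sets only changes the states on null sets. -/
lemma ae_eq_chain (hρ : 0 < ρ) (hρ1 : ρ ≤ 1) {L : ℕ} {g : Fin L → Geom M N}
    (hg : ∀ l, (g l).Valid) {f f' : ∀ l, (g l).Ker} {G : Fin L → ℝ → ℂ}
    (hf : ∀ l, ∀ᵐ y : (Fin ((g l).p + (g l).m) → E3) × (Fin ((g l).q + (g l).n) → E3),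
      y ∈ ballPow ((g l).p + (g l).m) ×ˢ ballPow ((g l).q + (g l).n) →
        ∀ s, 0 ≤ s → f l s y.1 y.2 = f' l s y.1 y.2) (n : ℕ) :
    ∀ᵐ z : Pt M N × (Fin n → E3), z.1 ∈ ballPow M ×ˢ ballPow N →
      ∀ r ∈ Set.Icc (0 : ℝ) 1,
        chain ρ L g f G r z.1 n z.2 = chain ρ L g f' G r z.1 n z.2 := by
  induction L generalizing n with
  | zero => exact Eventually.of_forall fun _ _ _ _ => rfl
  | succ L ih =>
    exact (hg 0).ae_eq_op hρ hρ1 (hf 0) _ (fun n => ih (g := fun l => g l.succ) (fun l => hg _)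
      (f := fun l => f l.succ) (f' := fun l => f' l.succ) (G := fun l => G l.succ)
      (fun l => hf _) n) n

end

/-! ### The kernels `v` as chains -/

section

variable {L M N : ℕ}

/-- The `l`-th factor in the definition of `v_{m,p,n,q}`. -/
def MultiIndex.geom (i : MultiIndex L M N) (l : Fin L) : Geom M N where
  m := i.m l
  p := i.p l
  n := i.n l
  q := i.q l
  e := fun j => Fin.cast i.sum_m (finSigmaFinEquiv ⟨l, j⟩)
  e' := fun j => Fin.cast i.sum_n (finSigmaFinEquiv ⟨l, j⟩)
  s := fun K => ∑ j ∈ Finset.Iio l, sumNorm (block i.sum_n K.2 j) +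
    ∑ j ∈ Finset.Ioi l, sumNorm (block i.sum_m K.1 j)
  s' := fun K => ∑ j ∈ Finset.Iic l, sumNorm (block i.sum_n K.2 j) +
    ∑ j ∈ Finset.Ioi l, sumNorm (block i.sum_m K.1 j)

lemma measurable_sumNorm_block {M : ℕ} {m : Fin L → ℕ} (h : ∑ l, m l = M) (l : Fin L) :
    Measurable fun k : Fin M → E3 => sumNorm (block h k l) := by
  unfold block sumNorm
  fun_prop

lemma MultiIndex.geom_valid (i : MultiIndex L M N) (l : Fin L) : (i.geom l).Valid where
  inj a b h := by
    have h1 := finSigmaFinEquiv.injective (Fin.cast_injective i.sum_m h)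
    exact eq_of_heq (Sigma.mk.inj h1).2
  inj' a b h := by
    have h1 := finSigmaFinEquiv.injective (Fin.cast_injective i.sum_n h)
    exact eq_of_heq (Sigma.mk.inj h1).2
  meas_s := by
    have h1 := measurable_sumNorm_block i.sum_m
    have h2 := measurable_sumNorm_block i.sum_n
    exact (Finset.measurable_fun_sum _ fun j _ => (h2 j).comp measurable_snd).add
      (Finset.measurable_fun_sum _ fun j _ => (h1 j).comp measurable_fst)
  meas_s' := by
    have h1 := measurable_sumNorm_block i.sum_m
    have h2 := measurable_sumNorm_block i.sum_n
    exact (Finset.measurable_fun_sum _ fun j _ => (h2 j).comp measurable_snd).add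
      (Finset.measurable_fun_sum _ fun j _ => (h1 j).comp measurable_fst)
  s_nonneg K := add_nonneg (Finset.sum_nonneg fun _ _ => sumNorm_nonneg _)
    (Finset.sum_nonneg fun _ _ => sumNorm_nonneg _)
  s'_nonneg K := add_nonneg (Finset.sum_nonneg fun _ _ => sumNorm_nonneg _)
    (Finset.sum_nonneg fun _ _ => sumNorm_nonneg _)

lemma sum_sumNorm_block {M : ℕ} {m : Fin L → ℕ} (h : ∑ l, m l = M) (k : Fin M → E3) :
    ∑ l, sumNorm (block h k l) = sumNorm k := by
  simp only [sumNorm, block]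
  rw [← Fintype.sum_sigma' (f := fun l (j : Fin (m l)) =>
    ‖k (Fin.cast h (finSigmaFinEquiv ⟨l, j⟩))‖)]
  exact Equiv.sum_comp (finSigmaFinEquiv.trans (finCongr h)) fun i => ‖k i‖

/-- The identity `r̃_l = r_{l+1} + Σ[k_{l+1}]` between the energy shifts. -/
lemma MultiIndex.geom_shift (i : MultiIndex L M N) (l l' : Fin L) (h : (l' : ℕ) = l + 1)
    (K : Pt M N) : (i.geom l).s' K = (i.geom l').s K + sumNorm ((i.geom l').k K) := by
  have h1 : Finset.Iic l = Finset.Iio l' := by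
    ext j; simp only [Finset.mem_Iic, Finset.mem_Iio, Fin.le_def, Fin.lt_def]; omega
  have h2 : Finset.Ioi l = insert l' (Finset.Ioi l') := by
    ext j; simp only [Finset.mem_insert, Finset.mem_Ioi, Fin.lt_def, Fin.ext_iff]; omega
  have h3 : sumNorm ((i.geom l').k K) = sumNorm (block i.sum_m K.1 l') := rfl
  rw [h3]
  simp only [MultiIndex.geom, h1, h2, Finset.sum_insert (show l' ∉ Finset.Ioi l' by simp)]
  ring

lemma MultiIndex.geom_last (i : MultiIndex L M N) (l : Fin L) (h : (l : ℕ) + 1 = L) (K : Pt M N) :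
    (i.geom l).s' K = sumNorm K.2 := by
  have h1 : Finset.Iic l = Finset.univ := by
    ext j; simp only [Finset.mem_Iic, Finset.mem_univ, Fin.le_def, iff_true]; omega
  have h2 : Finset.Ioi l = ∅ := by
    ext j; simp only [Finset.mem_Ioi, Fin.lt_def, Finset.notMem_empty, iff_false]; omega
  simp only [MultiIndex.geom, h1, h2, Finset.sum_empty, add_zero, sum_sumNorm_block]

/-- The vacuum expectation of a chain of operators, with the leftmost cutoff function. -/
def chainKernel (χ : ℝ → ℝ) (ρ : ℝ) (g : Fin L → Geom M N) (f : ∀ l, (g l).Ker)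
    (G : Fin L → ℝ → ℂ) : KerFun M N :=
  fun r k k' => χ (r + sumNorm k) * chain ρ L g f G r (k, k') 0 Fin.elim0

/-- The functions `F_l` in the definition of `v`. -/
def resolventFun (χ χbar : ℝ → ℝ) (ρ : ℝ) (w : Kernel) (l : Fin L) (s : ℝ) : ℂ :=
  if (l : ℕ) + 1 = L then (χ (s / ρ) : ℂ) else (χbar (s / ρ) : ℂ) ^ 2 / w.zero s

lemma vKernel_eq_chainKernel (χ χbar : ℝ → ℝ) {ρ : ℝ} (hρ : 0 < ρ) (w : Kernel)
    (i : MultiIndex L M N) :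
    vKernel χ χbar ρ w i = chainKernel χ ρ i.geom
      (fun l => cutKernel (w (i.p l + i.m l) (i.q l + i.n l))) (resolventFun χ χbar ρ w) := by
  funext r k k'
  rw [chainKernel, ← foldr_ofFn_eq_chain]
  simp only [vKernel, funHf]
  congr 2
  rw [sum_sumNorm_block]
  congr 1
  simp only [sumNorm, Finset.univ_eq_empty, Finset.sum_empty, zero_add]
  field_simp

lemma interactOp_zero {m n p q : ℕ} (f : KerFun (p + m) (q + n)) (r : ℝ) (k : Fin m → E3)
    (k' : Fin n → E3) : interactOp p q f r k k' 0 = 0 := by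
  have := interactOp_smul_right (f := f) 0 r k k' 0
  simpa using this

lemma funHf_zero (g : ℝ → ℂ) : funHf g 0 = 0 := by
  funext n κ; simp [funHf]

/-- On the vacuum the last function `F_L` is evaluated at the energy shift alone. -/
lemma chain_eq_zero_of_last {ρ : ℝ} (g : Fin L → Geom M N) (f : ∀ l, (g l).Ker)
    (G : Fin L → ℝ → ℂ) (r : ℝ) (K : Pt M N) (l : Fin L) (hl : (l : ℕ) + 1 = L)
    (h : G l (ρ * (r + (g l).s' K)) = 0) : chain ρ L g f G r K = 0 := by
  induction L with
  | zero => exact l.elim0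
  | succ L ih =>
    simp only [chain, Geom.op]
    cases L with
    | zero =>
      obtain rfl : l = 0 := Fin.ext (by omega)
      have : funHf (fun t => G 0 (t + ρ * (r + (g 0).s' K))) (chain ρ 0 (fun l => g l.succ)
          (fun l => f l.succ) (fun l => G l.succ) r K) = 0 := by
        funext n κ
        cases n with
        | zero => simp [funHf, sumNorm, h]
        | succ n => simp [funHf, chain, vacuum]
      rw [this, interactOp_zero]
    | succ L =>
      obtain ⟨l', rfl⟩ : ∃ l' : Fin (L + 1), l = l'.succ :=
        Fin.exists_succ_eq.2 (fun h0 => by simp [h0] at hl) |>.imp fun _ h => h.symm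
      rw [ih (fun l => g l.succ) (fun l => f l.succ) (fun l => G l.succ) l' (by simpa using hl) h,
        funHf_zero, interactOp_zero]

/-- The outer cutoffs `F₀` and `F_L` enforce the support condition in the `k` and in the `k̃`. -/
lemma chainKernel_support {χ : ℝ → ℝ} (hχ : ∀ r, 1 < r → χ r = 0) {ρ : ℝ}
    (i : MultiIndex L M N) (f : ∀ l, (i.geom l).Ker) {G : Fin L → ℝ → ℂ}
    (hG : ∀ l : Fin L, (l : ℕ) + 1 = L → ∀ s, ρ < s → G l s = 0) (hρ : 0 < ρ) (hL : 0 < L)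
    (r : ℝ) (k : Fin M → E3) (k' : Fin N → E3) (h : 1 - max (sumNorm k) (sumNorm k') < r) :
    chainKernel χ ρ i.geom f G r k k' = 0 := by
  unfold chainKernel
  rcases lt_or_ge 1 (r + sumNorm k) with h1 | h1
  · simp [hχ _ h1]
  · have h2 : 1 < r + sumNorm k' := by
      rcases max_choice (sumNorm k) (sumNorm k') with h3 | h3 <;> rw [h3] at h <;> linarith
    obtain ⟨L, rfl⟩ : ∃ L', L = L' + 1 := ⟨L - 1, by omega⟩
    rw [chain_eq_zero_of_last _ _ _ _ _ (Fin.last L) (by simp), Pi.zero_apply, Pi.zero_apply,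
      mul_zero]
    refine hG _ (by simp) _ ?_
    rw [i.geom_last _ (by simp)]
    exact lt_mul_of_one_lt_right hρ h2

/-- Kernels that agree almost everywhere give vacuum expectations that agree almost everywhere. -/
lemma ae_eq_chainKernel {χ : ℝ → ℝ} {ρ : ℝ} (hρ : 0 < ρ) (hρ1 : ρ ≤ 1) {g : Fin L → Geom M N}
    (hg : ∀ l, (g l).Valid) {f f' : ∀ l, (g l).Ker} {G : Fin L → ℝ → ℂ}
    (hf : ∀ l, ∀ᵐ K ∂(momentumMeasure ((g l).p + (g l).m) ((g l).q + (g l).n)),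
        ∀ r ∈ Set.Icc (0 : ℝ) 1, f l r K.1 K.2 = f' l r K.1 K.2)
    (hf' : ∀ l s k k', s ∉ Set.Icc (0 : ℝ) 1 → 0 ≤ s → f l s k k' = f' l s k k') :
    ∀ᵐ K ∂(momentumMeasure M N), ∀ r ∈ Set.Icc (0 : ℝ) 1,
      chainKernel χ ρ g f G r K.1 K.2 = chainKernel χ ρ g f' G r K.1 K.2 := by
  rw [ae_momentumMeasure]
  have h1 := ae_eq_chain (M := M) (N := N) hρ hρ1 hg (f := f) (f' := f') (G := G) (fun l => by
    have := ae_momentumMeasure.1 (hf l)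
    filter_upwards [this] with y hy hB s hs
    by_cases hs1 : s ∈ Set.Icc (0 : ℝ) 1
    · exact hy hB s hs1
    · exact hf' l s _ _ hs1 hs) 0
  have h2 := Measure.ae_ae_of_ae_prod (μ := (volume : Measure (Pt M N)))
    (ν := (volume : Measure (Fin 0 → E3))) h1
  filter_upwards [h2] with K hK hB r hr
  obtain ⟨κ, hκ⟩ := hK.exists
  have := hκ hB r hr
  simp only [chainKernel]
  rw [Subsingleton.elim κ Fin.elim0] at this
  rw [this]

lemma fockWeight_zero (κ : Fin 0 → E3) : fockWeight κ = 1 := by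
  simp [fockWeight, singWeight]

/-- Measurability and the `C¹` bound of the vacuum expectation of a state. -/
lemma StateBound.vacuumExpectation {X Y c : ℝ} {ψ : ℝ → Pt M N → Fock} (h : StateBound X Y ψ)
    {χ : ℝ → ℝ} (hχ : ContinuousOn χ (Set.Ici 0))
    (hc : C1On (Set.Ici 0) 1 c (fun s => (χ s : ℂ))) :
    (∀ r ∈ Set.Icc (0 : ℝ) 1, Measurable fun K : Pt M N =>
      (χ (r + sumNorm K.1) : ℂ) * ψ r K 0 Fin.elim0) ∧
    ∀ K : Pt M N, C1On (Set.Icc 0 1) X (c + Y)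
      fun r => (χ (r + sumNorm K.1) : ℂ) * ψ r K 0 Fin.elim0 := by
  constructor
  · intro r hr
    refine Measurable.mul ?_ ?_
    · refine Complex.measurable_ofReal.comp (Continuous.measurable ?_)
      have h1 : Continuous fun K : Pt M N => r + sumNorm K.1 := by
        have := continuous_sumNorm M
        fun_prop
      exact hχ.comp_continuous h1 fun K => add_nonneg hr.1 (sumNorm_nonneg _)
    · exact (h.meas r 0).comp (f := fun K : Pt M N => (K, Fin.elim0)) (by fun_prop)
  · intro K
    have h1 := hc.comp_affine (e := 0) (ρ := 1) (s := sumNorm K.1) le_rfl zero_le_one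
      (sumNorm_nonneg _)
    simp only [zero_add, one_mul] at h1
    have h2 := h1.mul (h.c1 K 0 Fin.elim0)
    rw [fockWeight_zero, mul_one, one_mul] at h2
    exact h2

end

/-! ### Differentiation of chains with respect to a parameter -/

/-- First order expansion `f h = f₀ + h (f' + o(1))` of a family of good kernels. -/
def KernelDiff {a b : ℕ} (f : ℂ → KerFun a b) (f₀ f' : KerFun a b) : Prop :=
  (∃ F, NiceKernel F f₀) ∧ (∃ F, NiceKernel F f') ∧
    ∃ (e : ℂ → KerFun a b) (ε : ℂ → ℝ), Tendsto ε (𝓝[≠] 0) (𝓝 0) ∧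
      ∀ᶠ h in 𝓝[≠] 0, NiceKernel (ε h) (e h) ∧ f h = f₀ + h • (f' + e h)

/-- First order expansion `G h = G₀ + h (G' + o(1))` of a family of functions of the energy. -/
def FunDiff (G : ℂ → ℝ → ℂ) (G₀ G' : ℝ → ℂ) : Prop :=
  ∃ Z, 0 ≤ Z ∧ (∃ T, Measurable G₀ ∧ C1On (Set.Ici 0) T Z G₀) ∧
    (∃ T, Measurable G' ∧ C1On (Set.Ici 0) T Z G') ∧
    ∃ (e : ℂ → ℝ → ℂ) (ε : ℂ → ℝ), Tendsto ε (𝓝[≠] 0) (𝓝 0) ∧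
      ∀ᶠ h in 𝓝[≠] 0, Measurable (e h) ∧ C1On (Set.Ici 0) (ε h) Z (e h) ∧
        ∀ s, 0 ≤ s → G h s = G₀ s + h * (G' s + e h s)

/-- First order expansion `ψ h = ψ₀ + h (ψ' + o(1))` of a family of states. -/
def StateDiff {P : Type} [MeasurableSpace P] (ψ : ℂ → ℝ → P → Fock) (ψ₀ ψ' : ℝ → P → Fock) :
    Prop :=
  ∃ Y, 0 ≤ Y ∧ (∃ X, StateBound X Y ψ₀) ∧ (∃ X, StateBound X Y ψ') ∧
    ∃ (e : ℂ → ℝ → P → Fock) (ε : ℂ → ℝ), Tendsto ε (𝓝[≠] 0) (𝓝 0) ∧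
      ∀ᶠ h in 𝓝[≠] 0, StateBound (ε h) Y (e h) ∧
        ∀ r ∈ Set.Icc (0 : ℝ) 1, ∀ K, ψ h r K = ψ₀ r K + h • (ψ' r K + e h r K)

lemma FunDiff.const {G : ℝ → ℂ} {T Z : ℝ} (hZ : 0 ≤ Z) (hm : Measurable G)
    (hc : C1On (Set.Ici 0) T Z G) : FunDiff (fun _ => G) G 0 :=
  ⟨Z, hZ, ⟨T, hm, hc⟩, ⟨0, measurable_const, C1On.zero le_rfl hZ⟩, fun _ => 0, fun _ => 0,
    tendsto_const_nhds, Eventually.of_forall fun _ => ⟨measurable_const, C1On.zero le_rfl hZ,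
      fun s _ => by simp⟩⟩

lemma tendsto_norm_nhdsNE : Tendsto (fun h : ℂ => ‖h‖) (𝓝[≠] 0) (𝓝 0) := by
  have : Tendsto (fun h : ℂ => ‖h‖) (𝓝 0) (𝓝 ‖(0 : ℂ)‖) := continuous_norm.tendsto 0
  rw [norm_zero] at this
  exact this.mono_left nhdsWithin_le_nhds

lemma NiceKernel.nonneg {a b : ℕ} {F : ℝ} {f : KerFun a b} (h : NiceKernel F f) : 0 ≤ F :=
  (norm_nonneg _).trans ((h.c1 0 0).bound (Set.mem_Ici.2 le_rfl))

lemma StateBound.nonneg {P : Type} [MeasurableSpace P] [Inhabited P] {X Y : ℝ}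
    {ψ : ℝ → P → Fock} (h : StateBound X Y ψ) : 0 ≤ X := by
  have := (norm_nonneg _).trans ((h.c1 default 0 Fin.elim0).bound (Set.left_mem_Icc.2 zero_le_one))
  rwa [fockWeight_zero, mul_one] at this

/-- The remainder of a product of first order expansions tends to zero. -/
lemma tendsto_productRemainder {ε δ : ℂ → ℝ} (hε : Tendsto ε (𝓝[≠] 0) (𝓝 0))
    (hδ : Tendsto δ (𝓝[≠] 0) (𝓝 0)) (T X T' X' : ℝ) :
    Tendsto (fun h => T * δ h + ε h * X + ‖h‖ * ((T' + ε h) * (X' + δ h))) (𝓝[≠] 0) (𝓝 0) := by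
  have h1 := ((hδ.const_mul T).add (hε.mul_const X)).add
    (tendsto_norm_nhdsNE.mul ((hε.const_add T').mul (hδ.const_add X')))
  simpa using h1

section

variable {P : Type} [MeasurableSpace P] {ρ : ℝ} {ψ : ℂ → ℝ → P → Fock}
  {ψ₀ ψ' : ℝ → P → Fock} {s : P → ℝ}

lemma StateDiff.funHf {G : ℂ → ℝ → ℂ} {G₀ G' : ℝ → ℂ} (hG : FunDiff G G₀ G') (hρ : 0 ≤ ρ)
    (hs : Measurable s) (hs0 : ∀ K, 0 ≤ s K) (hψ : StateDiff ψ ψ₀ ψ') :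
    ∃ φ', StateDiff (fun h r K => funHf (fun t => G h (t + ρ * (r + s K))) (ψ h r K))
      (fun r K => funHf (fun t => G₀ (t + ρ * (r + s K))) (ψ₀ r K)) φ' := by
  obtain ⟨Z, hZ, ⟨T, hm, hT⟩, ⟨T', hm', hT'⟩, e, ε, hε, he⟩ := hG
  obtain ⟨Y, hY, ⟨X, hb⟩, ⟨X', hb'⟩, d, δ, hδ, hd⟩ := hψ
  refine ⟨_, ρ * Z + Y, by positivity, ⟨T * X, hb.funHf hm hT hρ hs hs0⟩,
    ⟨T * X' + T' * X,
      (hb'.funHf hm hT hρ hs hs0).add (hb.funHf hm' hT' hρ hs hs0)⟩,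
    fun h => ((fun r K => SpinBoson.funHf (fun t => G₀ (t + ρ * (r + s K))) (d h r K)) +
      (fun r K => SpinBoson.funHf (fun t => e h (t + ρ * (r + s K))) (ψ₀ r K))) +
      h • (fun r K => SpinBoson.funHf (fun t => (G' + e h) (t + ρ * (r + s K)))
        ((ψ' + d h) r K)),
    _, tendsto_productRemainder hε hδ T X T' X', ?_⟩
  filter_upwards [he, hd] with h ⟨he1, he2, he3⟩ ⟨hd1, hd2⟩
  refine ⟨((hd1.funHf hm hT hρ hs hs0).add (hb.funHf he1 he2 hρ hs hs0)).add
    (((hb'.add hd1).funHf (hm'.add he1) (hT'.add he2) hρ hs hs0).smul h), fun r hr K => ?_⟩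
  rw [hd2 r hr K]
  funext n κ
  rcases le_or_gt 0 (sumNorm κ + ρ * (r + s K)) with h0 | h0
  · simp only [SpinBoson.funHf, Pi.add_apply, Pi.smul_apply, smul_eq_mul, he3 _ h0]
    ring
  · exact absurd h0 (not_lt.2 (add_nonneg (sumNorm_nonneg _)
      (mul_nonneg hρ (add_nonneg hr.1 (hs0 K)))))

lemma StateDiff.interactOp [Inhabited P] {m n p q : ℕ} {f : ℂ → KerFun (p + m) (q + n)}
    {f₀ f' : KerFun (p + m) (q + n)} (hf : KernelDiff f f₀ f') {k : P → Fin m → E3}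
    {k' : P → Fin n → E3} (hρ : 0 ≤ ρ) (hs : Measurable s) (hs0 : ∀ K, 0 ≤ s K)
    (hk : Measurable k) (hk' : Measurable k') (hψ : StateDiff ψ ψ₀ ψ') :
    ∃ φ', StateDiff
      (fun h r K => interactOp p q (f h) (ρ * (r + s K)) (k K) (k' K) (ψ h r K))
      (fun r K => interactOp p q f₀ (ρ * (r + s K)) (k K) (k' K) (ψ₀ r K)) φ' := by
  obtain ⟨⟨T, hT⟩, ⟨T', hT'⟩, e, ε, hε, he⟩ := hf
  obtain ⟨Y, hY, ⟨X, hb⟩, ⟨X', hb'⟩, d, δ, hδ, hd⟩ := hψ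
  have B : ∀ {T X : ℝ} {f : KerFun (p + m) (q + n)} {ψ : ℝ → P → Fock}, NiceKernel T f →
      StateBound X Y ψ → StateBound (T * X) (ρ + Y)
        (fun r K => SpinBoson.interactOp p q f (ρ * (r + s K)) (k K) (k' K) (ψ r K)) :=
    fun h1 h2 => h2.interactOp h1 h1.nonneg h2.nonneg hY hρ hs hs0 hk hk'
  refine ⟨_, ρ + Y, by positivity, ⟨T * X, B hT hb⟩,
    ⟨T * X' + T' * X, (B hT hb').add (B hT' hb)⟩,
    fun h => ((fun r K => SpinBoson.interactOp p q f₀ (ρ * (r + s K)) (k K) (k' K) (d h r K)) +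
      (fun r K => SpinBoson.interactOp p q (e h) (ρ * (r + s K)) (k K) (k' K) (ψ₀ r K))) +
      h • (fun r K => SpinBoson.interactOp p q (f' + e h) (ρ * (r + s K)) (k K) (k' K)
        ((ψ' + d h) r K)),
    _, tendsto_productRemainder hε hδ T X T' X', ?_⟩
  filter_upwards [he, hd] with h ⟨he1, he2⟩ ⟨hd1, hd2⟩
  refine ⟨((B hT hd1).add (B he1 hb)).add ((B (hT'.add he1) (hb'.add hd1)).smul h),
    fun r hr K => ?_⟩
  have E1 := interactOp_add_left (f := f₀) (f' := h • (f' + e h)) (ψ := ψ₀ + h • (ψ' + d h))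
    hT ((hT'.add he1).smul h) (hb.add ((hb'.add hd1).smul h)) hρ hs hs0 hk hk' hr K
  have E2 : ∀ {T : ℝ} {f : KerFun (p + m) (q + n)} (_ : NiceKernel T f), _ :=
    fun {T f} hf => interactOp_add_right (f := f) (ψ := ψ₀) (φ := h • (ψ' + d h)) hf hb
      ((hb'.add hd1).smul h) hρ hs hs0 hk hk' hr K
  have E3' := interactOp_add_right (f := f₀) (ψ := ψ') (φ := d h) hT hb' hd1 hρ hs hs0 hk hk' hr K
  have E4 := interactOp_add_left (f := f') (f' := e h) (ψ := ψ₀) hT' he1 hb hρ hs hs0 hk hk' hr K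
  rw [hd2 r hr K, he2]
  change SpinBoson.interactOp p q (f₀ + h • (f' + e h)) (ρ * (r + s K)) (k K) (k' K)
    ((ψ₀ + h • (ψ' + d h)) r K) = _
  rw [E1]
  have E2a := E2 hT
  have E2b := E2 (hT'.add he1)
  simp only [Pi.add_apply, Pi.smul_apply, interactOp_smul_left, interactOp_smul_right]
    at E2a E2b E3' E4 ⊢
  rw [E2a, E2b, E3', E4]
  module

end

/-- Chains depend differentiably on the kernels and functions they are built from. -/
lemma stateDiff_chain {M N : ℕ} {ρ : ℝ} (hρ : 0 ≤ ρ) {L : ℕ} {g : Fin L → Geom M N}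
    (hg : ∀ l, (g l).Valid) {f : ℂ → ∀ l, (g l).Ker} {f₀ f' : ∀ l, (g l).Ker}
    (hf : ∀ l, KernelDiff (fun h => f h l) (f₀ l) (f' l)) {G : ℂ → Fin L → ℝ → ℂ}
    {G₀ G' : Fin L → ℝ → ℂ} (hG : ∀ l, FunDiff (fun h => G h l) (G₀ l) (G' l)) :
    ∃ ψ', StateDiff (fun h => chain ρ L g (f h) (G h)) (chain ρ L g f₀ G₀) ψ' := by
  induction L with
  | zero =>
    exact ⟨0, 0, le_rfl, ⟨1, stateBound_vacuum⟩, ⟨0, StateBound.zero le_rfl⟩,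
      fun _ => 0, fun _ => 0,
      tendsto_const_nhds, Eventually.of_forall fun h => ⟨StateBound.zero le_rfl, fun r _ K => by
        simp [chain]⟩⟩
  | succ L ih =>
    obtain ⟨ψ', hψ⟩ := ih (fun l => hg l.succ) (f := fun h l => f h l.succ)
      (fun l => hf l.succ) (G := fun h l => G h l.succ) (fun l => hG l.succ)
    obtain ⟨φ', hφ⟩ := hψ.funHf (hG 0) hρ (hg 0).meas_s' (hg 0).s'_nonneg
    exact hφ.interactOp (hf 0) hρ (hg 0).meas_s (hg 0).s_nonneg
      (k := fun K => ρ • (g 0).k K) (k' := fun K => ρ • (g 0).k' K)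
      (by unfold Geom.k; fun_prop) (by unfold Geom.k'; fun_prop)

/-- The vacuum expectation of a chain depends differentiably on the kernels and functions it is
built from, with respect to the norm `‖·‖^#`. -/
lemma chainKernel_differentiable {M N L : ℕ} {χ : ℝ → ℝ} {c ρ : ℝ} (hρ : 0 < ρ)
    (hχ : ContinuousOn χ (Set.Ici 0)) (hc0 : 0 ≤ c)
    (hc : C1On (Set.Ici 0) 1 c (fun s => (χ s : ℂ))) {g : Fin L → Geom M N}
    (hg : ∀ l, (g l).Valid) {f : ℂ → ∀ l, (g l).Ker} {f₀ f' : ∀ l, (g l).Ker}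
    (hf : ∀ l, KernelDiff (fun h => f h l) (f₀ l) (f' l)) {G : ℂ → Fin L → ℝ → ℂ}
    {G₀ G' : Fin L → ℝ → ℂ} (hG : ∀ l, FunDiff (fun h => G h l) (G₀ l) (G' l))
    (hs : ∀ᶠ h in 𝓝[≠] 0, ∀ r k k', 1 - max (sumNorm k) (sumNorm k') < r →
      chainKernel χ ρ g (f h) (G h) r k k' = 0)
    (hs₀ : ∀ r k k', 1 - max (sumNorm k) (sumNorm k') < r → chainKernel χ ρ g f₀ G₀ r k k' = 0) :
    ∃ v' : KerFun M N, MemPre v' ∧ Tendsto (fun h : ℂ => sharpNorm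
      (h⁻¹ • (chainKernel χ ρ g (f h) (G h) - chainKernel χ ρ g f₀ G₀) - v')) (𝓝[≠] 0) (𝓝 0) := by
  obtain ⟨ψ', Y, hY, ⟨X, hb⟩, ⟨X', hb'⟩, e, ε, hε, he⟩ := stateDiff_chain hρ.le hg hf hG
  have hcY : 0 ≤ c + Y := by positivity
  set v' : KerFun M N := fun r k k' => χ (r + sumNorm k) * ψ' r (k, k') 0 Fin.elim0 with hv'
  have hv1 := hb'.vacuumExpectation hχ hc
  -- the difference quotients differ from `v'` by the vacuum expectation of the remainder
  have key : ∀ᶠ h in 𝓝[≠] (0 : ℂ), StateBound (ε h) Y (e h) ∧ ∀ r ∈ Set.Icc (0 : ℝ) 1,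
      ∀ k k', (h⁻¹ • (chainKernel χ ρ g (f h) (G h) - chainKernel χ ρ g f₀ G₀) - v') r k k' =
        χ (r + sumNorm k) * e h r (k, k') 0 Fin.elim0 := by
    filter_upwards [he, self_mem_nhdsWithin] with h hh h0
    refine ⟨hh.1, fun r hr k k' => ?_⟩
    have h0' : h ≠ 0 := h0
    simp only [hv', Pi.sub_apply, Pi.smul_apply, chainKernel, hh.2 r hr (k, k'), smul_eq_mul,
      Pi.add_apply]
    field_simp
    ring
  refine ⟨v', MemPre.of_c1On hb'.nonneg hcY (fun r hr => ((hv1.1 r hr)).aestronglyMeasurable)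
    (Eventually.of_forall fun K => hv1.2 K) ?_, ?_⟩
  · refine Eventually.of_forall fun K r hr hK => ?_
    have h1 : Tendsto (fun _ : ℂ => v' r K.1 K.2) (𝓝[≠] 0) (𝓝 0) := by
      refine squeeze_zero_norm' ?_ hε
      filter_upwards [key, hs] with h hh hsh
      have h2 := hh.2 r hr K.1 K.2
      simp only [Pi.sub_apply, Pi.smul_apply, hsh r _ _ hK, hs₀ r _ _ hK, sub_zero, smul_zero,
        zero_sub] at h2
      rw [← norm_neg, h2]
      exact ((hh.1.vacuumExpectation hχ hc).2 K).bound hr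
    exact tendsto_nhds_unique tendsto_const_nhds h1
  · have h1 : Tendsto (fun h => ENNReal.ofReal (ε h * (1 + (c + Y)))) (𝓝[≠] 0) (𝓝 0) := by
      have := ENNReal.tendsto_ofReal (hε.mul_const (1 + (c + Y)))
      simpa using this
    refine tendsto_of_tendsto_of_tendsto_of_le_of_le' tendsto_const_nhds h1
      (Eventually.of_forall fun _ => zero_le) ?_
    filter_upwards [key] with h hh
    refine sharpNorm_le_of_c1On hh.1.nonneg hcY (Eventually.of_forall fun K => ?_)
    exact ((hh.1.vacuumExpectation hχ hc).2 K).congr fun r hr => hh.2 r hr K.1 K.2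

/-! ### The cutoff functions and the free resolvent -/

lemma C1On.comp_div {X Y ρ : ℝ} {g : ℝ → ℂ} (h : C1On (Set.Ici 0) X Y g) (hρ : 0 < ρ) :
    C1On (Set.Ici 0) X (Y / ρ) (fun s => g (s / ρ)) := by
  obtain ⟨g', d, c, b⟩ := h
  have hm : Set.MapsTo (fun s : ℝ => s / ρ) (Set.Ici 0) (Set.Ici 0) := fun s hs =>
    div_nonneg hs hρ.le
  refine ⟨fun s => (ρ⁻¹ : ℝ) * g' (s / ρ), fun s hs => ?_, ?_, fun s hs => ?_⟩
  · have h1 : HasDerivWithinAt (fun s : ℝ => s / ρ) ρ⁻¹ (Set.Ici 0) s := by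
      simpa using ((hasDerivAt_id s).div_const ρ).hasDerivWithinAt
    have := (d _ (hm hs)).scomp s h1 hm
    simpa [Function.comp_def] using this
  · exact continuousOn_const.mul (c.comp (by fun_prop) hm)
  · obtain ⟨b1, b2⟩ := b _ (hm hs)
    refine ⟨b1, ?_⟩
    rw [norm_mul, Complex.norm_real, norm_inv, Real.norm_of_nonneg hρ.le, mul_div_assoc',
      inv_mul_eq_div]
    gcongr

/-- A function vanishing on `[0,σ)` may be divided by one that is bounded below on `[σ,∞)`. -/
lemma C1On.div {X Y σ a κ : ℝ} {u q q' : ℝ → ℂ} (h : C1On (Set.Ici 0) X Y u) (hY : 0 ≤ Y)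
    (hu : ∀ s, 0 ≤ s → s < σ → u s = 0)
    (hq : ∀ s, 0 ≤ s → HasDerivAt q (q' s) s) (hc : Continuous q') (ha : 0 < a)
    (hqa : ∀ s, 0 ≤ s → σ ≤ s → a ≤ ‖q s‖) (hκ : ∀ s, 0 ≤ s → ‖q' s‖ ≤ κ) :
    C1On (Set.Ici 0) (X / a) (Y + κ / a) (fun s => u s / q s) := by
  obtain ⟨u', d, c, b⟩ := h
  have hX : 0 ≤ X := (norm_nonneg _).trans (b 0 (Set.mem_Ici.2 le_rfl)).1
  have hκ0 : 0 ≤ κ := (norm_nonneg _).trans (hκ 0 le_rfl)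
  have hlow : ∀ s, 0 ≤ s → s < σ → ∀ᶠ t in 𝓝[Set.Ici 0] s, u t = 0 := fun s hs hσ => by
    filter_upwards [self_mem_nhdsWithin, mem_nhdsWithin_of_mem_nhds (Iio_mem_nhds hσ)]
      with t ht ht' using hu t ht ht'
  have hu' : ∀ s, 0 ≤ s → s < σ → u' s = 0 := fun s hs hσ => by
    have h1 : HasDerivWithinAt u 0 (Set.Ici 0) s :=
      (hasDerivWithinAt_const s (Set.Ici 0) (0 : ℂ)).congr_of_eventuallyEq (hlow s hs hσ)
        (hu s hs hσ)
    rw [← (d s hs).derivWithin (uniqueDiffOn_Ici 0 s hs),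
      h1.derivWithin (uniqueDiffOn_Ici 0 s hs)]
  have hq0 : ∀ s, 0 ≤ s → σ ≤ s → q s ≠ 0 := fun s hs hσ h0 => by
    have := hqa s hs hσ
    rw [h0, norm_zero] at this
    linarith
  refine ⟨fun s => u' s / q s - u s / q s * (q' s / q s), fun s hs => ?_, fun s hs => ?_,
    fun s hs => ?_⟩
  · rcases lt_or_ge s σ with hσ | hσ
    · have h1 : u' s / q s - u s / q s * (q' s / q s) = 0 := by simp [hu' s hs hσ, hu s hs hσ]
      simp only [h1]
      refine (hasDerivWithinAt_const s (Set.Ici 0) (0 : ℂ)).congr_of_eventuallyEq ?_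
        (by simp [hu s hs hσ])
      filter_upwards [hlow s hs hσ] with t ht
      simp [ht]
    · have h0 := hq0 s hs hσ
      have h1 : u' s / q s - u s / q s * (q' s / q s) =
          (u' s * q s - u s * q' s) / q s ^ 2 := by field_simp
      simp only [h1]
      exact (d s hs).fun_div (hq s hs).hasDerivWithinAt h0
  · rcases lt_or_ge s σ with hσ | hσ
    · have h1 : ∀ᶠ t in 𝓝[Set.Ici 0] s, u' t / q t - u t / q t * (q' t / q t) = 0 := by
        filter_upwards [self_mem_nhdsWithin, mem_nhdsWithin_of_mem_nhds (Iio_mem_nhds hσ)]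
          with t ht ht'
        simp [hu t ht ht', hu' t ht ht']
      refine (continuousWithinAt_const (b := (0 : ℂ))).congr_of_eventuallyEq h1 ?_
      simp [hu s hs hσ, hu' s hs hσ]
    · have h0 := hq0 s hs hσ
      have hqc : ContinuousWithinAt q (Set.Ici 0) s := (hq s hs).continuousAt.continuousWithinAt
      exact ((c s hs).div hqc h0).sub (((d s hs).continuousWithinAt.div hqc h0).mul
        (hc.continuousWithinAt.div hqc h0))
  · rcases lt_or_ge s σ with hσ | hσ
    · simp only [hu s hs hσ, hu' s hs hσ, zero_div, zero_mul, sub_zero, norm_zero]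
      exact ⟨by positivity, by positivity⟩
    · have h1 := hqa s hs hσ
      have h2 : ‖u s / q s‖ ≤ X / a := by
        rw [norm_div]; exact div_le_div₀ hX (b s hs).1 ha h1
      refine ⟨h2, (_root_.norm_sub_le _ _).trans ?_⟩
      rw [mul_add]
      refine add_le_add ?_ ?_
      · rw [norm_div, div_mul_eq_mul_div]
        exact div_le_div₀ (by positivity) (b s hs).2 ha h1
      · rw [norm_mul]
        gcongr
        rw [norm_div]; exact div_le_div₀ hκ0 (hκ s hs) ha h1

/-- The maximal slope `‖∂_r χ₁‖_∞` of the cutoff function. -/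
def cutoffSlope (χ : ℝ → ℝ) : ℝ := ⨆ r : Set.Ici (0 : ℝ), |derivWithin χ (Set.Ici 0) r|

lemma cutoffSlope_nonneg (χ : ℝ → ℝ) : 0 ≤ cutoffSlope χ :=
  Real.iSup_nonneg fun _ => abs_nonneg _

lemma cTheta_eq (χ : ℝ → ℝ) : cTheta χ = 3 + 2 * cutoffSlope χ := rfl

section Cutoff

variable {χ χbar : ℝ → ℝ}

/-- The supremum in the definition of the slope is over a bounded set, hence no junk value: the
derivative is continuous and vanishes beyond energy one. -/
lemma IsCutoffPair.abs_derivWithin_le (h : IsCutoffPair χ χbar) {r : ℝ} (hr : 0 ≤ r) :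
    |derivWithin χ (Set.Ici 0) r| ≤ cutoffSlope χ := by
  have hc : ContinuousOn (derivWithin χ (Set.Ici 0)) (Set.Ici 0) :=
    h.smooth.continuousOn_derivWithin (uniqueDiffOn_Ici 0) (by simp)
  obtain ⟨C, hC⟩ := (isCompact_Icc (a := (0 : ℝ)) (b := 2)).exists_bound_of_continuousOn
    (hc.mono fun r hr => hr.1)
  refine le_ciSup (f := fun r : Set.Ici (0 : ℝ) => |derivWithin χ (Set.Ici 0) r|) ?_ ⟨r, hr⟩
  refine ⟨C, ?_⟩
  rintro _ ⟨⟨s, hs⟩, rfl⟩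
  rcases le_or_gt s 2 with h2 | h2
  · exact hC s ⟨hs, h2⟩
  · have h1 : HasDerivWithinAt χ 0 (Set.Ici 0) s := by
      refine (hasDerivWithinAt_const s (Set.Ici 0) (0 : ℝ)).congr_of_eventuallyEq ?_
        (h.eq_zero s (by linarith))
      filter_upwards [mem_nhdsWithin_of_mem_nhds (Ioi_mem_nhds (show (1 : ℝ) < s by linarith))]
        with t ht using h.eq_zero t ht
    have h3 := hC 0 ⟨le_rfl, by norm_num⟩
    simp only
    rw [h1.derivWithin (uniqueDiffOn_Ici 0 s hs), abs_zero]
    exact (norm_nonneg _).trans h3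

lemma IsCutoffPair.c1On (h : IsCutoffPair χ χbar) :
    C1On (Set.Ici 0) 1 (cutoffSlope χ) (fun s => (χ s : ℂ)) := by
  refine ⟨fun r => (derivWithin χ (Set.Ici 0) r : ℝ), fun r hr => ?_, ?_, fun r hr => ?_⟩
  · exact ((h.smooth.differentiableOn (by simp) r hr).hasDerivWithinAt).ofReal_comp
  · exact Complex.continuous_ofReal.comp_continuousOn
      (h.smooth.continuousOn_derivWithin (uniqueDiffOn_Ici 0) (by simp))
  · rw [Complex.norm_real, Complex.norm_real, one_mul]
    refine ⟨?_, h.abs_derivWithin_le hr⟩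
    rw [Real.norm_of_nonneg (h.mem r hr).1]
    exact (h.mem r hr).2

-- `χ̄₁²` is differentiated as `1 - χ₁²`, which involves the slope of `χ₁` only.
lemma IsCutoffPair.c1On_sq (h : IsCutoffPair χ χbar) :
    C1On (Set.Ici 0) 1 (2 * cutoffSlope χ) (fun s => (χbar s : ℂ) ^ 2) := by
  obtain ⟨g', d, c, b⟩ := h.c1On
  have e : ∀ s, 0 ≤ s → (χbar s : ℂ) ^ 2 = 1 - (χ s : ℂ) * χ s := fun s hs => by
    have := h.sq_add_sq s hs
    rw [← Complex.ofReal_pow, show χbar s ^ 2 = 1 - χ s ^ 2 by linarith]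
    push_cast
    ring
  have h0 : C1On (Set.Ici 0) 1 (2 * cutoffSlope χ) (fun s => 1 - (χ s : ℂ) * χ s) := by
    refine ⟨fun s => 0 - (g' s * χ s + χ s * g' s), fun s hs => ?_, ?_, fun s hs => ?_⟩
    · exact (hasDerivWithinAt_const s _ 1).fun_sub ((d s hs).mul (d s hs))
    · have := h.c1On.continuousOn
      exact continuousOn_const.sub ((c.mul this).add (this.mul c))
    · constructor
      · change ‖1 - (χ s : ℂ) * χ s‖ ≤ 1
        rw [← e s hs, ← Complex.ofReal_pow, Complex.norm_real, norm_pow,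
          Real.norm_of_nonneg (h.mem_bar s hs).1]
        exact pow_le_one₀ (h.mem_bar s hs).1 (h.mem_bar s hs).2
      · have h1 := (b s hs).1
        have h2 := (b s hs).2
        change ‖0 - (g' s * χ s + χ s * g' s)‖ ≤ _
        rw [zero_sub, norm_neg, mul_comm (χ s : ℂ), ← two_mul, norm_mul, norm_mul, Complex.norm_two,
          one_mul]
        rw [one_mul] at h2
        have := mul_le_mul h2 h1 (norm_nonneg _) ((norm_nonneg _).trans h2)
        linarith
  exact h0.congr e

lemma IsCutoffPair.bar_eq_zero (h : IsCutoffPair χ χbar) {s : ℝ} (hs : 0 ≤ s) (hs' : s < 3 / 4) :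
    (χbar s : ℂ) ^ 2 = 0 := by
  have h1 := h.sq_add_sq s hs
  rw [h.eq_one s hs hs'] at h1
  rw [← Complex.ofReal_pow, show χbar s ^ 2 = 0 by linarith, Complex.ofReal_zero]

end Cutoff

/-! ### Extension of the free part to all energies -/

/-- The derivative of a `C¹` function on `[0,1]`, extended to a continuous function on the line that
vanishes on `[2,∞)`. -/
def extDeriv (q : ℝ → ℂ) (s : ℝ) : ℂ :=
  (max 0 (min 1 (2 - s)) : ℝ) *
    derivWithin q (Set.Icc 0 1) (Set.projIcc (0 : ℝ) 1 zero_le_one s)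

/-- Extension of a `C¹` function on `[0,1]` to a bounded `C¹` function on `[0,∞)`. -/
def ext (q : ℝ → ℂ) (s : ℝ) : ℂ := q 0 + ∫ t in (0 : ℝ)..s, extDeriv q t

section Extension

variable {q q₁ q₂ : ℝ → ℂ}

lemma continuous_extDeriv (hq : ContDiffOn ℝ 1 q (Set.Icc 0 1)) : Continuous (extDeriv q) := by
  have h1 := hq.continuousOn_derivWithin uniqueDiffOn_Icc_zero_one (by simp)
  refine (Complex.continuous_ofReal.comp (by fun_prop)).mul ?_
  exact h1.comp_continuous (continuous_subtype_val.comp continuous_projIcc)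
    fun s => Subtype.coe_prop _

lemma hasDerivAt_ext (hq : ContDiffOn ℝ 1 q (Set.Icc 0 1)) (s : ℝ) :
    HasDerivAt (ext q) (extDeriv q s) s :=
  (intervalIntegral.integral_hasDerivAt_right ((continuous_extDeriv hq).intervalIntegrable _ _)
    ((continuous_extDeriv hq).stronglyMeasurableAtFilter _ _)
    (continuous_extDeriv hq).continuousAt).const_add _

lemma extDeriv_of_mem {s : ℝ} (hs : s ∈ Set.Icc (0 : ℝ) 1) :
    extDeriv q s = derivWithin q (Set.Icc 0 1) s := by
  rw [extDeriv, Set.projIcc_of_mem _ hs, min_eq_left (by linarith [hs.2]),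
    max_eq_right zero_le_one, Complex.ofReal_one, one_mul]

lemma ext_of_mem (hq : ContDiffOn ℝ 1 q (Set.Icc 0 1)) {s : ℝ} (hs : s ∈ Set.Icc (0 : ℝ) 1) :
    ext q s = q s := by
  have h1 : ∫ t in (0 : ℝ)..s, extDeriv q t = q s - q 0 := by
    refine intervalIntegral.integral_eq_sub_of_hasDeriv_right_of_le hs.1
      (hq.continuousOn.mono (Set.Icc_subset_Icc_right hs.2)) (fun t ht => ?_)
      ((continuous_extDeriv hq).intervalIntegrable _ _)
    have ht' : t ∈ Set.Icc (0 : ℝ) 1 := ⟨ht.1.le, ht.2.le.trans hs.2⟩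
    rw [extDeriv_of_mem ht']
    have := (hq.differentiableOn (by simp) t ht').hasDerivWithinAt
    have h2 : Set.Icc (0 : ℝ) 1 ∈ 𝓝[>] t :=
      mem_nhdsWithin_of_mem_nhds (Icc_mem_nhds ht.1 (ht.2.trans_le hs.2))
    exact this.mono_of_mem_nhdsWithin h2
  rw [ext, h1]
  ring

lemma norm_extDeriv_le {B : ℝ} (hB : ∀ r ∈ Set.Icc (0 : ℝ) 1, ‖derivWithin q (Set.Icc 0 1) r‖ ≤ B)
    (s : ℝ) : ‖extDeriv q s‖ ≤ B := by
  have h1 := hB _ (Set.projIcc (0 : ℝ) 1 zero_le_one s).2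
  have h2 : |max 0 (min 1 (2 - s))| ≤ 1 := by
    rw [abs_of_nonneg (le_max_left _ _)]
    exact max_le zero_le_one (min_le_left _ _)
  rw [extDeriv, norm_mul, Complex.norm_real, Real.norm_eq_abs]
  calc _ ≤ 1 * B := mul_le_mul h2 h1 (norm_nonneg _) zero_le_one
    _ = B := one_mul B

lemma ext_of_two_le (hq : ContDiffOn ℝ 1 q (Set.Icc 0 1)) {s : ℝ} (hs : 2 ≤ s) :
    ext q s = ext q 2 := by
  have h1 := (continuous_extDeriv hq).intervalIntegrable (μ := volume)
  rw [ext, ext, ← intervalIntegral.integral_add_adjacent_intervals (h1 0 2) (h1 2 s)]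
  have h2 : ∫ t in (2 : ℝ)..s, extDeriv q t = 0 := by
    rw [intervalIntegral.integral_congr (g := fun _ => (0 : ℂ)), intervalIntegral.integral_zero]
    intro t ht
    rw [Set.uIcc_of_le hs] at ht
    have h3 : max 0 (min 1 (2 - t)) = 0 :=
      max_eq_left ((min_le_right _ _).trans (by linarith [ht.1]))
    simp [extDeriv, h3]
  rw [h2, add_zero]

lemma c1On_ext (hq : ContDiffOn ℝ 1 q (Set.Icc 0 1)) {B : ℝ}
    (hB0 : ∀ r ∈ Set.Icc (0 : ℝ) 1, ‖q r‖ ≤ B)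
    (hB : ∀ r ∈ Set.Icc (0 : ℝ) 1, ‖derivWithin q (Set.Icc 0 1) r‖ ≤ B) :
    C1On (Set.Ici 0) (3 * B) 1 (ext q) := by
  have hB' : 0 ≤ B := (norm_nonneg _).trans (hB0 0 (by simp))
  refine ⟨extDeriv q, fun s _ => (hasDerivAt_ext hq s).hasDerivWithinAt,
    (continuous_extDeriv hq).continuousOn, fun s hs => ⟨?_, ?_⟩⟩
  · have h1 : ∀ t, 0 ≤ t → t ≤ 2 → ‖ext q t‖ ≤ 3 * B := fun t ht ht2 => by
      have h2 : ‖∫ t in (0 : ℝ)..t, extDeriv q t‖ ≤ B * |t - 0| :=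
        intervalIntegral.norm_integral_le_of_norm_le_const fun x _ => norm_extDeriv_le hB x
      rw [sub_zero, abs_of_nonneg ht] at h2
      have h3 := hB0 0 (by simp)
      refine (norm_add_le _ _).trans ?_
      nlinarith
    rcases le_total s 2 with h2 | h2
    · exact h1 s hs h2
    · rw [ext_of_two_le hq h2]
      exact h1 2 (by norm_num) le_rfl
  · have := norm_extDeriv_le hB s
    linarith

lemma extDeriv_add_smul (h1 : ContDiffOn ℝ 1 q₁ (Set.Icc 0 1))
    (h2 : ContDiffOn ℝ 1 q₂ (Set.Icc 0 1)) (c : ℂ)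
    (h : ∀ r ∈ Set.Icc (0 : ℝ) 1, q r = q₁ r + c * q₂ r) (s : ℝ) :
    extDeriv q s = extDeriv q₁ s + c * extDeriv q₂ s := by
  obtain ⟨t, ht⟩ : ∃ t, t = (Set.projIcc (0 : ℝ) 1 zero_le_one s).1 := ⟨_, rfl⟩
  have htm : t ∈ Set.Icc (0 : ℝ) 1 := ht ▸ (Set.projIcc (0 : ℝ) 1 zero_le_one s).2
  have d1 := (h1.differentiableOn (by simp) t htm).hasDerivWithinAt
  have d2 := (h2.differentiableOn (by simp) t htm).hasDerivWithinAt
  have d := ((d1.fun_add (d2.const_mul c)).congr h (h t htm)).derivWithin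
    (uniqueDiffOn_Icc_zero_one t htm)
  simp only [extDeriv, ← ht, d]
  ring

/-- The extension is linear in the extended function. -/
lemma ext_add_smul (h1 : ContDiffOn ℝ 1 q₁ (Set.Icc 0 1))
    (h2 : ContDiffOn ℝ 1 q₂ (Set.Icc 0 1)) (c : ℂ)
    (h : ∀ r ∈ Set.Icc (0 : ℝ) 1, q r = q₁ r + c * q₂ r) (s : ℝ) :
    ext q s = ext q₁ s + c * ext q₂ s := by
  have i1 := (continuous_extDeriv h1).intervalIntegrable (μ := volume) 0 s
  have i2 := (continuous_extDeriv h2).intervalIntegrable (μ := volume) 0 s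
  rw [ext, ext, ext, h 0 (by simp), funext (extDeriv_add_smul h1 h2 c h),
    intervalIntegral.integral_add i1 (i2.const_mul c), intervalIntegral.integral_const_mul]
  ring

end Extension

/-- The conditions on `w_{0,0}` under which the resolvent `χ̄_ρ²/w_{0,0}` is controlled. -/
structure GoodFree (ρ : ℝ) (q : ℝ → ℂ) : Prop where
  contDiff : ContDiffOn ℝ 1 q (Set.Icc 0 1)
  deriv_le : ∀ r ∈ Set.Icc (0 : ℝ) 1, ‖derivWithin q (Set.Icc 0 1) r - 1‖ ≤ 1 / 100
  value_le : ‖q 0‖ ≤ ρ / 2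

namespace GoodFree

variable {ρ : ℝ} {q : ℝ → ℂ}

lemma norm_deriv_le (h : GoodFree ρ q) {r : ℝ} (hr : r ∈ Set.Icc (0 : ℝ) 1) :
    ‖derivWithin q (Set.Icc 0 1) r‖ ≤ 11 / 10 := by
  have h1 := h.deriv_le r hr
  have h2 := norm_sub_norm_le (derivWithin q (Set.Icc 0 1) r) 1
  rw [norm_one] at h2
  linarith

lemma le_re_deriv (h : GoodFree ρ q) {r : ℝ} (hr : r ∈ Set.Icc (0 : ℝ) 1) :
    99 / 100 ≤ (derivWithin q (Set.Icc 0 1) r).re := by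
  have h1 := (Complex.abs_re_le_norm _).trans (h.deriv_le r hr)
  rw [Complex.sub_re, Complex.one_re] at h1
  linarith [(abs_le.1 h1).1]

/-- The extended free part stays away from zero where `χ̄_ρ` does not vanish. -/
lemma le_norm_ext (h : GoodFree ρ q) (hρ : 0 < ρ) (hρ1 : ρ ≤ 1) {s : ℝ} (hs : 3 / 4 * ρ ≤ s) :
    ρ / 5 ≤ ‖ext q s‖ := by
  have hd : ∀ t, HasDerivAt (fun t => (ext q t).re) (extDeriv q t).re t := fun t =>
    (Complex.reCLM.hasFDerivAt.comp_hasDerivAt t (hasDerivAt_ext h.contDiff t))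
  have hmono : Monotone fun t => (ext q t).re := by
    refine monotone_of_deriv_nonneg (fun t => (hd t).differentiableAt) fun t => ?_
    rw [(hd t).deriv, extDeriv, Complex.re_ofReal_mul]
    exact mul_nonneg (le_max_left _ _)
      (by linarith [h.le_re_deriv (Set.projIcc (0 : ℝ) 1 zero_le_one t).2])
  have h1 : 99 / 100 * (3 / 4 * ρ - 0) ≤ (ext q (3 / 4 * ρ)).re - (ext q 0).re := by
    refine Convex.mul_sub_le_image_sub_of_le_deriv (convex_Icc (0 : ℝ) 1)
      (f := fun t => (ext q t).re)
      (fun t _ => (hd t).continuousAt.continuousWithinAt)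
      (fun t _ => (hd t).differentiableAt.differentiableWithinAt) (fun t ht => ?_) 0 (by simp)
      (3 / 4 * ρ) ⟨by positivity, by linarith⟩ (by positivity)
    rw [interior_Icc] at ht
    have ht' : t ∈ Set.Icc (0 : ℝ) 1 := Set.Ioo_subset_Icc_self ht
    rw [(hd t).deriv, extDeriv_of_mem ht']
    exact h.le_re_deriv ht'
  have h2 : (ext q 0).re = (q 0).re := by simp [ext]
  have h3 := (abs_le.1 ((Complex.abs_re_le_norm _).trans h.value_le)).1
  have h4 := hmono hs
  have h5 := Complex.re_le_norm (ext q s)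
  simp only at h4
  linarith

/-- Dividing by the free part costs a factor `5/ρ`, and `11/(2ρ)` in the logarithmic derivative. -/
lemma c1On_div (h : GoodFree ρ q) (hρ : 0 < ρ) (hρ1 : ρ ≤ 1) {X Y : ℝ} {u : ℝ → ℂ}
    (hu : C1On (Set.Ici 0) X Y u) (hY : 0 ≤ Y) (h0 : ∀ s, 0 ≤ s → s < 3 / 4 * ρ → u s = 0) :
    C1On (Set.Ici 0) (5 / ρ * X) (Y + 11 / 2 / ρ) (fun s => u s / ext q s) := by
  have := hu.div hY h0 (fun s _ => hasDerivAt_ext h.contDiff s) (continuous_extDeriv h.contDiff)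
    (a := ρ / 5) (κ := 11 / 10) (by positivity) (fun s _ hs => h.le_norm_ext hρ hρ1 hs)
    (fun s _ => norm_extDeriv_le (fun r hr => h.norm_deriv_le hr) s)
  convert this using 1
  · field_simp
  · field_simp
    ring

end GoodFree

/-! ### The functions `F_l` and their dependence on the free part -/

/-- The function `χ_ρ`, extended to the line as a constant on the negative energies. -/
def cutoffFun (χ : ℝ → ℝ) (ρ s : ℝ) : ℂ := (χ (max s 0 / ρ) : ℂ)

/-- The function `χ̄_ρ²/w_{0,0}`, with `w_{0,0}` extended beyond energy one, and constant on the
negative energies. -/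
def freeResolvent (χbar : ℝ → ℝ) (ρ : ℝ) (q : ℝ → ℂ) (s : ℝ) : ℂ :=
  (χbar (max s 0 / ρ) : ℂ) ^ 2 / ext q (max s 0)

lemma measurable_comp_max {g : ℝ → ℂ} (hg : ContinuousOn g (Set.Ici 0)) :
    Measurable fun s => g (max s 0) :=
  (hg.comp_continuous (by fun_prop) fun s => le_max_right s 0).measurable

section

variable {χ χbar : ℝ → ℝ} {ρ : ℝ}

lemma IsCutoffPair.cutoffFun_spec (h : IsCutoffPair χ χbar) (hρ : 0 < ρ) :
    Measurable (cutoffFun χ ρ) ∧ C1On (Set.Ici 0) 1 (cutoffSlope χ / ρ) (cutoffFun χ ρ) := by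
  have h1 := h.c1On.comp_div hρ
  exact ⟨measurable_comp_max h1.continuousOn,
    h1.congr fun s hs => by simp [cutoffFun, max_eq_left (Set.mem_Ici.1 hs)]⟩

lemma IsCutoffPair.bar_scaled_eq_zero (h : IsCutoffPair χ χbar) (hρ : 0 < ρ) {s : ℝ} (hs : 0 ≤ s)
    (hs' : s < 3 / 4 * ρ) : (χbar (s / ρ) : ℂ) ^ 2 = 0 :=
  h.bar_eq_zero (div_nonneg hs hρ.le) (by rwa [div_lt_iff₀ hρ])

lemma IsCutoffPair.freeResolvent_spec (h : IsCutoffPair χ χbar) (hρ : 0 < ρ) (hρ1 : ρ ≤ 1)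
    {q : ℝ → ℂ} (hq : GoodFree ρ q) :
    Measurable (freeResolvent χbar ρ q) ∧
      C1On (Set.Ici 0) (5 / ρ) ((2 * cutoffSlope χ + 11 / 2) / ρ) (freeResolvent χbar ρ q) := by
  have hc := cutoffSlope_nonneg χ
  have h1 := hq.c1On_div hρ hρ1 (h.c1On_sq.comp_div hρ) (by positivity)
    fun s hs hs' => h.bar_scaled_eq_zero hρ hs hs'
  rw [mul_one, ← add_div] at h1
  exact ⟨measurable_comp_max h1.continuousOn,
    h1.congr fun s hs => by simp [freeResolvent, max_eq_left (Set.mem_Ici.1 hs)]⟩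

/-- The function `χ̄_ρ²/w_{0,0}` depends differentiably on `w_{0,0}`. -/
lemma IsCutoffPair.funDiff_freeResolvent (hχ : IsCutoffPair χ χbar) (hρ : 0 < ρ) (hρ1 : ρ ≤ 1)
    {q e : ℂ → ℝ → ℂ} {q₀ q' : ℝ → ℂ} {B : ℝ} {ε : ℂ → ℝ} (h0 : GoodFree ρ q₀)
    (hq : ∀ᶠ h in 𝓝[≠] 0, GoodFree ρ (q h)) (hq' : ContDiffOn ℝ 1 q' (Set.Icc 0 1))
    (hB : ∀ r ∈ Set.Icc (0 : ℝ) 1, ‖q' r‖ ≤ B ∧ ‖derivWithin q' (Set.Icc 0 1) r‖ ≤ B)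
    (hε : Tendsto ε (𝓝[≠] 0) (𝓝 0))
    (he : ∀ᶠ h in 𝓝[≠] 0, ContDiffOn ℝ 1 (e h) (Set.Icc 0 1) ∧ ∀ r ∈ Set.Icc (0 : ℝ) 1,
      ‖e h r‖ ≤ ε h ∧ ‖derivWithin (e h) (Set.Icc 0 1) r‖ ≤ ε h)
    (hqe : ∀ᶠ h in 𝓝[≠] 0, ∀ r ∈ Set.Icc (0 : ℝ) 1, q h r = q₀ r + h * (q' r + e h r)) :
    ∃ G', FunDiff (fun h => freeResolvent χbar ρ (q h)) (freeResolvent χbar ρ q₀) G' := by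
  have hc := cutoffSlope_nonneg χ
  set b : ℝ → ℂ := fun s => (χbar (s / ρ) : ℂ) ^ 2 with hb
  set Y : ℝ := 2 * cutoffSlope χ / ρ with hY
  have hY0 : 0 ≤ Y := by positivity
  have cb : C1On (Set.Ici 0) 1 Y b := hχ.c1On_sq.comp_div hρ
  have bz : ∀ s, 0 ≤ s → s < 3 / 4 * ρ → b s = 0 := fun s hs hs' =>
    hχ.bar_scaled_eq_zero hρ hs hs'
  have cq' := c1On_ext hq' (fun r hr => (hB r hr).1) (fun r hr => (hB r hr).2)
  set D : ℝ := 11 / 2 / ρ with hD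
  have hD0 : 0 ≤ D := by positivity
  set Z : ℝ := Y + 2 + 3 * D with hZ
  have hZ0 : 0 ≤ Z := by positivity
  -- the derivative `-χ̄_ρ² w' / w²` and the remainder of the expansion
  set F' : ℝ → ℂ := fun s => -1 * (b s * ext q' s / ext q₀ s / ext q₀ s) with hF'
  set R : ℂ → ℝ → ℂ := fun h s => -1 * (b s * ext (e h) s / ext (q h) s / ext q₀ s) +
    h * (b s * ext q' s * (ext q' s + ext (e h) s) / ext (q h) s / ext q₀ s / ext q₀ s) with hR
  have dz : ∀ {u v : ℝ → ℂ}, (∀ s, 0 ≤ s → s < 3 / 4 * ρ → u s = 0) →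
      ∀ s, 0 ≤ s → s < 3 / 4 * ρ → u s / v s = 0 := fun hu s hs hs' => by
    rw [hu s hs hs', zero_div]
  have mz : ∀ {u v : ℝ → ℂ}, (∀ s, 0 ≤ s → s < 3 / 4 * ρ → u s = 0) →
      ∀ s, 0 ≤ s → s < 3 / 4 * ρ → u s * v s = 0 := fun hu s hs hs' => by
    rw [hu s hs hs', zero_mul]
  have cF' : ∃ T, C1On (Set.Ici 0) T Z F' := by
    have h1 := cb.mul cq'
    have h2 := h0.c1On_div hρ hρ1 h1 (by positivity) (mz bz)
    have h3 := h0.c1On_div hρ hρ1 h2 (by positivity) (dz (mz bz))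
    exact ⟨_, (h3.const_mul (-1)).mono le_rfl (by rw [hZ]; linarith) hZ0⟩
  obtain ⟨T', hT'⟩ := cF'
  obtain ⟨m0, c0⟩ := hχ.freeResolvent_spec hρ hρ1 h0
  refine ⟨fun s => F' (max s 0), Z, hZ0, ⟨_, m0, c0.mono le_rfl ?_ hZ0⟩,
    ⟨T', measurable_comp_max hT'.continuousOn, hT'.congr fun s hs => by
      rw [max_eq_left (Set.mem_Ici.1 hs)]⟩, fun h s => R h (max s 0),
    fun h => ‖(-1 : ℂ)‖ * (5 / ρ * (5 / ρ * (1 * (3 * ε h)))) +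
      ‖h‖ * (5 / ρ * (5 / ρ * (5 / ρ * (1 * (3 * B) * (3 * B + 3 * ε h))))), ?_, ?_⟩
  · rw [add_div]
    linarith
  · have h1 : Tendsto (fun h => ‖(-1 : ℂ)‖ * (5 / ρ * (5 / ρ * (1 * (3 * ε h)))) +
        ‖h‖ * (5 / ρ * (5 / ρ * (5 / ρ * (1 * (3 * B) * (3 * B + 3 * ε h)))))) (𝓝[≠] 0)
        (𝓝 (‖(-1 : ℂ)‖ * (5 / ρ * (5 / ρ * (1 * (3 * 0)))) +
        0 * (5 / ρ * (5 / ρ * (5 / ρ * (1 * (3 * B) * (3 * B + 3 * 0))))))) :=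
      ((((((hε.const_mul 3).const_mul 1).const_mul _).const_mul _).const_mul _).add
        (tendsto_norm_nhdsNE.mul (((((hε.const_mul 3).const_add _).const_mul _).const_mul
          _).const_mul _ |>.const_mul _)))
    simpa using h1
  · filter_upwards [hq, he, hqe] with h hqh heh hqeh
    have ce := c1On_ext heh.1 (fun r hr => (heh.2 r hr).1) (fun r hr => (heh.2 r hr).2)
    have cR : C1On (Set.Ici 0) (‖(-1 : ℂ)‖ * (5 / ρ * (5 / ρ * (1 * (3 * ε h)))) +
      ‖h‖ * (5 / ρ * (5 / ρ * (5 / ρ * (1 * (3 * B) * (3 * B + 3 * ε h)))))) Z (R h) := by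
      have a1 := cb.mul ce
      have a2 := hqh.c1On_div hρ hρ1 a1 (by positivity) (mz bz)
      have a3 := h0.c1On_div hρ hρ1 a2 (by positivity) (dz (mz bz))
      have b1 := (cb.mul cq').mul (cq'.add ce)
      have b2 := hqh.c1On_div hρ hρ1 b1 (by positivity) (mz (mz bz))
      have b3 := h0.c1On_div hρ hρ1 b2 (by positivity) (dz (mz (mz bz)))
      have b4 := h0.c1On_div hρ hρ1 b3 (by positivity) (dz (dz (mz (mz bz))))
      exact ((a3.const_mul (-1)).mono le_rfl (by rw [hZ]; linarith) hZ0).add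
        ((b4.const_mul h).mono le_rfl (by rw [hZ]; linarith) hZ0)
    refine ⟨measurable_comp_max cR.continuousOn, cR.congr fun s hs => by
      rw [max_eq_left (Set.mem_Ici.1 hs)], fun s hs => ?_⟩
    simp only [freeResolvent, max_eq_left hs, hF', hR]
    rcases lt_or_ge s (3 / 4 * ρ) with hs' | hs'
    · have := bz s hs hs'
      simp only [hb] at this
      simp [this, hb]
    · have hW : ext (q h) s = ext q₀ s + h * (ext q' s + ext (e h) s) := by
        have h1 := ext_add_smul (q := fun r => q' r + e h r) hq' heh.1 1 (fun r _ => by simp) s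
        rw [ext_add_smul h0.contDiff (hq'.add heh.1) h (fun r hr => hqeh r hr) s]
        change _ + h * ext (fun r => q' r + e h r) s = _
        rw [h1, one_mul]
      have pos : 0 < ρ / 5 := by positivity
      have n0 : ext q₀ s ≠ 0 := norm_pos_iff.1 (pos.trans_le (h0.le_norm_ext hρ hρ1 hs'))
      have n1 : ext (q h) s ≠ 0 := norm_pos_iff.1 (pos.trans_le (hqh.le_norm_ext hρ hρ1 hs'))
      simp only [hb]
      field_simp
      rw [hW]
      ring

end

/-! ### Bounds on the kernels `v` -/

/-- The functions `F_l` in the definition of `v`, extended to all energies. -/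
def regFun (χ χbar : ℝ → ℝ) (ρ : ℝ) (q : ℝ → ℂ) {L : ℕ} (l : Fin L) : ℝ → ℂ :=
  if (l : ℕ) + 1 = L then cutoffFun χ ρ else freeResolvent χbar ρ q

section

variable {χ χbar : ℝ → ℝ} {ρ : ℝ} {w : Kernel} {L M N : ℕ}

/-- Up to null sets, the kernel `v` may be computed from good versions of the integral kernels and
of the resolvents. -/
lemma ae_vKernel_eq_chainKernel (hρ : 0 < ρ) (hρ1 : ρ ≤ 1) (hw : GoodFree ρ w.zero)
    (i : MultiIndex L M N) {f : ∀ l, (i.geom l).Ker} {F : Fin L → ℝ}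
    (hf : ∀ l, NiceKernel (F l) (f l))
    (h : ∀ l, ∀ᵐ K ∂(momentumMeasure (i.p l + i.m l) (i.q l + i.n l)),
      ∀ r ∈ Set.Icc (0 : ℝ) 1, w (i.p l + i.m l) (i.q l + i.n l) r K.1 K.2 = f l r K.1 K.2) :
    ∀ᵐ K ∂(momentumMeasure M N), ∀ r ∈ Set.Icc (0 : ℝ) 1,
      vKernel χ χbar ρ w i r K.1 K.2 =
        chainKernel χ ρ i.geom f (regFun χ χbar ρ w.zero) r K.1 K.2 := by
  have h1 := ae_eq_chainKernel (χ := χ) hρ hρ1 (g := i.geom) i.geom_valid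
    (f := fun l => cutKernel (w (i.p l + i.m l) (i.q l + i.n l))) (f' := f)
    (G := resolventFun χ χbar ρ w) (fun l => by
      filter_upwards [h l] with K hK r hr
      rw [← hK r hr]
      simp [cutKernel, hr]) (fun l s k k' hs hs0 => by
      have h1 : 1 < s := by by_contra h2; exact hs ⟨hs0, not_lt.1 h2⟩
      rw [(hf l).supp k k' s hs0 (lt_of_le_of_lt (sub_le_self _ (le_max_of_le_left
        (sumNorm_nonneg _))) h1)]
      simp [cutKernel, h1])
  rw [vKernel_eq_chainKernel χ χbar hρ w i]
  filter_upwards [h1] with K hK r hr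
  rw [hK r hr]
  simp only [chainKernel]
  rw [chain_congr_G hρ.le i.geom_valid hf (fun l l' hl K => i.geom_shift l l' hl K) ?_ hr.1]
  intro l s hs hsl
  unfold resolventFun regFun
  split_ifs with hl
  · simp [cutoffFun, max_eq_left hs]
  · have : s ≤ 1 := hsl.resolve_right hl
    rw [freeResolvent, max_eq_left hs, ext_of_mem hw.contDiff ⟨hs, this⟩]

lemma regFun_spec (hχ : IsCutoffPair χ χbar) (hρ : 0 < ρ) (hρ1 : ρ ≤ 1) {q : ℝ → ℂ}
    (hq : GoodFree ρ q) (l : Fin L) : Measurable (regFun χ χbar ρ q l) ∧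
      C1On (Set.Ici 0) (if (l : ℕ) + 1 = L then 1 else 5 / ρ)
        (if (l : ℕ) + 1 = L then cutoffSlope χ / ρ else (2 * cutoffSlope χ + 11 / 2) / ρ)
        (regFun χ χbar ρ q l) := by
  unfold regFun
  split_ifs
  · exact hχ.cutoffFun_spec hρ
  · exact hχ.freeResolvent_spec hρ hρ1 hq

lemma regFun_last (hχ : IsCutoffPair χ χbar) (hρ : 0 < ρ) (q : ℝ → ℂ) (l : Fin L)
    (hl : (l : ℕ) + 1 = L) (s : ℝ) (hs : ρ < s) : regFun χ χbar ρ q l s = 0 := by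
  rw [regFun, if_pos hl, cutoffFun, max_eq_left (hρ.trans hs).le,
    hχ.eq_zero _ ((one_lt_div hρ).2 hs), Complex.ofReal_zero]

/-- The numerical inequality that absorbs the derivatives of all the factors of `v`. -/
lemma derivative_count {c : ℝ} (hc : 0 ≤ c) (hρ : ρ ≤ 1 / 48) (L : ℕ) :
    1 + (c + ((L : ℝ) * (ρ + (2 * c + 11 / 2)) + (ρ + c))) ≤ 3 / 2 * (3 + 2 * c) * 2 ^ L := by
  have h1 : (L : ℝ) + 1 ≤ 2 ^ L := by
    have := Nat.lt_two_pow_self (n := L)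
    exact_mod_cast this
  have h2 : 2 * (L : ℝ) ≤ 2 ^ L := by
    rcases Nat.eq_zero_or_pos L with rfl | hL
    · simp
    · obtain ⟨k, rfl⟩ : ∃ k, L = k + 1 := ⟨L - 1, by omega⟩
      have := Nat.lt_two_pow_self (n := k)
      have : ((k : ℝ) + 1) ≤ 2 ^ k := by exact_mod_cast this
      rw [pow_succ]
      push_cast
      linarith
  have h0 : (0 : ℝ) ≤ L := Nat.cast_nonneg L
  nlinarith [mul_le_mul_of_nonneg_left h1 hc, mul_le_mul_of_nonneg_left hρ h0]

/-- The bound on `v`. Each of the `L` resolvents contributes a factor `5/ρ`, and the number of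
factors that the derivative can hit is absorbed by `2^L`. -/
lemma vKernel_bound (hχ : IsCutoffPair χ χbar) (hρ : 0 < ρ) (hρ1 : ρ ≤ 1 / 48)
    (hw : GoodFree ρ w.zero) (hm : ∀ m n, MemSharp (w m n)) (i : MultiIndex (L + 1) M N) :
    MemPre (vKernel χ χbar ρ w i) ∧ sharpNorm (vKernel χ χbar ρ w i) ≤
      ENNReal.ofReal (3 / 2 * cTheta χ * (10 / ρ) ^ L) *
        ∏ l, sharpNorm (w (i.p l + i.m l) (i.q l + i.n l)) := by
  have hρ1' : ρ ≤ 1 := by linarith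
  have hc := cutoffSlope_nonneg χ
  have hex := fun l => (hm (i.p l + i.m l) (i.q l + i.n l)).memPre.exists_niceKernel
    (by have := i.pos l; omega)
  choose f hf hae using hex
  have h1 := ae_vKernel_eq_chainKernel (χ := χ) (χbar := χbar) hρ hρ1' hw i (f := f)
    (F := fun l => (sharpNorm (w (i.p l + i.m l) (i.q l + i.n l))).toReal) hf hae
  have hZ : ∀ l : Fin (L + 1), 0 ≤ (if (l : ℕ) + 1 = L + 1 then cutoffSlope χ / ρ else
      (2 * cutoffSlope χ + 11 / 2) / ρ) := fun l => by split_ifs <;> positivity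
  have h2 := stateBound_chain hρ.le (g := i.geom) i.geom_valid hf (fun l => ENNReal.toReal_nonneg)
    (fun l => (regFun_spec hχ hρ hρ1' hw l).1) (fun l => (regFun_spec hχ hρ hρ1' hw l).2) hZ
  rw [Finset.prod_mul_distrib] at h2
  have e1 : ∏ l : Fin (L + 1), (if (l : ℕ) + 1 = L + 1 then (1 : ℝ) else 5 / ρ) =
      (5 / ρ) ^ L := by
    rw [Fin.prod_univ_castSucc]
    have : ∀ l : Fin L, ¬ ((l.castSucc : Fin (L + 1)) : ℕ) + 1 = L + 1 := fun l => by
      have := l.2; simp only [Fin.val_castSucc]; omega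
    simp only [this, if_false, Finset.prod_const, Finset.card_univ, Fintype.card_fin, Fin.val_last,
      if_true, mul_one]
  have e2 : ∑ l : Fin (L + 1), (ρ + ρ * (if (l : ℕ) + 1 = L + 1 then cutoffSlope χ / ρ else
      (2 * cutoffSlope χ + 11 / 2) / ρ)) =
      (L : ℝ) * (ρ + (2 * cutoffSlope χ + 11 / 2)) + (ρ + cutoffSlope χ) := by
    rw [Fin.sum_univ_castSucc]
    have : ∀ l : Fin L, ¬ ((l.castSucc : Fin (L + 1)) : ℕ) + 1 = L + 1 := fun l => by
      have := l.2; simp only [Fin.val_castSucc]; omega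
    simp only [this, if_false, Finset.sum_const, Finset.card_univ, Fintype.card_fin,
      nsmul_eq_mul, Fin.val_last, if_true]
    field_simp
  rw [e1, e2] at h2
  have h3 := h2.vacuumExpectation hχ.smooth.continuousOn hχ.c1On
  have hX := h2.nonneg
  have hY : 0 ≤ cutoffSlope χ + ((L : ℝ) * (ρ + (2 * cutoffSlope χ + 11 / 2)) +
      (ρ + cutoffSlope χ)) := by positivity
  have h4 : MemPre (chainKernel χ ρ i.geom f (regFun χ χbar ρ w.zero)) :=
    MemPre.of_c1On hX hY (fun r hr => (h3.1 r hr).aestronglyMeasurable)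
      (Eventually.of_forall fun K => h3.2 K) (Eventually.of_forall fun K r hr hK =>
        chainKernel_support hχ.eq_zero i f (fun l hl s hs => regFun_last hχ hρ _ l hl s hs) hρ
          (Nat.succ_pos L) r _ _ hK)
  refine ⟨h4.congr h1, ?_⟩
  rw [sharpNorm_congr h1]
  refine (sharpNorm_le_of_c1On hX hY (Eventually.of_forall fun K => h3.2 K)).trans ?_
  have e3 : ∏ l, sharpNorm (w (i.p l + i.m l) (i.q l + i.n l)) = ENNReal.ofReal
      (∏ l, (sharpNorm (w (i.p l + i.m l) (i.q l + i.n l))).toReal) := by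
    rw [← ENNReal.toReal_prod, ENNReal.ofReal_toReal]
    exact ENNReal.prod_ne_top fun l _ => (hm _ _).norm_lt_top.ne
  rw [e3, ← ENNReal.ofReal_mul (by rw [cTheta_eq]; positivity)]
  refine ENNReal.ofReal_le_ofReal ?_
  have h5 := derivative_count hc hρ1 L
  have h6 : 0 ≤ ∏ l, (sharpNorm (w (i.p l + i.m l) (i.q l + i.n l))).toReal :=
    Finset.prod_nonneg fun _ _ => ENNReal.toReal_nonneg
  calc (∏ l, (sharpNorm (w (i.p l + i.m l) (i.q l + i.n l))).toReal) * (5 / ρ) ^ L *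
        (1 + (cutoffSlope χ + ((L : ℝ) * (ρ + (2 * cutoffSlope χ + 11 / 2)) +
          (ρ + cutoffSlope χ))))
      ≤ (∏ l, (sharpNorm (w (i.p l + i.m l) (i.q l + i.n l))).toReal) * (5 / ρ) ^ L *
        (3 / 2 * (3 + 2 * cutoffSlope χ) * 2 ^ L) := by gcongr
    _ = _ := by
      rw [cTheta_eq, show (10 : ℝ) / ρ = 5 / ρ * 2 by ring, mul_pow]
      ring

lemma vKernel_eq_zero_of_number (hρ : 0 < ρ) (i : MultiIndex L M N)
    (h : ∑ l, i.q l ≠ ∑ l, i.p l) : vKernel χ χbar ρ w i = 0 := by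
  rw [vKernel_eq_chainKernel χ χbar hρ w i]
  funext r k k'
  rw [chainKernel, chain_of_number r (k, k') Fin.elim0 (by rw [zero_add]; exact h), mul_zero]
  rfl

/-- The kernels `v` of length one vanish unless there are no contractions. -/
lemma vKernel_one_eq_zero (hρ : 0 < ρ) (i : MultiIndex 1 M N) (h : 0 < i.p 0 + i.q 0) :
    vKernel χ χbar ρ w i = 0 := by
  rcases Nat.eq_zero_or_pos (i.q 0) with hq | hq
  · exact vKernel_eq_zero_of_number hρ i (by simp; omega)
  · rw [vKernel_eq_chainKernel χ χbar hρ w i]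
    funext r k k'
    rw [chainKernel, chain_one_of_pos r (k, k') Fin.elim0 hq, mul_zero]
    rfl

/-- Even kernels lead to even kernels, by conservation of the parity of the particle number. -/
lemma vKernel_odd (hχ : IsCutoffPair χ χbar) (hρ : 0 < ρ) (hρ1 : ρ ≤ 1 / 48)
    (hw : GoodFree ρ w.zero) (hm : ∀ m n, MemSharp (w m n))
    (hodd : ∀ m n, Odd (m + n) → sharpNorm (w m n) = 0) (h : Odd (M + N))
    (i : MultiIndex (L + 1) M N) : sharpNorm (vKernel χ χbar ρ w i) = 0 := by
  by_cases hq : ∑ l, i.q l = ∑ l, i.p l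
  · obtain ⟨l, hl⟩ : ∃ l, Odd (i.p l + i.m l + (i.q l + i.n l)) := by
      by_contra! hcon
      have h1 : Even (∑ l, (i.p l + i.m l + (i.q l + i.n l))) :=
        Finset.even_sum _ fun l _ => Nat.not_odd_iff_even.1 (hcon l)
      simp only [Finset.sum_add_distrib, i.sum_m, i.sum_n, hq] at h1
      rw [Nat.odd_iff] at h
      rw [Nat.even_iff] at h1
      omega
    have h2 := (vKernel_bound hχ hρ hρ1 hw hm i).2
    rw [Finset.prod_eq_zero (Finset.mem_univ l) (hodd _ _ hl), mul_zero] at h2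
    exact le_antisymm h2 zero_le
  · rw [vKernel_eq_zero_of_number hρ i hq, sharpNorm_zero]

end

/-! ### Summation over the multi-indices -/

/-- The power of a sum is the sum over all functions into the index set. -/
lemma tsum_pi_prod {α : Type*} (g : α → ENNReal) (L : ℕ) :
    ∑' c : Fin L → α, ∏ l, g (c l) = (∑' a, g a) ^ L := by
  induction L with
  | zero =>
    rw [tsum_eq_single default fun b hb => absurd (Subsingleton.elim b default) hb]
    simp
  | succ L ih =>
    rw [← (Fin.consEquiv fun _ => α).tsum_eq, ENNReal.tsum_prod', pow_succ', ← ih,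
      ← ENNReal.tsum_mul_right]
    refine tsum_congr fun a => ?_
    rw [← ENNReal.tsum_mul_left]
    refine tsum_congr fun c => ?_
    rw [Fin.prod_univ_succ]
    simp [Fin.consEquiv]

/-- The binomial theorem, summed against a sequence. -/
lemma tsum_choose_mul (t : ENNReal) (f : ℕ → ENNReal) :
    ∑' mp : ℕ × ℕ, ((mp.1 + mp.2).choose mp.2 : ENNReal) * t ^ mp.1 * f (mp.2 + mp.1) =
      ∑' a, (1 + t) ^ a * f a := by
  rw [← Finset.HasAntidiagonal.sigmaAntidiagonalEquivProd.tsum_eq, ENNReal.tsum_sigma']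
  refine tsum_congr fun a => ?_
  rw [tsum_fintype, add_comm 1 t, (Commute.all t 1).add_pow', Finset.sum_mul,
    ← Finset.sum_coe_sort (Finset.HasAntidiagonal.antidiagonal a)]
  refine Finset.sum_congr rfl fun x _ => ?_
  have h := Finset.HasAntidiagonal.mem_antidiagonal.1 x.2
  simp only [Finset.HasAntidiagonal.sigmaAntidiagonalEquivProd_apply]
  rw [add_comm x.1.2, h, one_pow, mul_one, nsmul_eq_mul, ← Nat.choose_symm_of_eq_add h.symm]

/-- The four exponents of the multi-index, slot by slot. -/
def MultiIndex.slots {L M N : ℕ} (i : MultiIndex L M N) (l : Fin L) : (ℕ × ℕ) × (ℕ × ℕ) :=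
  ((i.m l, i.p l), (i.n l, i.q l))

lemma MultiIndex.slots_injective (L : ℕ) : Function.Injective
    fun s : Σ MN : ℕ × ℕ, MultiIndex L MN.1 MN.2 => s.2.slots := by
  rintro ⟨⟨M, N⟩, ⟨m, p, n, q, hm, hn, hp⟩⟩ ⟨⟨M', N'⟩, ⟨m', p', n', q', hm', hn', hp'⟩⟩ h
  have h' := fun l => congrFun h l
  simp only [MultiIndex.slots, Prod.mk.injEq] at h'
  obtain rfl : m = m' := funext fun l => (h' l).1.1
  obtain rfl : p = p' := funext fun l => (h' l).1.2
  obtain rfl : n = n' := funext fun l => (h' l).2.1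
  obtain rfl : q = q' := funext fun l => (h' l).2.2
  obtain rfl : M = M' := hm.symm.trans hm'
  obtain rfl : N = N' := hn.symm.trans hn'
  rfl

instance (L M N : ℕ) : Countable (MultiIndex L M N) :=
  Function.Injective.countable (f := fun i : MultiIndex L M N => i.slots) fun i j h =>
    eq_of_heq (Sigma.mk.inj (MultiIndex.slots_injective L (a₁ := ⟨(M, N), i⟩) (a₂ := ⟨(M, N), j⟩)
      h)).2

/-- The sum over all multi-indices of length `L` is dominated by the `L`-th power of a sum over a
single slot. -/
lemma tsum_multiIndex_le (A : ℕ → ℕ → ENNReal) (t : ENNReal) (L : ℕ) :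
    ∑' MN : ℕ × ℕ, t ^ (MN.1 + MN.2) * ∑' i : MultiIndex L MN.1 MN.2,
        (i.coeff : ENNReal) * ∏ l, A (i.p l + i.m l) (i.q l + i.n l) ≤
      (∑' ab : ℕ × ℕ, (1 + t) ^ (ab.1 + ab.2) * A ab.1 ab.2) ^ L := by
  set g : (ℕ × ℕ) × (ℕ × ℕ) → ENNReal := fun c =>
    (((c.1.1 + c.1.2).choose c.1.2 : ENNReal) * t ^ c.1.1) *
      ((((c.2.1 + c.2.2).choose c.2.2 : ENNReal) * t ^ c.2.1) *
        A (c.1.2 + c.1.1) (c.2.2 + c.2.1)) with hg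
  have h1 : ∑' c, g c = ∑' ab : ℕ × ℕ, (1 + t) ^ (ab.1 + ab.2) * A ab.1 ab.2 := by
    rw [ENNReal.tsum_prod' (f := g), ENNReal.tsum_prod'
      (f := fun ab : ℕ × ℕ => (1 + t) ^ (ab.1 + ab.2) * A ab.1 ab.2)]
    simp only [hg, ENNReal.tsum_mul_left]
    rw [tsum_choose_mul t fun a => ∑' c : ℕ × ℕ, ((c.1 + c.2).choose c.2 : ENNReal) * t ^ c.1 *
      A a (c.2 + c.1)]
    refine tsum_congr fun a => ?_
    rw [tsum_choose_mul t fun b => A a b, ← ENNReal.tsum_mul_left]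
    refine tsum_congr fun b => ?_
    rw [pow_add]
    ring
  rw [← h1, ← tsum_pi_prod]
  simp_rw [← ENNReal.tsum_mul_left]
  rw [← ENNReal.tsum_sigma' fun s : Σ MN : ℕ × ℕ, MultiIndex L MN.1 MN.2 =>
    t ^ (s.1.1 + s.1.2) * ((s.2.coeff : ENNReal) *
      ∏ l, A (s.2.p l + s.2.m l) (s.2.q l + s.2.n l))]
  refine le_trans (le_of_eq (tsum_congr ?_))
    (ENNReal.tsum_comp_le_tsum_of_injective (MultiIndex.slots_injective L) fun c => ∏ l, g (c l))
  rintro ⟨⟨M, N⟩, i⟩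
  simp only [hg, MultiIndex.slots, MultiIndex.coeff, Finset.prod_mul_distrib, Nat.cast_prod,
    Nat.cast_mul, Finset.prod_pow_eq_pow_sum, i.sum_m, i.sum_n, pow_add]
  ring

/-! ### The contraction estimate -/

/-- The conditions on the scaling parameters, and a bound `γ` on the interacting part. -/
structure ScaleCond (χ : ℝ → ℝ) (ρ ξ γ : ℝ) : Prop where
  ρ_pos : 0 < ρ
  ρ_le : ρ ≤ 1 / (16 * cTheta χ)
  ξ_pos : 0 < ξ
  ξ_le : ξ ≤ (ρ / (2 * cTheta χ)) ^ ((1 : ℝ) / 4)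
  γ_nonneg : 0 ≤ γ
  γ_le : γ ≤ ρ / 32

lemma three_le_cTheta (χ : ℝ → ℝ) : 3 ≤ cTheta χ := by
  have := cutoffSlope_nonneg χ
  rw [cTheta_eq]; linarith

namespace ScaleCond

variable {χ : ℝ → ℝ} {ρ ξ γ : ℝ}

lemma mul_cTheta_le (h : ScaleCond χ ρ ξ γ) : ρ * cTheta χ ≤ 1 / 16 := by
  have hC := three_le_cTheta χ
  have := h.ρ_le
  rw [le_div_iff₀ (by positivity)] at this
  linarith

-- `C_θ ≥ 3`, whence `ρ ≤ 1/48`.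
lemma ρ_le' (h : ScaleCond χ ρ ξ γ) : ρ ≤ 1 / 48 := by
  have hC := three_le_cTheta χ
  nlinarith [h.mul_cTheta_le, h.ρ_pos]

/-- Since `ξ⁴ ≤ ρ/(2 C_θ)` and `ρ` is small compared to this bound on `ξ`, also `(ρ + ξ)⁴` is at
most of the order of `ρ`. -/
lemma pow_four_le (h : ScaleCond χ ρ ξ γ) : (ρ + ξ) ^ 4 * cTheta χ ≤ 71 / 100 * ρ := by
  have hC := three_le_cTheta χ
  have hρ := h.ρ_pos
  set a : ℝ := (ρ / (2 * cTheta χ)) ^ ((1 : ℝ) / 4) with ha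
  have ha0 : 0 < a := by positivity
  have ha4 : a ^ 4 = ρ / (2 * cTheta χ) := by
    rw [ha, ← Real.rpow_natCast, ← Real.rpow_mul (by positivity)]
    norm_num
  -- `ρ³ C_θ` is tiny, so that `(11 ρ)⁴ ≤ ρ / (2 C_θ)`; then `(12/11)⁴ / 2 < 71/100`
  have h1 : 11 * ρ ≤ a := by
    refine le_of_pow_le_pow_left₀ (n := 4) (by norm_num) ha0.le ?_
    rw [ha4, le_div_iff₀ (by positivity)]
    have h2 := h.mul_cTheta_le
    have h3 := h.ρ_le'
    have h4 : ρ ^ 2 * (ρ * cTheta χ) ≤ (1 / 48) ^ 2 * (1 / 16) := by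
      gcongr
    nlinarith
  have h2 : (ρ + ξ) ^ 4 ≤ (12 / 11 * a) ^ 4 := by
    have h3 := h.ξ_pos
    gcongr
    linarith [h.ξ_le]
  rw [mul_pow, ha4] at h2
  calc (ρ + ξ) ^ 4 * cTheta χ ≤ (12 / 11) ^ 4 * (ρ / (2 * cTheta χ)) * cTheta χ := by gcongr
    _ = (12 / 11) ^ 4 / 2 * ρ := by field_simp
    _ ≤ 71 / 100 * ρ := mul_le_mul_of_nonneg_right (by norm_num) hρ.le

lemma sq_le (h : ScaleCond χ ρ ξ γ) : (ρ + ξ) ^ 2 ≤ 1 / 10 := by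
  have hC := three_le_cTheta χ
  have hρ := h.ρ_pos
  have h0 := h.ξ_pos
  have h1 := h.pow_four_le
  have h2 := h.ρ_le'
  refine le_of_pow_le_pow_left₀ (n := 2) (by norm_num) (by norm_num) ?_
  have h3 : (ρ + ξ) ^ 4 * 3 ≤ (ρ + ξ) ^ 4 * cTheta χ := by gcongr
  nlinarith

lemma add_le_one (h : ScaleCond χ ρ ξ γ) : ρ + ξ ≤ 1 := by
  have h0 := h.ρ_pos
  have h1 := h.ξ_pos
  have := h.sq_le
  nlinarith

/-- The terms of length one and the geometric series of the longer terms together stay below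
`ρ γ/2`. -/
lemma budget (h : ScaleCond χ ρ ξ γ) :
    3 / 2 * cTheta χ * (ρ ^ 2 * γ) + 3 / 2 * cTheta χ * ((ρ + ξ) ^ 2 * γ) *
      (10 / ρ * ((ρ + ξ) ^ 2 * γ)) * (32 / 31) ≤ ρ * (γ / 2) := by
  have hρ := h.ρ_pos
  have hγ := h.γ_nonneg
  have hC := three_le_cTheta χ
  have h1 : 3 / 2 * cTheta χ * (ρ ^ 2 * γ) ≤ 3 / 32 * (ρ * γ) := by
    have := mul_le_mul_of_nonneg_right h.mul_cTheta_le (by positivity : 0 ≤ 3 / 2 * (ρ * γ))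
    nlinarith
  have h2 : 3 / 2 * cTheta χ * ((ρ + ξ) ^ 2 * γ) * (10 / ρ * ((ρ + ξ) ^ 2 * γ)) * (32 / 31) =
      480 / 31 * (γ / ρ * γ) * ((ρ + ξ) ^ 4 * cTheta χ) := by
    field_simp
    ring
  rw [h2]
  have h3 : 480 / 31 * (γ / ρ * γ) * ((ρ + ξ) ^ 4 * cTheta χ) ≤
      480 / 31 * (γ / ρ * γ) * (71 / 100 * ρ) :=
    mul_le_mul_of_nonneg_left h.pow_four_le (by positivity)
  have h4 : 480 / 31 * (γ / ρ * γ) * (71 / 100 * ρ) = 480 / 31 * (71 / 100) * (γ * γ) := by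
    field_simp
  have h5 := mul_le_mul_of_nonneg_right h.γ_le hγ
  nlinarith [mul_nonneg hρ.le hγ]

end ScaleCond

/-- The conditions on a kernel used in the contraction estimate. -/
structure GoodKernel (ρ ξ γ : ℝ) (w : Kernel) : Prop where
  mem : ∀ m n, MemSharp (w m n)
  free : GoodFree ρ w.zero
  norm_le : xiNorm ξ (geOne w) ≤ ENNReal.ofReal γ
  odd : ∀ m n, Odd (m + n) → sharpNorm (w m n) = 0

lemma sharpNorm_geOne_eq_zero {ρ ξ γ : ℝ} {w : Kernel} (hw : GoodKernel ρ ξ γ w) {a b : ℕ}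
    (h : ¬ 2 ≤ a + b) : sharpNorm (geOne w a b) = 0 := by
  by_cases h1 : 1 ≤ a + b
  · have h2 : geOne w a b = w a b := by simp [geOne, h1]
    rw [h2, hw.odd a b (by rw [show a + b = 1 by omega]; exact odd_one)]
  · have h2 : geOne w a b = 0 := by simp only [geOne, h1, if_false]
    rw [h2, sharpNorm_zero]

/-- For even kernels, rescaling the momenta by `x ≤ 1` gains at least a factor `x²`. -/
lemma tsum_rescaled_le {ρ ξ γ : ℝ} {w : Kernel} (hw : GoodKernel ρ ξ γ w) {x : ℝ}
    (hx : 0 ≤ x) (hx1 : x ≤ 1) :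
    ∑' ab : ℕ × ℕ, ENNReal.ofReal (x * ξ⁻¹) ^ (ab.1 + ab.2) * sharpNorm (geOne w ab.1 ab.2) ≤
      ENNReal.ofReal (x ^ 2 * γ) := by
  have h1 : ∑' ab : ℕ × ℕ, ENNReal.ofReal (x * ξ⁻¹) ^ (ab.1 + ab.2) *
      sharpNorm (geOne w ab.1 ab.2) ≤ ENNReal.ofReal (x ^ 2) * xiNorm ξ (geOne w) := by
    rw [xiNorm, ← ENNReal.tsum_mul_left]
    refine ENNReal.tsum_le_tsum fun ab => ?_
    by_cases h2 : 2 ≤ ab.1 + ab.2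
    · rw [ENNReal.ofReal_mul hx, mul_pow, mul_assoc, ENNReal.ofReal_pow hx]
      gcongr ?_ * _
      exact pow_le_pow_right_of_le_one' (ENNReal.ofReal_le_one.2 hx1) h2
    · rw [sharpNorm_geOne_eq_zero hw h2, mul_zero]
      exact zero_le
  refine h1.trans ?_
  rw [ENNReal.ofReal_mul (by positivity)]
  gcongr
  exact hw.norm_le

section

variable {χ χbar : ℝ → ℝ} {ρ ξ γ : ℝ} {w : Kernel}

/-- The sum of the norms of all terms in the series that define `ŵ_{M,N}`, up to powers of `ρ`. -/
def orderSum (χ χbar : ℝ → ℝ) (ρ : ℝ) (w : Kernel) (M N : ℕ) : ENNReal :=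
  ∑' L : ℕ, ∑' i : MultiIndex (L + 1) M N,
    (i.coeff : ENNReal) * sharpNorm (vKernel χ χbar ρ w i)

lemma orderSum_odd (hχ : IsCutoffPair χ χbar) (hs : ScaleCond χ ρ ξ γ)
    (hw : GoodKernel ρ ξ γ w) {M N : ℕ} (h : Odd (M + N)) : orderSum χ χbar ρ w M N = 0 := by
  simp only [orderSum, vKernel_odd hχ hs.ρ_pos hs.ρ_le' hw.free hw.mem hw.odd h, mul_zero,
    tsum_zero]

lemma prod_sharpNorm_eq {L M N : ℕ} (i : MultiIndex L M N) (w : Kernel) :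
    ∏ l, sharpNorm (w (i.p l + i.m l) (i.q l + i.n l)) =
      ∏ l, sharpNorm (geOne w (i.p l + i.m l) (i.q l + i.n l)) := by
  refine Finset.prod_congr rfl fun l _ => ?_
  have h : 1 ≤ i.p l + i.m l + (i.q l + i.n l) := by have := i.pos l; omega
  have h2 : geOne w (i.p l + i.m l) (i.q l + i.n l) = w (i.p l + i.m l) (i.q l + i.n l) := by
    simp only [geOne, h, if_true]
  rw [h2]

/-- The terms of length one. Only the term without contractions is present. -/
lemma tsum_order_one_le (hχ : IsCutoffPair χ χbar) (hs : ScaleCond χ ρ ξ γ)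
    (hw : GoodKernel ρ ξ γ w) (M N : ℕ) :
    ∑' i : MultiIndex 1 M N, (i.coeff : ENNReal) * sharpNorm (vKernel χ χbar ρ w i) ≤
      ENNReal.ofReal (3 / 2 * cTheta χ) * sharpNorm (geOne w M N) := by
  by_cases h0 : 1 ≤ M + N
  · set i₀ : MultiIndex 1 M N := ⟨fun _ => M, fun _ => 0, fun _ => N, fun _ => 0, by simp,
      by simp, fun _ => by omega⟩ with hi₀
    rw [tsum_eq_single i₀]
    · have h1 := (vKernel_bound (L := 0) hχ hs.ρ_pos hs.ρ_le' hw.free hw.mem i₀).2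
      rw [prod_sharpNorm_eq, pow_zero, mul_one] at h1
      have h2 : i₀.coeff = 1 := by simp [MultiIndex.coeff, hi₀]
      rw [h2, Nat.cast_one, one_mul]
      refine h1.trans (le_of_eq ?_)
      congr 1
      set A : ℕ → ℕ → ENNReal := fun a b => sharpNorm (geOne w a b) with hA
      change ∏ l : Fin 1, A (0 + M) (0 + N) = A M N
      simp
    · intro i hi
      rw [vKernel_one_eq_zero hs.ρ_pos i, sharpNorm_zero, mul_zero]
      by_contra h
      refine hi ?_
      obtain ⟨m, p, n, q, hm, hn, hpos⟩ := i
      have hm' : m 0 = M := by rw [← hm, Fin.sum_univ_one]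
      have hn' : n 0 = N := by rw [← hn, Fin.sum_univ_one]
      simp only [not_lt, nonpos_iff_eq_zero, Nat.add_eq_zero_iff] at h
      rw [hi₀]
      congr 1 <;> funext l <;> rw [Fin.eq_zero l] <;> [exact hm'; exact h.1; exact hn'; exact h.2]
  · refine le_trans (le_of_eq (ENNReal.tsum_eq_zero.2 fun i => ?_)) zero_le
    rw [vKernel_one_eq_zero hs.ρ_pos i, sharpNorm_zero, mul_zero]
    have h1 := i.pos 0
    have h2 := i.sum_m
    have h3 := i.sum_n
    rw [Fin.sum_univ_one] at h2 h3
    have h4 : i.m 0 + i.p 0 + i.n 0 + i.q 0 = i.m 0 + i.n 0 + (i.p 0 + i.q 0) := by ring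
    have h5 : i.m 0 + i.n 0 = 0 := by
      rw [show i.m 0 = M from h2, show i.n 0 = N from h3]; omega
    omega

/-- The terms of length `L + 1`: by the binomial theorem the outer and inner momenta of a slot,
weighted by `ρ` and `ξ`, combine to the weight `ρ + ξ`. -/
lemma tsum_order_le (hχ : IsCutoffPair χ χbar) (hs : ScaleCond χ ρ ξ γ)
    (hw : GoodKernel ρ ξ γ w) (L : ℕ) :
    ∑' MN : ℕ × ℕ, ENNReal.ofReal (ρ * ξ⁻¹) ^ (MN.1 + MN.2) *
        ∑' i : MultiIndex (L + 1) MN.1 MN.2,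
          (i.coeff : ENNReal) * sharpNorm (vKernel χ χbar ρ w i) ≤
      ENNReal.ofReal (3 / 2 * cTheta χ * (10 / ρ) ^ L * ((ρ + ξ) ^ 2 * γ) ^ (L + 1)) := by
  have hρ := hs.ρ_pos
  have hξ := hs.ξ_pos
  have hγ := hs.γ_nonneg
  have hC := three_le_cTheta χ
  have h1 := tsum_multiIndex_le (fun a b => sharpNorm (geOne w a b)) (ENNReal.ofReal (ρ * ξ⁻¹))
    (L + 1)
  have h2 : 1 + ENNReal.ofReal (ρ * ξ⁻¹) = ENNReal.ofReal ((ρ + ξ) * ξ⁻¹) := by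
    rw [← ENNReal.ofReal_one, ← ENNReal.ofReal_add zero_le_one (by positivity)]
    congr 1
    field_simp
    ring
  have h3 := tsum_rescaled_le hw (x := ρ + ξ) (by positivity) hs.add_le_one
  simp only [h2] at h1
  have e : ENNReal.ofReal (3 / 2 * cTheta χ * (10 / ρ) ^ L * ((ρ + ξ) ^ 2 * γ) ^ (L + 1)) =
      ENNReal.ofReal (3 / 2 * cTheta χ * (10 / ρ) ^ L) *
        ENNReal.ofReal ((ρ + ξ) ^ 2 * γ) ^ (L + 1) := by
    rw [ENNReal.ofReal_mul (by positivity), ENNReal.ofReal_pow (by positivity)]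
  rw [e]
  refine le_trans ?_ (mul_le_mul' le_rfl (h1.trans (pow_le_pow_left₀ zero_le h3 (L + 1))))
  rw [← ENNReal.tsum_mul_left]
  refine ENNReal.tsum_le_tsum fun MN => ?_
  rw [mul_left_comm]
  refine mul_le_mul' le_rfl ?_
  rw [← ENNReal.tsum_mul_left]
  refine ENNReal.tsum_le_tsum fun i => ?_
  rw [mul_left_comm]
  refine mul_le_mul' le_rfl ?_
  rw [← prod_sharpNorm_eq]
  exact (vKernel_bound hχ hρ hs.ρ_le' hw.free hw.mem i).2

/-- The weighted sum of the norms of all terms of the renormalized kernels is at most `ρ γ/2`. -/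
lemma tsum_orderSum_le (hχ : IsCutoffPair χ χbar) (hs : ScaleCond χ ρ ξ γ)
    (hw : GoodKernel ρ ξ γ w) :
    ∑' MN : ℕ × ℕ, ENNReal.ofReal (ρ * ξ⁻¹) ^ (MN.1 + MN.2) * orderSum χ χbar ρ w MN.1 MN.2 ≤
      ENNReal.ofReal (ρ * (γ / 2)) := by
  have hρ := hs.ρ_pos
  have hξ := hs.ξ_pos
  have hγ := hs.γ_nonneg
  have hC := three_le_cTheta χ
  set q : ℝ := (ρ + ξ) ^ 2 * γ with hq
  have hq0 : 0 ≤ q := by positivity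
  have hx0 : 0 ≤ 10 / ρ * q := by positivity
  have hx : 10 / ρ * q ≤ 1 / 32 := by
    have h1 := mul_le_mul hs.sq_le hs.γ_le hγ (by norm_num)
    rw [div_mul_eq_mul_div, div_le_iff₀ hρ, hq]
    linarith
  simp only [orderSum, ← ENNReal.tsum_mul_left]
  rw [ENNReal.tsum_comm]
  simp only [ENNReal.tsum_mul_left]
  rw [tsum_eq_zero_add' ENNReal.summable]
  have h0 : ∑' MN : ℕ × ℕ, ENNReal.ofReal (ρ * ξ⁻¹) ^ (MN.1 + MN.2) *
        ∑' i : MultiIndex (0 + 1) MN.1 MN.2,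
          (i.coeff : ENNReal) * sharpNorm (vKernel χ χbar ρ w i) ≤
      ENNReal.ofReal (3 / 2 * cTheta χ * (ρ ^ 2 * γ)) := by
    have e : ENNReal.ofReal (3 / 2 * cTheta χ * (ρ ^ 2 * γ)) =
        ENNReal.ofReal (3 / 2 * cTheta χ) * ENNReal.ofReal (ρ ^ 2 * γ) :=
      ENNReal.ofReal_mul (by positivity)
    rw [e]
    refine le_trans ?_ (mul_le_mul' le_rfl
      (tsum_rescaled_le hw hρ.le (by linarith [hs.ρ_le'])))
    rw [← ENNReal.tsum_mul_left]
    refine ENNReal.tsum_le_tsum fun MN => ?_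
    rw [mul_left_comm]
    refine mul_le_mul' le_rfl ?_
    exact tsum_order_one_le hχ hs hw _ _
  have h1 : ∑' L : ℕ, ENNReal.ofReal (3 / 2 * cTheta χ * (10 / ρ) ^ (L + 1) * q ^ (L + 1 + 1)) ≤
      ENNReal.ofReal (3 / 2 * cTheta χ * q * (10 / ρ * q) * (32 / 31)) := by
    have e : ∀ L : ℕ, 3 / 2 * cTheta χ * (10 / ρ) ^ (L + 1) * q ^ (L + 1 + 1) =
        3 / 2 * cTheta χ * q * (10 / ρ * q) * (10 / ρ * q) ^ L := fun L => by
      clear_value q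
      rw [mul_pow]
      ring
    simp only [e]
    have hs1 := summable_geometric_of_lt_one hx0 (by linarith : 10 / ρ * q < 1)
    rw [← ENNReal.ofReal_tsum_of_nonneg (fun L => by positivity) (hs1.mul_left _),
      tsum_mul_left, tsum_geometric_of_lt_one hx0 (by linarith)]
    refine ENNReal.ofReal_le_ofReal (mul_le_mul_of_nonneg_left ?_ (by positivity))
    rw [inv_le_comm₀ (by linarith) (by norm_num)]
    linarith
  refine (add_le_add h0 ((ENNReal.tsum_le_tsum fun L =>
    tsum_order_le hχ hs hw (L + 1)).trans h1)).trans ?_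
  rw [← ENNReal.ofReal_add (by positivity) (by positivity)]
  exact ENNReal.ofReal_le_ofReal hs.budget

end

/-! ### The renormalized kernels as absolutely convergent series -/

section

variable {χ χbar : ℝ → ℝ} {ρ ξ γ : ℝ} {w : Kernel} {M N : ℕ}

/-- The rescaled free part `ρ⁻¹ w_{0,0}(ρ r)`, as a contribution to `ŵ_{M,N}`. -/
def rescaledFree (ρ : ℝ) (w : Kernel) (M N : ℕ) : KerFun M N := fun r _ _ =>
  if M + N = 0 then (ρ : ℂ)⁻¹ * w.zero (ρ * r) else 0

/-- The terms of the series for `ŵ_{M,N}`, indexed by the multi-indices of positive length. -/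
def hatTerm (χ χbar : ℝ → ℝ) (ρ : ℝ) (w : Kernel) (M N : ℕ)
    (j : Σ L : ℕ, MultiIndex (L + 1) M N) : KerFun M N :=
  ((-1) ^ j.1 * ((ρ : ℂ) ^ (M + N) * (ρ : ℂ)⁻¹) * (j.2.coeff : ℂ)) • vKernel χ χbar ρ w j.2

lemma C1On.comp_mul {X Y : ℝ} {g : ℝ → ℂ} (h : C1On (Set.Icc 0 1) X Y g) (hρ : 0 ≤ ρ)
    (hρ1 : ρ ≤ 1) : C1On (Set.Icc 0 1) X (ρ * Y) (fun r => g (ρ * r)) := by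
  obtain ⟨g', d, c, b⟩ := h
  have hm : Set.MapsTo (fun r : ℝ => ρ * r) (Set.Icc 0 1) (Set.Icc 0 1) := fun r hr =>
    ⟨mul_nonneg hρ hr.1, mul_le_one₀ hρ1 hr.1 hr.2⟩
  refine ⟨fun r => ρ * g' (ρ * r), fun r hr => ?_, ?_, fun r hr => ?_⟩
  · have h1 : HasDerivWithinAt (fun r : ℝ => ρ * r) ρ (Set.Icc 0 1) r := by
      simpa using ((hasDerivAt_id r).const_mul ρ).hasDerivWithinAt
    have := (d _ (hm hr)).scomp r h1 hm
    simpa [Function.comp_def] using this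
  · exact continuousOn_const.mul (c.comp (by fun_prop) hm)
  · obtain ⟨b1, b2⟩ := b _ (hm hr)
    refine ⟨b1, ?_⟩
    rw [norm_mul, Complex.norm_real, Real.norm_of_nonneg hρ]
    nlinarith [mul_le_mul_of_nonneg_left b2 hρ]

lemma rescaledFree_eq_zero {ρ : ℝ} (w : Kernel) {M N : ℕ} (h : M + N ≠ 0) :
    rescaledFree ρ w M N = 0 := by
  funext r k k'
  exact if_neg h

lemma rescaledFree_spec (hρ : 0 < ρ) (hρ1 : ρ ≤ 1) (hw : MemPre (w 0 0)) (M N : ℕ) :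
    MemPre (rescaledFree ρ w M N) ∧
      sharpNorm (rescaledFree ρ w M N) ≤ ENNReal.ofReal (2 / ρ) * sharpNorm (w 0 0) := by
  by_cases h0 : M + N = 0
  · obtain ⟨rfl, rfl⟩ : M = 0 ∧ N = 0 := by omega
    have h1 := of_ae_zero_zero hw.ae_c1On (Fin.elim0, Fin.elim0)
    have h2 := (h1.comp_mul hρ.le hρ1).const_mul (ρ : ℂ)⁻¹
    rw [norm_inv, Complex.norm_real, Real.norm_of_nonneg hρ.le, mul_one] at h2
    have hX : 0 ≤ ρ⁻¹ * (sharpNorm (w 0 0)).toReal := by positivity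
    have h3 : ∀ K : (Fin 0 → E3) × (Fin 0 → E3), C1On (Set.Icc 0 1)
        (ρ⁻¹ * (sharpNorm (w 0 0)).toReal) ρ (fun r => rescaledFree ρ w 0 0 r K.1 K.2) :=
      fun K => h2.congr fun r _ => by simp [rescaledFree, Kernel.zero]
    refine ⟨MemPre.of_c1On hX hρ.le (fun r _ => ?_) (Eventually.of_forall h3)
      (Eventually.of_forall fun K r hr hK => ?_), ?_⟩
    · simp only [rescaledFree]
      exact aestronglyMeasurable_const
    · simp only [sumNorm, Finset.univ_eq_empty, Finset.sum_empty, max_self, sub_zero] at hK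
      exact absurd hK (not_lt.2 hr.2)
    · refine (sharpNorm_le_of_c1On hX hρ.le (Eventually.of_forall h3)).trans ?_
      conv_rhs => rw [← ENNReal.ofReal_toReal hw.norm_lt_top.ne]
      rw [← ENNReal.ofReal_mul (by positivity)]
      refine ENNReal.ofReal_le_ofReal ?_
      have h4 : 2 / ρ * (sharpNorm (w 0 0)).toReal = ρ⁻¹ * (sharpNorm (w 0 0)).toReal * 2 := by ring
      rw [h4]
      exact mul_le_mul_of_nonneg_left (by linarith) hX
  · rw [rescaledFree_eq_zero w h0, sharpNorm_zero]
    exact ⟨memPre_zero, zero_le⟩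

lemma rescaledFree_sub_smul (ρ : ℝ) (w₁ w₂ w₃ : Kernel) (c : ℂ) (M N : ℕ) :
    c • (rescaledFree ρ w₁ M N - rescaledFree ρ w₂ M N) - rescaledFree ρ w₃ M N =
      rescaledFree ρ (c • (w₁ - w₂) - w₃) M N := by
  funext r k k'
  simp only [rescaledFree, Pi.sub_apply, Pi.smul_apply, Kernel.zero, smul_eq_mul]
  split_ifs
  · ring
  · simp

lemma hatTerm_spec (hχ : IsCutoffPair χ χbar) (hs : ScaleCond χ ρ ξ γ) (hw : GoodKernel ρ ξ γ w)
    (j : Σ L : ℕ, MultiIndex (L + 1) M N) : MemPre (hatTerm χ χbar ρ w M N j) :=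
  (vKernel_bound hχ hs.ρ_pos hs.ρ_le' hw.free hw.mem j.2).1.smul _

lemma tsum_hatTerm_le (hρ : 0 < ρ) (w : Kernel) (M N : ℕ) :
    ∑' j, sharpNorm (hatTerm χ χbar ρ w M N j) ≤
      ENNReal.ofReal ρ ^ (M + N) * ENNReal.ofReal ρ⁻¹ * orderSum χ χbar ρ w M N := by
  rw [orderSum, ENNReal.tsum_sigma', ← ENNReal.tsum_mul_left]
  refine ENNReal.tsum_le_tsum fun L => ?_
  rw [← ENNReal.tsum_mul_left]
  refine ENNReal.tsum_le_tsum fun i => ?_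
  refine (sharpNorm_smul_le _ _).trans (le_of_eq ?_)
  have h1 : ‖(ρ : ℂ)‖ₑ = ENNReal.ofReal ρ := by
    rw [← ofReal_norm, Complex.norm_real, Real.norm_of_nonneg hρ.le]
  have h2 : ‖(ρ : ℂ)⁻¹‖ₑ = ENNReal.ofReal ρ⁻¹ := by
    rw [← ofReal_norm, norm_inv, Complex.norm_real, Real.norm_of_nonneg hρ.le]
  have h3 : ‖((i.coeff : ℕ) : ℂ)‖ₑ = (i.coeff : ENNReal) := by
    rw [← ofReal_norm, Complex.norm_natCast, ENNReal.ofReal_natCast]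
  simp only [enorm_mul, enorm_pow, h1, h2, h3, enorm_neg, enorm_one, one_pow, one_mul]
  ring

/-- The weighted norms of all terms of all renormalized kernels sum up to at most `γ/2`. -/
lemma tsum_tsum_hatTerm_le (hχ : IsCutoffPair χ χbar) (hs : ScaleCond χ ρ ξ γ)
    (hw : GoodKernel ρ ξ γ w) :
    ∑' MN : ℕ × ℕ, ENNReal.ofReal ξ⁻¹ ^ (MN.1 + MN.2) *
      ∑' j, sharpNorm (hatTerm χ χbar ρ w MN.1 MN.2 j) ≤ ENNReal.ofReal (γ / 2) := by
  have hρ := hs.ρ_pos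
  calc ∑' MN : ℕ × ℕ, ENNReal.ofReal ξ⁻¹ ^ (MN.1 + MN.2) *
        ∑' j, sharpNorm (hatTerm χ χbar ρ w MN.1 MN.2 j)
      ≤ ∑' MN : ℕ × ℕ, ENNReal.ofReal ρ⁻¹ * (ENNReal.ofReal (ρ * ξ⁻¹) ^ (MN.1 + MN.2) *
        orderSum χ χbar ρ w MN.1 MN.2) := by
        refine ENNReal.tsum_le_tsum fun MN => ?_
        refine (mul_le_mul' le_rfl (tsum_hatTerm_le hρ w MN.1 MN.2)).trans (le_of_eq ?_)
        rw [ENNReal.ofReal_mul hρ.le, mul_pow]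
        ring
    _ ≤ ENNReal.ofReal ρ⁻¹ * ENNReal.ofReal (ρ * (γ / 2)) := by
        rw [ENNReal.tsum_mul_left]
        exact mul_le_mul' le_rfl (tsum_orderSum_le hχ hs hw)
    _ = ENNReal.ofReal (γ / 2) := by
        rw [← ENNReal.ofReal_mul (by positivity)]
        congr 1
        field_simp

lemma tsum_hatTerm_ne_top (hχ : IsCutoffPair χ χbar) (hs : ScaleCond χ ρ ξ γ)
    (hw : GoodKernel ρ ξ γ w) (M N : ℕ) : ∑' j, sharpNorm (hatTerm χ χbar ρ w M N j) ≠ ⊤ := by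
  intro h
  have h1 := (ENNReal.le_tsum (f := fun MN : ℕ × ℕ => ENNReal.ofReal ξ⁻¹ ^ (MN.1 + MN.2) *
      ∑' j, sharpNorm (hatTerm χ χbar ρ w MN.1 MN.2 j)) (M, N)).trans
    (tsum_tsum_hatTerm_le hχ hs hw)
  have h2 : ENNReal.ofReal ξ⁻¹ ^ (M + N) ≠ 0 :=
    pow_ne_zero _ (ENNReal.ofReal_pos.2 (inv_pos.2 hs.ξ_pos)).ne'
  simp only [h, ENNReal.mul_top h2] at h1
  exact absurd h1 (by simp)

/-- Almost everywhere, `ŵ` is the sum of the rescaled free part and of the series over all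
multi-indices. -/
lemma ae_hatKernel_eq (hχ : IsCutoffPair χ χbar) (hs : ScaleCond χ ρ ξ γ)
    (hw : GoodKernel ρ ξ γ w) (M N : ℕ) :
    ∀ᵐ K ∂(momentumMeasure M N), ∀ r ∈ Set.Icc (0 : ℝ) 1,
      hatKernel χ χbar ρ w M N r K.1 K.2 = rescaledFree ρ w M N r K.1 K.2 +
        ∑' j, hatTerm χ χbar ρ w M N j r K.1 K.2 := by
  filter_upwards [ae_summable_of_tsum_sharpNorm (fun j => hatTerm_spec hχ hs hw j)
    (tsum_hatTerm_ne_top hχ hs hw M N)] with K hK r hr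
  have h1 := hK r hr
  have hρ : (ρ : ℂ) ≠ 0 := by exact_mod_cast hs.ρ_pos.ne'
  have h2 : ∀ L : ℕ, ∑' i : MultiIndex (L + 1) M N,
      hatTerm χ χbar ρ w M N ⟨L, i⟩ r K.1 K.2 = (-1) ^ L * ((ρ : ℂ) ^ (M + N) * (ρ : ℂ)⁻¹) *
        orderTerm χ χbar ρ w (L + 1) M N r K.1 K.2 := fun L => by
    rw [orderTerm, ← tsum_mul_left]
    refine tsum_congr fun i => ?_
    simp only [hatTerm, Pi.smul_apply, smul_eq_mul]
    ring
  have h3 := h1.sigma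
  rw [h1.tsum_sigma]
  simp only [h2] at h3 ⊢
  unfold hatKernel rescaledFree
  split_ifs with h0
  · obtain ⟨rfl, rfl⟩ : M = 0 ∧ N = 0 := by omega
    rw [h3.tsum_eq_zero_add]
    -- the term of length one vanishes, as it has no outer momenta and hence a contraction
    have h4 : orderTerm χ χbar ρ w (0 + 1) 0 0 r K.1 K.2 = 0 := by
      rw [orderTerm]
      refine (tsum_congr fun i => ?_).trans tsum_zero
      have h5 : 0 < i.p 0 + i.q 0 := by
        have h6 := i.pos 0
        have h7 : i.m 0 = 0 := by have := i.sum_m; rwa [Fin.sum_univ_one] at this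
        have h8 : i.n 0 = 0 := by have := i.sum_n; rwa [Fin.sum_univ_one] at this
        omega
      have h6 : vKernel χ χbar ρ w i = 0 := vKernel_one_eq_zero hs.ρ_pos i h5
      rw [h6]
      simp
    rw [h4, mul_zero, zero_add, ← tsum_mul_left]
    congr 1
    refine tsum_congr fun L => ?_
    simp only [add_zero, pow_zero, one_mul]
    ring
  · rw [zero_add]
    refine tsum_congr fun L => ?_
    obtain ⟨a, ha⟩ : ∃ a, M + N = a + 1 := ⟨M + N - 1, by omega⟩
    rw [ha, Nat.add_sub_cancel, pow_succ, mul_assoc ((ρ : ℂ) ^ a), mul_inv_cancel₀ hρ, mul_one]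

lemma tsum_hatTerm_spec (hχ : IsCutoffPair χ χbar) (hs : ScaleCond χ ρ ξ γ)
    (hw : GoodKernel ρ ξ γ w) (M N : ℕ) :
    MemPre (fun r k k' => ∑' j, hatTerm χ χbar ρ w M N j r k k') ∧
      sharpNorm (fun r k k' => ∑' j, hatTerm χ χbar ρ w M N j r k k') ≤
        ∑' j, sharpNorm (hatTerm χ χbar ρ w M N j) :=
  MemPre.tsum (fun j => hatTerm_spec hχ hs hw j) (tsum_hatTerm_ne_top hχ hs hw M N)

lemma memPre_hatKernel (hχ : IsCutoffPair χ χbar) (hs : ScaleCond χ ρ ξ γ)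
    (hw : GoodKernel ρ ξ γ w) (M N : ℕ) : MemPre (hatKernel χ χbar ρ w M N) :=
  ((rescaledFree_spec hs.ρ_pos (by linarith [hs.ρ_le']) (hw.mem 0 0).memPre M N).1.add
    (tsum_hatTerm_spec hχ hs hw M N).1).congr (ae_hatKernel_eq hχ hs hw M N)

lemma sharpNorm_hatKernel_le (hχ : IsCutoffPair χ χbar) (hs : ScaleCond χ ρ ξ γ)
    (hw : GoodKernel ρ ξ γ w) (M N : ℕ) : sharpNorm (hatKernel χ χbar ρ w M N) ≤
      sharpNorm (rescaledFree ρ w M N) + ∑' j, sharpNorm (hatTerm χ χbar ρ w M N j) := by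
  rw [sharpNorm_congr (g := rescaledFree ρ w M N +
    fun r k k' => ∑' j, hatTerm χ χbar ρ w M N j r k k') (ae_hatKernel_eq hχ hs hw M N)]
  exact ((rescaledFree_spec hs.ρ_pos (by linarith [hs.ρ_le']) (hw.mem 0 0).memPre
    M N).1.sharpNorm_add_le (tsum_hatTerm_spec hχ hs hw M N).1).trans
      (add_le_add le_rfl (tsum_hatTerm_spec hχ hs hw M N).2)

/-- The interacting part of the renormalized kernel is at most `γ/2`. -/
lemma xiNorm_geOne_renormSharp_le (hχ : IsCutoffPair χ χbar) (hs : ScaleCond χ ρ ξ γ)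
    (hw : GoodKernel ρ ξ γ w) :
    xiNorm ξ (geOne (renormSharp χ χbar ρ w)) ≤ ENNReal.ofReal (γ / 2) := by
  refine le_trans (ENNReal.tsum_le_tsum fun MN => mul_le_mul' le_rfl ?_)
    (tsum_tsum_hatTerm_le hχ hs hw)
  by_cases h : 1 ≤ MN.1 + MN.2
  · have h1 : geOne (renormSharp χ χbar ρ w) MN.1 MN.2 =
        symmetrize (hatKernel χ χbar ρ w) MN.1 MN.2 := by
      simp only [geOne, h, if_true, renormSharp]
    rw [h1]
    refine (memSharp_symmetrize (memPre_hatKernel hχ hs hw _ _)).2.trans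
      ((sharpNorm_hatKernel_le hχ hs hw _ _).trans ?_)
    rw [rescaledFree_eq_zero w (by omega), sharpNorm_zero, zero_add]
  · have h1 : geOne (renormSharp χ χbar ρ w) MN.1 MN.2 = 0 := by
      simp only [geOne, h, if_false]
    rw [h1, sharpNorm_zero]
    exact zero_le

lemma sharpNorm_renormSharp_odd (hχ : IsCutoffPair χ χbar) (hs : ScaleCond χ ρ ξ γ)
    (hw : GoodKernel ρ ξ γ w) (h : Odd (M + N)) :
    sharpNorm (renormSharp χ χbar ρ w M N) = 0 := by
  refine le_antisymm ((memSharp_symmetrize (memPre_hatKernel hχ hs hw _ _)).2.trans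
      ((sharpNorm_hatKernel_le hχ hs hw _ _).trans ?_)) zero_le
  rw [rescaledFree_eq_zero w h.pos.ne', sharpNorm_zero, zero_add]
  refine (tsum_hatTerm_le hs.ρ_pos w M N).trans ?_
  rw [orderSum_odd hχ hs hw h, mul_zero]

end

/-! ### The free part of the renormalized kernel -/

section

variable {χ χbar : ℝ → ℝ} {ρ ξ γ : ℝ} {w : Kernel}

lemma renormSharp_zero (χ χbar : ℝ → ℝ) (ρ : ℝ) (w : Kernel) (r : ℝ) :
    (renormSharp χ χbar ρ w).zero r = hatKernel χ χbar ρ w 0 0 r Fin.elim0 Fin.elim0 := by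
  have h : ∀ (π : Equiv.Perm (Fin 0)), (fun i => (Fin.elim0 : Fin 0 → E3) (π i)) = Fin.elim0 :=
    fun π => Subsingleton.elim _ _
  simp [renormSharp, symmetrize, Kernel.zero, h]

/-- The renormalized free part is the rescaled free part up to an error of size `γ/2`. -/
lemma renormSharp_zero_spec (hχ : IsCutoffPair χ χbar) (hs : ScaleCond χ ρ ξ γ)
    (hw : GoodKernel ρ ξ γ w) : ∃ T : ℝ → ℂ, C1On (Set.Icc 0 1) (γ / 2) 1 T ∧
      ∀ r ∈ Set.Icc (0 : ℝ) 1,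
        (renormSharp χ χbar ρ w).zero r = (ρ : ℂ)⁻¹ * w.zero (ρ * r) + T r := by
  have hγ := hs.γ_nonneg
  obtain ⟨h1, h2⟩ := tsum_hatTerm_spec hχ hs hw 0 0
  have h3 := (ENNReal.le_tsum (f := fun MN : ℕ × ℕ => ENNReal.ofReal ξ⁻¹ ^ (MN.1 + MN.2) *
      ∑' j, sharpNorm (hatTerm χ χbar ρ w MN.1 MN.2 j)) (0, 0)).trans
    (tsum_tsum_hatTerm_le hχ hs hw)
  simp only [add_zero, pow_zero, one_mul] at h3
  have h4 := ENNReal.toReal_le_of_le_ofReal (by positivity) (h2.trans h3)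
  refine ⟨fun r => ∑' j, hatTerm χ χbar ρ w 0 0 j r Fin.elim0 Fin.elim0,
    (of_ae_zero_zero h1.ae_c1On (Fin.elim0, Fin.elim0)).mono h4 le_rfl zero_le_one,
    fun r hr => ?_⟩
  rw [renormSharp_zero]
  have h5 := of_ae_zero_zero (ae_hatKernel_eq hχ hs hw 0 0) (Fin.elim0, Fin.elim0) r hr
  rw [h5]
  simp [rescaledFree]

lemma norm_value_renormSharp_le (hχ : IsCutoffPair χ χbar) (hs : ScaleCond χ ρ ξ γ)
    (hw : GoodKernel ρ ξ γ w) :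
    ‖(renormSharp χ χbar ρ w).zero 0 - (ρ : ℂ)⁻¹ * w.zero 0‖ ≤ γ / 2 := by
  obtain ⟨T, hT, h⟩ := renormSharp_zero_spec hχ hs hw
  rw [h 0 (by simp), mul_zero, add_sub_cancel_left]
  exact hT.bound (by simp)

lemma norm_deriv_renormSharp_le (hχ : IsCutoffPair χ χbar) (hs : ScaleCond χ ρ ξ γ)
    (hw : GoodKernel ρ ξ γ w) {ε : ℝ}
    (hε : ∀ r ∈ Set.Icc (0 : ℝ) 1, ‖derivWithin w.zero (Set.Icc 0 1) r - 1‖ ≤ ε) {r : ℝ}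
    (hr : r ∈ Set.Icc (0 : ℝ) 1) :
    ‖derivWithin (renormSharp χ χbar ρ w).zero (Set.Icc 0 1) r - 1‖ ≤ ε + γ / 2 := by
  obtain ⟨T, hT, h⟩ := renormSharp_zero_spec hχ hs hw
  have hρ := hs.ρ_pos
  have hρr : ρ * r ∈ Set.Icc (0 : ℝ) 1 :=
    ⟨mul_nonneg hρ.le hr.1, mul_le_one₀ (by linarith [hs.ρ_le']) hr.1 hr.2⟩
  have hρ0 : (ρ : ℂ) ≠ 0 := by exact_mod_cast hρ.ne'
  have h1 : HasDerivWithinAt (fun r : ℝ => ρ * r) ρ (Set.Icc 0 1) r := by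
    simpa using ((hasDerivAt_id r).const_mul ρ).hasDerivWithinAt
  have hm : Set.MapsTo (fun r : ℝ => ρ * r) (Set.Icc 0 1) (Set.Icc 0 1) := fun r hr =>
    ⟨mul_nonneg hρ.le hr.1, mul_le_one₀ (by linarith [hs.ρ_le']) hr.1 hr.2⟩
  have h2 := (hw.free.contDiff.differentiableOn (by simp) _ hρr).hasDerivWithinAt.scomp r h1 hm
  have h3 := ((h2.const_mul (ρ : ℂ)⁻¹).fun_add (hT.hasDerivWithinAt hr)).congr h (h r hr)
  rw [h3.derivWithin (uniqueDiffOn_Icc_zero_one r hr), Complex.real_smul, inv_mul_cancel_left₀ hρ0,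
    add_sub_right_comm]
  refine (norm_add_le _ _).trans (add_le_add (hε _ hρr) ?_)
  have := hT.norm_derivWithin_le hr
  rwa [mul_one] at this

end

/-! ### A Cauchy estimate for functions with values in a seminormed space -/

/-- A scalar holomorphic function, bounded by `B` on a disc of radius `R`, is approximated by its
linearization with an error controlled by `B / R²`. -/
lemma norm_linearization_le {φ : ℂ → ℂ} {z₀ : ℂ} {R B : ℝ} (hR : 0 < R)
    (hd : DifferentiableOn ℂ φ (Metric.ball z₀ R)) (hB : ∀ z ∈ Metric.ball z₀ R, ‖φ z‖ ≤ B)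
    {h : ℂ} (hh : ‖h‖ < R / 4) :
    ‖φ (z₀ + h) - φ z₀ - h * deriv φ z₀‖ ≤ 8 * B / R ^ 2 * ‖h‖ ^ 2 ∧
      ‖deriv φ z₀‖ ≤ 2 * B / R := by
  have hsub : ∀ z ∈ Metric.ball z₀ (R / 2), Metric.closedBall z (R / 4) ⊆ Metric.ball z₀ R :=
    fun z hz => Metric.closedBall_subset_ball' (by rw [Metric.mem_ball] at hz; linarith)
  have h1 : ∀ z ∈ Metric.ball z₀ (R / 2), ‖deriv φ z‖ ≤ 2 * B / R := fun z hz => by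
    rw [show 2 * B / R = B / (R / 2) by field_simp]
    have hz' : dist z z₀ < R / 2 := hz
    have hc : ∀ s, s < R / 2 → 0 < s → ‖deriv φ z‖ ≤ B / s := fun s hs hs0 => by
      have hsub : Metric.closedBall z s ⊆ Metric.ball z₀ R :=
        Metric.closedBall_subset_ball' (by linarith)
      refine Complex.norm_deriv_le_of_forall_mem_sphere_norm_le hs0 ?_ fun y hy =>
        hB y (hsub (Metric.sphere_subset_closedBall hy))
      exact (hd.mono hsub).diffContOnCl_ball subset_rfl
    have hB0 : 0 ≤ B := (norm_nonneg _).trans (hB z₀ (Metric.mem_ball_self hR))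
    have ht : Tendsto (fun s : ℝ => B / s) (𝓝[<] (R / 2)) (𝓝 (B / (R / 2))) :=
      (tendsto_const_nhds.div tendsto_id (by positivity)).mono_left nhdsWithin_le_nhds
    refine ge_of_tendsto ht ?_
    filter_upwards [self_mem_nhdsWithin, mem_nhdsWithin_of_mem_nhds
      (Ioi_mem_nhds (show 0 < R / 2 by positivity))] with s hs hs0 using hc s hs hs0
  have hd' : DifferentiableOn ℂ (deriv φ) (Metric.ball z₀ R) := hd.deriv Metric.isOpen_ball
  have h2 : ∀ z ∈ Metric.ball z₀ (R / 4), ‖deriv (deriv φ) z‖ ≤ 8 * B / R ^ 2 := fun z hz => by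
    rw [show 8 * B / R ^ 2 = 2 * B / R / (R / 4) by field_simp; ring]
    have hz' : dist z z₀ < R / 4 := hz
    have hc : ∀ s, s < R / 4 → 0 < s → ‖deriv (deriv φ) z‖ ≤ 2 * B / R / s := fun s hs hs0 => by
      have hsub : Metric.closedBall z s ⊆ Metric.ball z₀ (R / 2) :=
        Metric.closedBall_subset_ball' (by linarith)
      refine Complex.norm_deriv_le_of_forall_mem_sphere_norm_le hs0 ?_ fun y hy =>
        h1 y (hsub (Metric.sphere_subset_closedBall hy))
      exact (hd'.mono (hsub.trans (Metric.ball_subset_ball (by linarith)))).diffContOnCl_ball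
        subset_rfl
    have ht : Tendsto (fun s : ℝ => 2 * B / R / s) (𝓝[<] (R / 4)) (𝓝 (2 * B / R / (R / 4))) :=
      (tendsto_const_nhds.div tendsto_id (by positivity)).mono_left nhdsWithin_le_nhds
    refine ge_of_tendsto ht ?_
    filter_upwards [self_mem_nhdsWithin, mem_nhdsWithin_of_mem_nhds
      (Ioi_mem_nhds (show 0 < R / 4 by positivity))] with s hs hs0 using hc s hs hs0
  refine ⟨?_, h1 z₀ (Metric.mem_ball_self (by positivity))⟩
  have hball : ∀ {z}, z ∈ Metric.ball z₀ (R / 4) → z ∈ Metric.ball z₀ R := fun hz =>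
    Metric.ball_subset_ball (by linarith) hz
  have hB0 : 0 ≤ 8 * B / R ^ 2 :=
    (norm_nonneg _).trans (h2 z₀ (Metric.mem_ball_self (by positivity)))
  -- the derivative varies by at most `8 B / R² ‖h‖` along the segment from `z₀` to `z₀ + h`
  have h3 : ∀ z ∈ Metric.closedBall z₀ ‖h‖, ‖deriv φ z - deriv φ z₀‖ ≤ 8 * B / R ^ 2 * ‖h‖ :=
    fun z hz => by
    have hz' : z ∈ Metric.ball z₀ (R / 4) := Metric.mem_ball.2 (lt_of_le_of_lt hz hh)
    have := (convex_ball z₀ (R / 4)).norm_image_sub_le_of_norm_deriv_le (𝕜 := ℂ)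
      (fun y hy => hd'.differentiableAt (Metric.isOpen_ball.mem_nhds (hball hy))) h2
      (Metric.mem_ball_self (by positivity)) hz'
    refine this.trans (mul_le_mul_of_nonneg_left ?_ hB0)
    rwa [← dist_eq_norm]
  have h4 := (convex_closedBall z₀ ‖h‖).norm_image_sub_le_of_norm_hasDerivWithin_le (𝕜 := ℂ)
    (f := fun z => φ z - z * deriv φ z₀) (f' := fun z => deriv φ z - 1 * deriv φ z₀)
    (C := 8 * B / R ^ 2 * ‖h‖) (x := z₀) (y := z₀ + h) (fun z hz => by
      have hz' : z ∈ Metric.ball z₀ R := hball (Metric.mem_ball.2 (lt_of_le_of_lt hz hh))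
      exact ((hd.differentiableAt (Metric.isOpen_ball.mem_nhds hz')).hasDerivAt.sub
        ((hasDerivAt_id z).mul_const _)).hasDerivWithinAt)
    (fun z hz => by rw [one_mul]; exact h3 z hz)
    (Metric.mem_closedBall_self (norm_nonneg _)) (by simp)
  have e : φ (z₀ + h) - (z₀ + h) * deriv φ z₀ - (φ z₀ - z₀ * deriv φ z₀) =
      φ (z₀ + h) - φ z₀ - h * deriv φ z₀ := by ring
  rw [e, add_sub_cancel_left] at h4
  linarith [h4, sq ‖h‖]

/-- The vector valued version, reduced to the scalar one by the Hahn–Banach theorem. -/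
lemma seminorm_linearization_le {V : Type*} [AddCommGroup V] [Module ℂ V] (p : Seminorm ℂ V)
    {u u' : ℂ → V} {z₀ : ℂ} {R B : ℝ} (hR : 0 < R)
    (hd : ∀ z ∈ Metric.ball z₀ R,
      Tendsto (fun h : ℂ => p (h⁻¹ • (u (z + h) - u z) - u' z)) (𝓝[≠] 0) (𝓝 0))
    (hB : ∀ z ∈ Metric.ball z₀ R, p (u z) ≤ B) {h : ℂ} (hh : ‖h‖ < R / 4) (h0 : h ≠ 0) :
    p (h⁻¹ • (u (z₀ + h) - u z₀) - u' z₀) ≤ 8 * B / R ^ 2 * ‖h‖ ∧ p (u' z₀) ≤ 2 * B / R := by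
  -- composition with a functional bounded by `p`
  have key : ∀ f : V →ₗ[ℂ] ℂ, (∀ v, ‖f v‖ ≤ p v) →
      ‖f (h⁻¹ • (u (z₀ + h) - u z₀) - u' z₀)‖ ≤ 8 * B / R ^ 2 * ‖h‖ ∧
        ‖f (u' z₀)‖ ≤ 2 * B / R := fun f hf => by
    have hdf : ∀ z ∈ Metric.ball z₀ R, HasDerivAt (fun z => f (u z)) (f (u' z)) z :=
      fun z hz => by
      rw [hasDerivAt_iff_tendsto_slope_zero]
      have h1 : Tendsto (fun h : ℂ => f (h⁻¹ • (u (z + h) - u z) - u' z)) (𝓝[≠] 0) (𝓝 0) :=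
        squeeze_zero_norm (fun h => hf _) (hd z hz)
      have h2 := h1.add_const (f (u' z))
      simp only [map_sub, map_smul, sub_add_cancel, zero_add] at h2
      exact h2
    obtain ⟨h1, h2⟩ := norm_linearization_le (φ := fun z => f (u z)) hR
      (fun z hz => (hdf z hz).differentiableAt.differentiableWithinAt)
      (fun z hz => (hf _).trans (hB z hz)) hh
    rw [(hdf z₀ (Metric.mem_ball_self hR)).deriv] at h1 h2
    refine ⟨?_, h2⟩
    have e : f (h⁻¹ • (u (z₀ + h) - u z₀) - u' z₀) =
        h⁻¹ * (f (u (z₀ + h)) - f (u z₀) - h * f (u' z₀)) := by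
      simp only [map_sub, map_smul, smul_eq_mul]
      field_simp
    rw [e, norm_mul, norm_inv, inv_mul_le_iff₀ (norm_pos_iff.2 h0)]
    linarith [sq ‖h‖]
  have hb : ∀ x : V, ∃ f : V →ₗ[ℂ] ℂ, (∀ v, ‖f v‖ ≤ p v) ∧ ‖f x‖ = p x := fun x => by
    let _ : SeminormedAddCommGroup V := p.toAddGroupSeminorm.toSeminormedAddCommGroup
    let _ : NormedSpace ℂ V := ⟨fun c v => (map_smul_eq_mul p c v).le⟩
    obtain ⟨g, hg, hgx⟩ := exists_dual_vector'' ℂ x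
    refine ⟨g.toLinearMap, fun v => ?_, ?_⟩
    · have h1 := g.le_opNorm v
      exact h1.trans ((mul_le_mul_of_nonneg_right hg (norm_nonneg _)).trans (one_mul _).le)
    · change ‖g x‖ = p x
      rw [hgx, RCLike.norm_ofReal, abs_norm]
      rfl
  constructor
  · obtain ⟨f, hf, hx⟩ := hb (h⁻¹ • (u (z₀ + h) - u z₀) - u' z₀)
    rw [← hx]
    exact (key f hf).1
  · obtain ⟨f, hf, hx⟩ := hb (u' z₀)
    rw [← hx]
    exact (key f hf).2

/-! ### Differentiability of series of kernels -/

/-- The space of kernels of finite norm, without symmetry. -/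
def preModule (m n : ℕ) : Submodule ℂ (KerFun m n) where
  carrier := {f | MemPre f}
  add_mem' hf hg := hf.add hg
  zero_mem' := memPre_zero
  smul_mem' c _ hf := hf.smul c

section

variable {ι : Type} {m n : ι → ℕ}

/-- A finite weighted sum of the norms `‖·‖^#` of families of kernels. -/
def finiteSeminorm (ω : ι → ℝ) (hω : ∀ j, 0 ≤ ω j) (S : Finset ι) :
    Seminorm ℂ (∀ j, preModule (m j) (n j)) :=
  Seminorm.ofSMulLE (fun v => ∑ j ∈ S, ω j * (sharpNorm (v j).1).toReal)
    (by simp [sharpNorm_zero])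
    (fun v v' => by
      rw [← Finset.sum_add_distrib]
      refine Finset.sum_le_sum fun j _ => ?_
      rw [← mul_add, ← ENNReal.toReal_add (v j).2.norm_lt_top.ne (v' j).2.norm_lt_top.ne]
      refine mul_le_mul_of_nonneg_left (ENNReal.toReal_mono ?_ ?_) (hω j)
      · exact ENNReal.add_ne_top.2 ⟨(v j).2.norm_lt_top.ne, (v' j).2.norm_lt_top.ne⟩
      · exact (v j).2.sharpNorm_add_le (v' j).2)
    (fun c v => by
      rw [Finset.mul_sum]
      refine Finset.sum_le_sum fun j _ => ?_
      rw [mul_left_comm]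
      refine mul_le_mul_of_nonneg_left ?_ (hω j)
      have h1 := sharpNorm_smul_le c (v j).1
      have h2 := ENNReal.toReal_mono (ENNReal.mul_ne_top (by simp) (v j).2.norm_lt_top.ne) h1
      rwa [ENNReal.toReal_mul, toReal_enorm] at h2)

lemma finiteSeminorm_apply (ω : ι → ℝ) (hω : ∀ j, 0 ≤ ω j) (S : Finset ι)
    (v : ∀ j, preModule (m j) (n j)) :
    finiteSeminorm ω hω S v = ∑ j ∈ S, ω j * (sharpNorm (v j).1).toReal := rfl

lemma ofReal_finiteSeminorm (ω : ι → ℝ) (hω : ∀ j, 0 ≤ ω j) (S : Finset ι)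
    (v : ∀ j, preModule (m j) (n j)) :
    ENNReal.ofReal (finiteSeminorm ω hω S v) =
      ∑ j ∈ S, ENNReal.ofReal (ω j) * sharpNorm (v j).1 := by
  rw [finiteSeminorm_apply, ENNReal.ofReal_sum_of_nonneg fun j _ =>
    mul_nonneg (hω j) ENNReal.toReal_nonneg]
  refine Finset.sum_congr rfl fun j _ => ?_
  rw [ENNReal.ofReal_mul (hω j), ENNReal.ofReal_toReal (v j).2.norm_lt_top.ne]

/-- If the terms of a series are holomorphic and the sum of their norms is bounded on a disc, then
the series may be differentiated termwise at the center. -/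
lemma weighted_differentiable {ω : ι → ℝ} (hω : ∀ j, 0 ≤ ω j)
    {V : ℂ → ∀ j, KerFun (m j) (n j)} {z₀ : ℂ} {R B : ℝ} (hR : 0 < R) (hB0 : 0 ≤ B)
    (hV : ∀ z ∈ Metric.ball z₀ R, ∀ j, MemPre (V z j))
    (hd : ∀ z ∈ Metric.ball z₀ R, ∀ j, ∃ v', MemPre v' ∧
      Tendsto (fun h : ℂ => sharpNorm (h⁻¹ • (V (z + h) j - V z j) - v')) (𝓝[≠] 0) (𝓝 0))
    (hB : ∀ z ∈ Metric.ball z₀ R,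
      ∑' j, ENNReal.ofReal (ω j) * sharpNorm (V z j) ≤ ENNReal.ofReal B) :
    ∃ V' : ∀ j, KerFun (m j) (n j), (∀ j, MemPre (V' j)) ∧
      ∑' j, ENNReal.ofReal (ω j) * sharpNorm (V' j) ≤ ENNReal.ofReal (2 * B / R) ∧
      ∀ h : ℂ, h ≠ 0 → ‖h‖ < R / 4 →
        ∑' j, ENNReal.ofReal (ω j) * sharpNorm (h⁻¹ • (V (z₀ + h) j - V z₀ j) - V' j) ≤
          ENNReal.ofReal (8 * B / R ^ 2 * ‖h‖) := by
  classical
  choose! v' hv' hvt using hd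
  have hz₀ : z₀ ∈ Metric.ball z₀ R := Metric.mem_ball_self hR
  -- the values outside the disc are immaterial, but have to be elements of the submodule
  set u : ℂ → ∀ j, preModule (m j) (n j) := fun z j =>
    if hz : z ∈ Metric.ball z₀ R then ⟨V z j, hV z hz j⟩ else 0 with hu
  set u' : ℂ → ∀ j, preModule (m j) (n j) := fun z j =>
    if hz : z ∈ Metric.ball z₀ R then ⟨v' z j, hv' z hz j⟩ else 0 with hu'
  have eu : ∀ z ∈ Metric.ball z₀ R, ∀ j, (u z j).1 = V z j :=
    fun z hz j => by simp only [hu, dif_pos hz]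
  have eu' : ∀ z ∈ Metric.ball z₀ R, ∀ j, (u' z j).1 = v' z j := fun z hz j => by
    simp only [hu', dif_pos hz]
  have ediff : ∀ z ∈ Metric.ball z₀ R, ∀ h : ℂ, z + h ∈ Metric.ball z₀ R → ∀ j,
      ((h⁻¹ • (u (z + h) - u z) - u' z) j).1 = h⁻¹ • (V (z + h) j - V z j) - v' z j :=
    fun z hz h hzh j => by
    have : ((h⁻¹ • (u (z + h) - u z) - u' z) j).1 =
      h⁻¹ • ((u (z + h) j).1 - (u z j).1) - (u' z j).1 := rfl
    rw [this, eu _ hzh, eu _ hz, eu' _ hz]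
  -- the bounds on finite partial sums do not depend on the partial sum
  have key : ∀ S : Finset ι, ∀ h : ℂ, h ≠ 0 → ‖h‖ < R / 4 →
      finiteSeminorm ω hω S (h⁻¹ • (u (z₀ + h) - u z₀) - u' z₀) ≤ 8 * B / R ^ 2 * ‖h‖ ∧
        finiteSeminorm ω hω S (u' z₀) ≤ 2 * B / R := fun S h h0 hh => by
    refine seminorm_linearization_le (finiteSeminorm ω hω S) hR (fun z hz => ?_) (fun z hz => ?_)
      hh h0
    · have h1 : Tendsto (fun h : ℂ => ∑ j ∈ S,
          ω j * (sharpNorm (h⁻¹ • (V (z + h) j - V z j) - v' z j)).toReal) (𝓝[≠] 0) (𝓝 0) := by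
        have h2 : Tendsto (fun h : ℂ => ∑ j ∈ S,
          ω j * (sharpNorm (h⁻¹ • (V (z + h) j - V z j) - v' z j)).toReal) (𝓝[≠] 0)
            (𝓝 (∑ j ∈ S, ω j * (0 : ENNReal).toReal)) :=
          tendsto_finsetSum S fun j _ =>
            ((ENNReal.tendsto_toReal ENNReal.zero_ne_top).comp (hvt z hz j)).const_mul _
        simpa using h2
      refine h1.congr' ?_
      have h3 : ∀ᶠ h : ℂ in 𝓝[≠] 0, z + h ∈ Metric.ball z₀ R := by
        refine eventually_nhdsWithin_of_eventually_nhds ?_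
        have h4 : Tendsto (fun h : ℂ => z + h) (𝓝 0) (𝓝 z) := by
          simpa using (continuous_const_add z).tendsto 0
        exact h4.eventually (Metric.isOpen_ball.mem_nhds hz)
      filter_upwards [h3] with h hzh
      rw [finiteSeminorm_apply]
      refine Finset.sum_congr rfl fun j _ => ?_
      rw [ediff z hz h hzh j]
    · have h1 := (ENNReal.sum_le_tsum S).trans (hB z hz)
      rw [← ENNReal.ofReal_le_ofReal_iff hB0, ofReal_finiteSeminorm]
      refine le_trans (le_of_eq ?_) h1
      exact Finset.sum_congr rfl fun j _ => by rw [eu z hz]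
  refine ⟨v' z₀, hv' z₀ hz₀, ?_, fun h h0 hh => ?_⟩
  · rw [ENNReal.tsum_eq_iSup_sum]
    refine iSup_le fun S => ?_
    have h1 := (key S (R / 8 : ℝ) (by exact_mod_cast (by positivity : R / 8 ≠ 0)) (by
      rw [Complex.norm_real, Real.norm_of_nonneg (by positivity)]; linarith)).2
    refine le_trans (le_of_eq ?_) (ENNReal.ofReal_le_ofReal h1)
    rw [ofReal_finiteSeminorm]
    exact Finset.sum_congr rfl fun j _ => by rw [eu' z₀ hz₀]
  · rw [ENNReal.tsum_eq_iSup_sum]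
    refine iSup_le fun S => ?_
    have hzh : z₀ + h ∈ Metric.ball z₀ R := by
      rw [Metric.mem_ball, dist_eq_norm, add_sub_cancel_left]; linarith
    refine le_trans (le_of_eq ?_) (ENNReal.ofReal_le_ofReal (key S h h0 hh).1)
    rw [ofReal_finiteSeminorm]
    exact Finset.sum_congr rfl fun j _ => by rw [ediff z₀ hz₀ h hzh]

end

/-! ### Holomorphic families of kernels -/

section

variable {χ χbar : ℝ → ℝ} {ρ ξ γ : ℝ} {M N : ℕ}

/-- A differentiable family of kernels has good versions that are differentiable. -/
lemma exists_kernelDiff {a b : ℕ} (hab : 1 ≤ a + b) {F : ℂ → KerFun a b} {F₀ F' : KerFun a b}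
    (h0 : MemPre F₀) (h' : MemPre F') (hF : ∀ᶠ h in 𝓝[≠] (0 : ℂ), MemPre (F h))
    (ht : Tendsto (fun h : ℂ => sharpNorm (h⁻¹ • (F h - F₀) - F')) (𝓝[≠] 0) (𝓝 0)) :
    ∃ (f : ℂ → KerFun a b) (f₀ f' : KerFun a b), KernelDiff f f₀ f' ∧
      (∃ C, NiceKernel C f₀) ∧
      (∀ᵐ K ∂(momentumMeasure a b), ∀ r ∈ Set.Icc (0 : ℝ) 1, F₀ r K.1 K.2 = f₀ r K.1 K.2) ∧
      ∀ᶠ h in 𝓝[≠] (0 : ℂ), (∃ C, NiceKernel C (f h)) ∧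
        ∀ᵐ K ∂(momentumMeasure a b), ∀ r ∈ Set.Icc (0 : ℝ) 1, F h r K.1 K.2 = f h r K.1 K.2 := by
  obtain ⟨f₀, hf₀, e₀⟩ := h0.exists_niceKernel hab
  obtain ⟨f', hf', e'⟩ := h'.exists_niceKernel hab
  have hex : ∀ h : ℂ, ∃ e : KerFun a b, MemPre (F h) →
      NiceKernel (sharpNorm (h⁻¹ • (F h - F₀) - F')).toReal e ∧
      ∀ᵐ K ∂(momentumMeasure a b), ∀ r ∈ Set.Icc (0 : ℝ) 1,
        (h⁻¹ • (F h - F₀) - F') r K.1 K.2 = e r K.1 K.2 := fun h => by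
    by_cases hh : MemPre (F h)
    · obtain ⟨e, he⟩ := (((hh.sub h0).smul h⁻¹).sub h').exists_niceKernel hab
      exact ⟨e, fun _ => he⟩
    · exact ⟨0, fun h => absurd h hh⟩
  choose e he using hex
  have htr : Tendsto (fun h : ℂ => (sharpNorm (h⁻¹ • (F h - F₀) - F')).toReal) (𝓝[≠] 0) (𝓝 0) :=
    (ENNReal.tendsto_toReal ENNReal.zero_ne_top).comp ht
  refine ⟨fun h => f₀ + h • (f' + e h), f₀, f', ⟨⟨_, hf₀⟩, ⟨_, hf'⟩, e, _, htr, ?_⟩, ⟨_, hf₀⟩, e₀,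
    ?_⟩
  · filter_upwards [hF] with h hh using ⟨(he h hh).1, rfl⟩
  · filter_upwards [hF, self_mem_nhdsWithin] with h hh hne
    have hne' : h ≠ 0 := hne
    refine ⟨⟨_, hf₀.add ((hf'.add (he h hh).1).smul h)⟩, ?_⟩
    filter_upwards [e₀, e', (he h hh).2] with K k0 k' ke r hr
    have h1 := ke r hr
    simp only [Pi.add_apply, Pi.smul_apply, Pi.sub_apply, smul_eq_mul] at h1 ⊢
    rw [← k0 r hr, ← k' r hr, ← h1]
    field_simp
    ring

lemma MemPre.zero_spec {u : Kernel} (h : MemPre (u 0 0)) :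
    ContDiffOn ℝ 1 u.zero (Set.Icc 0 1) ∧ ∀ r ∈ Set.Icc (0 : ℝ) 1,
      ‖u.zero r‖ ≤ (sharpNorm (u 0 0)).toReal ∧
        ‖derivWithin u.zero (Set.Icc 0 1) r‖ ≤ (sharpNorm (u 0 0)).toReal := by
  have h1 := of_ae_zero_zero h.ae_c1On (Fin.elim0, Fin.elim0)
  refine ⟨h1.contDiffOn, fun r hr => ⟨h1.bound hr, ?_⟩⟩
  have := h1.norm_derivWithin_le hr
  rwa [mul_one] at this

lemma tendsto_sharpNorm_of_xiNorm (hξ : 0 < ξ) {u : ℂ → Kernel}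
    (h : Tendsto (fun h => xiNorm ξ (u h)) (𝓝[≠] 0) (𝓝 0)) (a b : ℕ) :
    Tendsto (fun h => sharpNorm (u h a b)) (𝓝[≠] 0) (𝓝 0) := by
  set c : ENNReal := ENNReal.ofReal ξ⁻¹ ^ (a + b) with hc
  have hc0 : c ≠ 0 := pow_ne_zero _ (ENNReal.ofReal_pos.2 (inv_pos.2 hξ)).ne'
  have hct : c ≠ ⊤ := ENNReal.pow_ne_top ENNReal.ofReal_ne_top
  have h1 : Tendsto (fun h => c⁻¹ * xiNorm ξ (u h)) (𝓝[≠] 0) (𝓝 (c⁻¹ * 0)) :=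
    ENNReal.Tendsto.const_mul h (Or.inr (ENNReal.inv_ne_top.2 hc0))
  rw [mul_zero] at h1
  refine tendsto_of_tendsto_of_tendsto_of_le_of_le tendsto_const_nhds h1 (fun _ => zero_le)
    fun h => ?_
  have h2 := ENNReal.le_tsum (f := fun mn : ℕ × ℕ => ENNReal.ofReal ξ⁻¹ ^ (mn.1 + mn.2) *
    sharpNorm (u h mn.1 mn.2)) (a, b)
  calc sharpNorm (u h a b) = c⁻¹ * (c * sharpNorm (u h a b)) := by
        rw [← mul_assoc, ENNReal.inv_mul_cancel hc0 hct, one_mul]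
    _ ≤ _ := mul_le_mul' le_rfl h2

/-- A family of kernels that satisfy the assumptions of the contraction estimate and that depend
holomorphically on a parameter in the disc. -/
structure GoodFamily (ρ ξ γ : ℝ) (W : ℂ → Kernel) : Prop where
  good : ∀ ζ ∈ disc, GoodKernel ρ ξ γ (W ζ)
  diff : ∀ ζ ∈ disc, ∃ W' : Kernel, MemXi ξ W' ∧
    Tendsto (fun h : ℂ => xiNorm ξ (h⁻¹ • (W (ζ + h) - W ζ) - W')) (𝓝[≠] 0) (𝓝 0)

lemma isOpen_disc : IsOpen disc := isOpen_lt continuous_norm continuous_const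

lemma eventually_add_mem_disc {ζ : ℂ} (hζ : ζ ∈ disc) : ∀ᶠ h in 𝓝[≠] (0 : ℂ), ζ + h ∈ disc := by
  refine eventually_nhdsWithin_of_eventually_nhds ?_
  have h4 : Tendsto (fun h : ℂ => ζ + h) (𝓝 0) (𝓝 ζ) := by
    simpa using (continuous_const_add ζ).tendsto 0
  exact h4.eventually (isOpen_disc.mem_nhds hζ)

/-- The kernels `v` depend holomorphically on the parameter. -/
lemma GoodFamily.vKernel_differentiable (hχ : IsCutoffPair χ χbar) (hs : ScaleCond χ ρ ξ γ)
    {W : ℂ → Kernel} (hW : GoodFamily ρ ξ γ W) {ζ : ℂ} (hζ : ζ ∈ disc) {L : ℕ}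
    (i : MultiIndex (L + 1) M N) : ∃ v', MemPre v' ∧
      Tendsto (fun h : ℂ => sharpNorm
        (h⁻¹ • (vKernel χ χbar ρ (W (ζ + h)) i - vKernel χ χbar ρ (W ζ) i) - v'))
        (𝓝[≠] 0) (𝓝 0) := by
  have hρ := hs.ρ_pos
  have hρ1 : ρ ≤ 1 := by linarith [hs.ρ_le']
  obtain ⟨W', hW', ht⟩ := hW.diff ζ hζ
  have hev := eventually_add_mem_disc hζ
  have hex := fun l : Fin (L + 1) => exists_kernelDiff (a := i.p l + i.m l) (b := i.q l + i.n l)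
    (by have := i.pos l; omega) (F := fun h => W (ζ + h) (i.p l + i.m l) (i.q l + i.n l))
    ((hW.good ζ hζ).mem _ _).memPre (hW'.1 _ _).memPre
    (hev.mono fun h hh => ((hW.good _ hh).mem _ _).memPre)
    (tendsto_sharpNorm_of_xiNorm hs.ξ_pos ht _ _)
  choose f f₀ f' hd hn₀ hae₀ hae using hex
  have hG : ∃ G', FunDiff (fun h => freeResolvent χbar ρ (W (ζ + h)).zero)
      (freeResolvent χbar ρ (W ζ).zero) G' := by
    have hrem : ∀ᶠ h in 𝓝[≠] (0 : ℂ), MemPre ((h⁻¹ • (W (ζ + h) - W ζ) - W') 0 0) :=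
      hev.mono fun h hh => ((((hW.good _ hh).mem 0 0).memPre.sub
        ((hW.good ζ hζ).mem 0 0).memPre).smul h⁻¹).sub (hW'.1 0 0).memPre
    refine hχ.funDiff_freeResolvent hρ hρ1 (hW.good ζ hζ).free
      (hev.mono fun h hh => (hW.good _ hh).free) (hW'.1 0 0).memPre.zero_spec.1
      (hW'.1 0 0).memPre.zero_spec.2
      (e := fun h => (h⁻¹ • (W (ζ + h) - W ζ) - W').zero)
      ((ENNReal.tendsto_toReal ENNReal.zero_ne_top).comp
        (tendsto_sharpNorm_of_xiNorm hs.ξ_pos ht 0 0)) (hrem.mono fun h hh => hh.zero_spec) ?_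
    filter_upwards [self_mem_nhdsWithin] with h hne r _
    have hne' : h ≠ 0 := hne
    simp only [Kernel.zero, Pi.sub_apply, Pi.smul_apply, smul_eq_mul]
    field_simp
    ring
  obtain ⟨G', hG'⟩ := hG
  have hGl : ∀ l : Fin (L + 1), ∃ G', FunDiff (fun h => regFun χ χbar ρ (W (ζ + h)).zero l)
      (regFun χ χbar ρ (W ζ).zero l) G' := fun l => by
    unfold regFun
    split_ifs
    · have h1 := hχ.cutoffFun_spec hρ
      exact ⟨0, FunDiff.const (div_nonneg (cutoffSlope_nonneg χ) hρ.le) h1.1 h1.2⟩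
    · exact ⟨G', hG'⟩
  choose Gl hGl using hGl
  have hsupp : ∀ (f : ∀ l, (i.geom l).Ker) (q : ℝ → ℂ) (r : ℝ) (k : Fin M → E3) (k' : Fin N → E3),
      1 - max (sumNorm k) (sumNorm k') < r →
        chainKernel χ ρ i.geom f (regFun χ χbar ρ q) r k k' = 0 := fun f q r k k' h =>
    chainKernel_support hχ.eq_zero i f (fun l hl s hs => regFun_last hχ hρ _ l hl s hs) hρ
      (Nat.succ_pos L) r k k' h
  obtain ⟨v', hv', hvt⟩ := chainKernel_differentiable hρ hχ.smooth.continuousOn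
    (cutoffSlope_nonneg χ) hχ.c1On i.geom_valid (f := fun h l => f l h) (f₀ := f₀) (f' := f') hd
    (G := fun h => regFun χ χbar ρ (W (ζ + h)).zero) hGl
    (Eventually.of_forall fun h => hsupp _ _) (hsupp _ _)
  refine ⟨v', hv', hvt.congr' ?_⟩
  have hall : ∀ᶠ h in 𝓝[≠] (0 : ℂ), ∀ l, (∃ C, NiceKernel C (f l h)) ∧
      ∀ᵐ K ∂(momentumMeasure (i.p l + i.m l) (i.q l + i.n l)), ∀ r ∈ Set.Icc (0 : ℝ) 1,
        W (ζ + h) (i.p l + i.m l) (i.q l + i.n l) r K.1 K.2 = f l h r K.1 K.2 :=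
    eventually_all.2 hae
  choose C₀ hC₀ using hn₀
  have e₀ := ae_vKernel_eq_chainKernel (χ := χ) (χbar := χbar) hρ hρ1 (hW.good ζ hζ).free i hC₀ hae₀
  filter_upwards [hall, hev] with h hh hhd
  choose C hC using fun l => (hh l).1
  have e₁ := ae_vKernel_eq_chainKernel (χ := χ) (χbar := χbar) hρ hρ1 (hW.good _ hhd).free i hC
    fun l => (hh l).2
  refine sharpNorm_congr ?_
  filter_upwards [e₀, e₁] with K k0 k1 r hr
  simp only [Pi.sub_apply, Pi.smul_apply, k0 r hr, k1 r hr]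

lemma symmetrize_sub_smul (c : ℂ) (A B C : Kernel) :
    symmetrize (c • (A - B) - C) = c • (symmetrize A - symmetrize B) - symmetrize C := by
  funext M N r k k'
  simp only [symmetrize, Pi.sub_apply, Pi.smul_apply, smul_eq_mul, Finset.sum_sub_distrib,
    ← Finset.mul_sum]
  ring

/-- The norm of the symmetrization of a kernel that consists of a rescaled free part and of a
series. -/
lemma symmetrize_spec (hρ : 0 < ρ) (hρ1 : ρ ≤ 1) (hξ : 0 < ξ) {A u : Kernel}
    {T : ∀ M N, (Σ L : ℕ, MultiIndex (L + 1) M N) → KerFun M N} (hu : MemPre (u 0 0))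
    (hT : ∀ M N j, MemPre (T M N j)) {S : ENNReal} (hS : S ≠ ⊤)
    (hsum : ∑' MN : ℕ × ℕ, ENNReal.ofReal ξ⁻¹ ^ (MN.1 + MN.2) *
      ∑' j, sharpNorm (T MN.1 MN.2 j) ≤ S)
    (hA : ∀ M N, ∀ᵐ K ∂(momentumMeasure M N), ∀ r ∈ Set.Icc (0 : ℝ) 1,
      A M N r K.1 K.2 = rescaledFree ρ u M N r K.1 K.2 + ∑' j, T M N j r K.1 K.2) :
    (∀ M N, MemSharp (symmetrize A M N)) ∧
      xiNorm ξ (symmetrize A) ≤ ENNReal.ofReal (2 / ρ) * sharpNorm (u 0 0) + S := by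
  have hfin : ∀ M N, ∑' j, sharpNorm (T M N j) ≠ ⊤ := fun M N h => by
    have h1 := (ENNReal.le_tsum (f := fun MN : ℕ × ℕ => ENNReal.ofReal ξ⁻¹ ^ (MN.1 + MN.2) *
      ∑' j, sharpNorm (T MN.1 MN.2 j)) (M, N)).trans hsum
    have h2 : ENNReal.ofReal ξ⁻¹ ^ (M + N) ≠ 0 :=
      pow_ne_zero _ (ENNReal.ofReal_pos.2 (inv_pos.2 hξ)).ne'
    simp only [h, ENNReal.mul_top h2, top_le_iff] at h1
    exact hS h1
  have hF := fun M N => rescaledFree_spec hρ hρ1 hu M N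
  have hTs := fun M N => MemPre.tsum (hT M N) (hfin M N)
  have hAm : ∀ M N, MemPre (A M N) := fun M N =>
    ((hF M N).1.add (hTs M N).1).congr (hA M N)
  have hAn : ∀ M N, sharpNorm (A M N) ≤
      sharpNorm (rescaledFree ρ u M N) + ∑' j, sharpNorm (T M N j) := fun M N => by
    rw [sharpNorm_congr (g := rescaledFree ρ u M N + fun r k k' => ∑' j, T M N j r k k') (hA M N)]
    exact ((hF M N).1.sharpNorm_add_le (hTs M N).1).trans (add_le_add le_rfl (hTs M N).2)
  refine ⟨fun M N => (memSharp_symmetrize (hAm M N)).1, ?_⟩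
  calc xiNorm ξ (symmetrize A)
      ≤ ∑' MN : ℕ × ℕ, (ENNReal.ofReal ξ⁻¹ ^ (MN.1 + MN.2) *
          sharpNorm (rescaledFree ρ u MN.1 MN.2) + ENNReal.ofReal ξ⁻¹ ^ (MN.1 + MN.2) *
          ∑' j, sharpNorm (T MN.1 MN.2 j)) := by
        refine ENNReal.tsum_le_tsum fun MN => ?_
        rw [← mul_add]
        exact mul_le_mul' le_rfl ((memSharp_symmetrize (hAm _ _)).2.trans (hAn _ _))
    _ ≤ _ := by
        rw [ENNReal.tsum_add]
        refine add_le_add ?_ hsum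
        rw [tsum_eq_single (0, 0) fun MN h => ?_]
        · simpa using (hF 0 0).2
        · rw [rescaledFree_eq_zero u (fun h0 => h (Prod.ext (by simp; omega) (by simp; omega))),
            sharpNorm_zero, mul_zero]

/-- The renormalized kernels depend holomorphically on the parameter. -/
lemma GoodFamily.renormSharp_differentiable (hχ : IsCutoffPair χ χbar) (hs : ScaleCond χ ρ ξ γ)
    {W : ℂ → Kernel} (hW : GoodFamily ρ ξ γ W) {ζ : ℂ} (hζ : ζ ∈ disc) :
    ∃ D : Kernel, MemXi ξ D ∧ Tendsto (fun h : ℂ => xiNorm ξ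
      (h⁻¹ • (renormSharp χ χbar ρ (W (ζ + h)) - renormSharp χ χbar ρ (W ζ)) - D))
      (𝓝[≠] 0) (𝓝 0) := by
  have hρ := hs.ρ_pos
  have hρ1 : ρ ≤ 1 := by linarith [hs.ρ_le']
  have hξ := hs.ξ_pos
  have hγ := hs.γ_nonneg
  obtain ⟨R, hR, hball⟩ := Metric.isOpen_iff.1 isOpen_disc ζ hζ
  obtain ⟨W', hW', ht⟩ := hW.diff ζ hζ
  have hsum : ∀ {T : ∀ j : (Σ MN : ℕ × ℕ, Σ L : ℕ, MultiIndex (L + 1) MN.1 MN.2),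
      KerFun j.1.1 j.1.2}, ∑' j, ENNReal.ofReal (ξ⁻¹ ^ (j.1.1 + j.1.2)) * sharpNorm (T j) =
        ∑' MN : ℕ × ℕ, ENNReal.ofReal ξ⁻¹ ^ (MN.1 + MN.2) * ∑' j, sharpNorm (T ⟨MN, j⟩) := by
    intro T
    rw [ENNReal.tsum_sigma']
    refine tsum_congr fun MN => ?_
    simp only [ENNReal.tsum_mul_left]
    rw [ENNReal.ofReal_pow (by positivity)]
  obtain ⟨V', hV', hVs, hVd⟩ := weighted_differentiable
    (ι := Σ MN : ℕ × ℕ, Σ L : ℕ, MultiIndex (L + 1) MN.1 MN.2)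
    (ω := fun j => ξ⁻¹ ^ (j.1.1 + j.1.2)) (fun j => by positivity)
    (V := fun z j => hatTerm χ χbar ρ (W z) j.1.1 j.1.2 j.2) (z₀ := ζ) (B := γ / 2) hR
    (by positivity) (fun z hz j => hatTerm_spec hχ hs (hW.good z (hball hz)) j.2)
    (fun z hz j => by
      obtain ⟨v', hv', hvt⟩ := hW.vKernel_differentiable hχ hs (hball hz) j.2.2
      set c : ℂ := (-1) ^ j.2.1 * ((ρ : ℂ) ^ (j.1.1 + j.1.2) * (ρ : ℂ)⁻¹) * (j.2.2.coeff : ℂ)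
        with hc
      refine ⟨c • v', hv'.smul c, ?_⟩
      have h1 := ENNReal.Tendsto.const_mul hvt (a := ‖c‖ₑ) (Or.inr (by simp))
      rw [mul_zero] at h1
      refine tendsto_of_tendsto_of_tendsto_of_le_of_le tendsto_const_nhds h1 (fun _ => zero_le)
        fun h => ?_
      refine le_trans (le_of_eq ?_) (sharpNorm_smul_le c _)
      congr 1
      simp only [hatTerm, ← hc]
      module)
    (fun z hz => by
      rw [hsum (T := fun j => hatTerm χ χbar ρ (W z) j.1.1 j.1.2 j.2)]
      exact tsum_tsum_hatTerm_le hχ hs (hW.good z (hball hz)))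
  rw [hsum] at hVs
  -- `H` is the derivative of `ŵ`, and its symmetrization the derivative of the renormalized kernel
  set H : Kernel := fun M N r k k' => rescaledFree ρ W' M N r k k' +
    ∑' j, V' ⟨(M, N), j⟩ r k k' with hH
  obtain ⟨hD1, hD2⟩ := symmetrize_spec hρ hρ1 hξ (A := H) (T := fun M N j => V' ⟨(M, N), j⟩)
    (hW'.1 0 0).memPre (fun M N j => hV' _) ENNReal.ofReal_ne_top hVs
    fun M N => Eventually.of_forall fun K r _ => rfl
  refine ⟨symmetrize H, ⟨hD1, hD2.trans_lt ?_⟩, ?_⟩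
  · exact ENNReal.add_lt_top.2 ⟨ENNReal.mul_lt_top ENNReal.ofReal_lt_top (hW'.1 0 0).norm_lt_top,
      ENNReal.ofReal_lt_top⟩
  · have hlim : Tendsto (fun h : ℂ => ENNReal.ofReal (2 / ρ) *
        sharpNorm ((h⁻¹ • (W (ζ + h) - W ζ) - W') 0 0) +
          ENNReal.ofReal (8 * (γ / 2) / R ^ 2 * ‖h‖)) (𝓝[≠] 0) (𝓝 0) := by
      have h1 := ENNReal.Tendsto.const_mul (tendsto_sharpNorm_of_xiNorm hξ ht 0 0)
        (a := ENNReal.ofReal (2 / ρ)) (Or.inr ENNReal.ofReal_ne_top)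
      have h2 := ENNReal.tendsto_ofReal (tendsto_norm_nhdsNE.const_mul (8 * (γ / 2) / R ^ 2))
      rw [mul_zero] at h1 h2
      rw [ENNReal.ofReal_zero] at h2
      simpa using h1.add h2
    refine tendsto_of_tendsto_of_tendsto_of_le_of_le' tendsto_const_nhds hlim
      (Eventually.of_forall fun _ => zero_le) ?_
    have hsmall : ∀ᶠ h in 𝓝[≠] (0 : ℂ), ‖h‖ < R / 4 :=
      tendsto_norm_nhdsNE.eventually (Iio_mem_nhds (by positivity))
    filter_upwards [hsmall, eventually_add_mem_disc hζ, self_mem_nhdsWithin] with h hh hd hne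
    have h3 := hVd h hne hh
    rw [hsum] at h3
    have hg := hW.good _ hd
    have hg₀ := hW.good ζ hζ
    have hu : MemPre ((h⁻¹ • (W (ζ + h) - W ζ) - W') 0 0) :=
      (((hg.mem 0 0).memPre.sub (hg₀.mem 0 0).memPre).smul h⁻¹).sub (hW'.1 0 0).memPre
    have hVfin : ∀ M N, ∑' j, sharpNorm (V' ⟨(M, N), j⟩) ≠ ⊤ := fun M N hM => by
      have h1 := (ENNReal.le_tsum (f := fun MN : ℕ × ℕ => ENNReal.ofReal ξ⁻¹ ^ (MN.1 + MN.2) *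
        ∑' j, sharpNorm (V' ⟨MN, j⟩)) (M, N)).trans hVs
      have h2 : ENNReal.ofReal ξ⁻¹ ^ (M + N) ≠ 0 :=
        pow_ne_zero _ (ENNReal.ofReal_pos.2 (inv_pos.2 hξ)).ne'
      simp only [hM, ENNReal.mul_top h2, top_le_iff] at h1
      exact ENNReal.ofReal_ne_top h1
    have h4 := symmetrize_spec hρ hρ1 hξ
      (A := h⁻¹ • (hatKernel χ χbar ρ (W (ζ + h)) - hatKernel χ χbar ρ (W ζ)) - H)
      (u := h⁻¹ • (W (ζ + h) - W ζ) - W') (T := fun M N j =>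
        h⁻¹ • (hatTerm χ χbar ρ (W (ζ + h)) M N j - hatTerm χ χbar ρ (W ζ) M N j) -
          V' ⟨(M, N), j⟩) hu
      (fun M N j => (((hatTerm_spec hχ hs hg j).sub (hatTerm_spec hχ hs hg₀ j)).smul h⁻¹).sub
        (hV' _)) ENNReal.ofReal_ne_top h3 fun M N => by
      filter_upwards [ae_hatKernel_eq hχ hs hg M N, ae_hatKernel_eq hχ hs hg₀ M N,
        ae_summable_of_tsum_sharpNorm (fun j => hatTerm_spec hχ hs hg j)
          (tsum_hatTerm_ne_top hχ hs hg M N),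
        ae_summable_of_tsum_sharpNorm (fun j => hatTerm_spec hχ hs hg₀ j)
          (tsum_hatTerm_ne_top hχ hs hg₀ M N),
        ae_summable_of_tsum_sharpNorm (fun j => hV' ⟨(M, N), j⟩) (hVfin M N)]
        with K k1 k2 s1 s2 s3 r hr
      rw [← rescaledFree_sub_smul]
      simp only [Pi.sub_apply, Pi.smul_apply, smul_eq_mul, k1 r hr, k2 r hr, hH]
      rw [(((s1 r hr).sub (s2 r hr)).mul_left h⁻¹).tsum_sub (s3 r hr), tsum_mul_left,
        (s1 r hr).tsum_sub (s2 r hr)]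
      ring
    rw [renormSharp, renormSharp, ← symmetrize_sub_smul]
    exact h4.2

end

/-! ### The energy map -/

section

variable {ρ ξ ε δ₁ δ₂ : ℝ} {w : ℂ → Kernel}

lemma MemAnalytic.exists_hasDerivAt_value (hξ : 0 < ξ) (hw : MemAnalytic ξ w) {z : ℂ}
    (hz : z ∈ disc) : ∃ d, HasDerivAt (fun z => (w z).zero 0) d z := by
  obtain ⟨w', hw', ht⟩ := hw.differentiable z hz
  refine ⟨w'.zero 0, ?_⟩
  rw [hasDerivAt_iff_tendsto_slope_zero]
  have h1 := (ENNReal.tendsto_toReal ENNReal.zero_ne_top).comp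
    (tendsto_sharpNorm_of_xiNorm hξ ht 0 0)
  have h2 : Tendsto (fun h : ℂ => (h⁻¹ • (w (z + h) - w z) - w').zero 0) (𝓝[≠] 0) (𝓝 0) := by
    refine squeeze_zero_norm' ?_ h1
    filter_upwards [eventually_add_mem_disc hz] with h hh
    have h3 : MemPre ((h⁻¹ • (w (z + h) - w z) - w') 0 0) :=
      (((((hw.mem _ hh).1 0 0).memPre.sub ((hw.mem z hz).1 0 0).memPre).smul h⁻¹).sub
        (hw'.1 0 0).memPre)
    exact (h3.zero_spec.2 0 (by simp)).1
  have h3 := h2.add_const (w'.zero 0)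
  rw [zero_add] at h3
  refine h3.congr fun h => ?_
  simp only [Kernel.zero, Pi.sub_apply, Pi.smul_apply]
  ring

/-- The deviation `z ↦ w_{0,0}(z,0) + z` of the vacuum energy from its unperturbed value. -/
def energyShift (w : ℂ → Kernel) (z : ℂ) : ℂ := (w z).zero 0 + z

lemma energy_eq (ρ : ℝ) (w : ℂ → Kernel) (z : ℂ) :
    energy ρ w z = (ρ : ℂ)⁻¹ * (z - energyShift w z) := by
  simp only [energy, energyShift]; ring

/-- The condition that the energy map `z ↦ ρ⁻¹ (z - energyShift w z)` is a small holomorphic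
perturbation of a dilation. -/
structure EnergyCond (ρ : ℝ) (w : ℂ → Kernel) : Prop where
  ρ_pos : 0 < ρ
  ρ_le : ρ ≤ 1 / 48
  diff : DifferentiableOn ℂ (energyShift w) disc
  small : ∀ z ∈ disc, ‖energyShift w z‖ ≤ ρ / 32

namespace EnergyCond

/-- By the Cauchy estimate on discs of radius `1/8`, the perturbation is a contraction. -/
lemma norm_deriv_le (h : EnergyCond ρ w) {z : ℂ} (hz : z ∈ Metric.ball (0 : ℂ) (1 / 4)) :
    ‖deriv (energyShift w) z‖ ≤ 1 / 2 := by
  have hsub : Metric.closedBall z (1 / 8) ⊆ disc := fun y hy => by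
    rw [Metric.mem_closedBall, dist_eq_norm] at hy
    rw [mem_ball_zero_iff] at hz
    have := norm_add_le (y - z) z
    rw [sub_add_cancel] at this
    change ‖y‖ < 1 / 2
    linarith
  have h1 := Complex.norm_deriv_le_of_forall_mem_sphere_norm_le (f := energyShift w) (c := z)
    (R := 1 / 8) (by norm_num) ((h.diff.mono hsub).diffContOnCl_ball subset_rfl)
    (fun y hy => h.small y (hsub (Metric.sphere_subset_closedBall hy)))
  have := h.ρ_le
  linarith

lemma lipschitz (h : EnergyCond ρ w) {z₁ z₂ : ℂ} (h₁ : z₁ ∈ Metric.ball (0 : ℂ) (1 / 4))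
    (h₂ : z₂ ∈ Metric.ball (0 : ℂ) (1 / 4)) :
    ‖energyShift w z₂ - energyShift w z₁‖ ≤ 1 / 2 * ‖z₂ - z₁‖ := by
  refine (convex_ball (0 : ℂ) (1 / 4)).norm_image_sub_le_of_norm_deriv_le (𝕜 := ℂ)
    (fun y hy => ?_) (fun y hy => h.norm_deriv_le hy) h₁ h₂
  refine h.diff.differentiableAt (isOpen_disc.mem_nhds ?_)
  rw [mem_ball_zero_iff] at hy
  change ‖y‖ < 1 / 2
  linarith

lemma mem_ball_of_mem (h : EnergyCond ρ w) {z : ℂ} (hz : z ∈ energyDomain ρ w) :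
    z ∈ Metric.ball (0 : ℂ) (1 / 4) := by
  have h1 := h.small z hz.1
  have h2 := hz.2
  have h3 := norm_sub_le (energyShift w z) ((w z).zero 0)
  rw [energyShift, add_sub_cancel_left] at h3
  rw [energyShift] at h1
  rw [mem_ball_zero_iff]
  have := h.ρ_le
  linarith

/-- The energy map expands distances by at least `1/(2ρ)`. -/
lemma norm_sub_le' (h : EnergyCond ρ w) {z₁ z₂ : ℂ} (h₁ : z₁ ∈ energyDomain ρ w)
    (h₂ : z₂ ∈ energyDomain ρ w) :
    ‖z₂ - z₁‖ ≤ 2 * ρ * ‖energy ρ w z₂ - energy ρ w z₁‖ := by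
  have h3 := h.lipschitz (h.mem_ball_of_mem h₁) (h.mem_ball_of_mem h₂)
  have hρ := h.ρ_pos
  have hρ0 : (ρ : ℂ) ≠ 0 := by exact_mod_cast hρ.ne'
  have e : z₂ - z₁ = ρ * (energy ρ w z₂ - energy ρ w z₁) +
      (energyShift w z₂ - energyShift w z₁) := by
    rw [energy_eq, energy_eq]
    field_simp
    ring
  have h4 := norm_add_le (ρ * (energy ρ w z₂ - energy ρ w z₁))
    (energyShift w z₂ - energyShift w z₁)
  rw [← e, norm_mul, Complex.norm_real, Real.norm_of_nonneg hρ.le] at h4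
  linarith

lemma norm_energy_lt (h : EnergyCond ρ w) {z : ℂ} : ‖energy ρ w z‖ < 1 / 2 ↔
    ‖(w z).zero 0‖ < ρ / 2 := by
  have hρ := h.ρ_pos
  rw [energy, norm_neg, norm_mul, norm_inv, Complex.norm_real, Real.norm_of_nonneg hρ.le,
    inv_mul_lt_iff₀ hρ]
  constructor <;> intro h <;> linarith

/-- The energy map is a bijection onto the disc. Preimages are fixed points of a contraction. -/
lemma bijOn (h : EnergyCond ρ w) : Set.BijOn (energy ρ w) (energyDomain ρ w) disc := by
  have hρ := h.ρ_pos
  have hρ1 := h.ρ_le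
  have hρ0 : (ρ : ℂ) ≠ 0 := by exact_mod_cast hρ.ne'
  refine ⟨fun z hz => h.norm_energy_lt.2 hz.2, fun z₁ h₁ z₂ h₂ he => ?_, fun ζ hζ => ?_⟩
  · have := h.norm_sub_le' h₁ h₂
    rw [he, sub_self, norm_zero, mul_zero] at this
    exact (sub_eq_zero.1 (norm_le_zero_iff.1 this)).symm
  · set s : Set ℂ := Metric.closedBall 0 (1 / 8) with hs
    have hsb : ∀ z ∈ s, z ∈ Metric.ball (0 : ℂ) (1 / 4) := fun z hz =>
      Metric.closedBall_subset_ball (by norm_num) hz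
    have hsd : ∀ z ∈ s, z ∈ disc := fun z hz => by
      have := mem_closedBall_zero_iff.1 hz
      change ‖z‖ < 1 / 2
      linarith
    have hζ' : ‖ζ‖ < 1 / 2 := hζ
    -- `energy ρ w z = ζ` is the fixed point equation `z = ρ ζ + energyShift w z`
    have hmaps : Set.MapsTo (fun z => ρ * ζ + energyShift w z) s s := fun z hz => by
      rw [hs, mem_closedBall_zero_iff]
      refine (norm_add_le _ _).trans ?_
      rw [norm_mul, Complex.norm_real, Real.norm_of_nonneg hρ.le]
      have := h.small z (hsd z hz)
      nlinarith
    have hcontr : ContractingWith (1 / 2)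
        (hmaps.restrict (fun z => ρ * ζ + energyShift w z) s s) := by
      refine ⟨by norm_num, LipschitzWith.of_dist_le_mul fun z₁ z₂ => ?_⟩
      rw [Subtype.dist_eq, Subtype.dist_eq, dist_eq_norm, dist_eq_norm]
      simp only [Set.MapsTo.val_restrict_apply, add_sub_add_left_eq_sub]
      have := h.lipschitz (hsb _ z₂.2) (hsb _ z₁.2)
      simpa using this
    obtain ⟨z, hz, hfix, -, -⟩ := hcontr.exists_fixedPoint' Metric.isClosed_closedBall.isComplete
      hmaps (x := 0) (by simp [hs]) (edist_ne_top _ _)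
    have hfix' : ρ * ζ + energyShift w z = z := hfix
    have he : energy ρ w z = ζ := by
      rw [energy_eq, ← hfix', add_sub_assoc]
      rw [hfix', sub_self, add_zero, inv_mul_cancel_left₀ hρ0]
    refine ⟨z, ⟨hsd z hz, ?_⟩, he⟩
    rw [← h.norm_energy_lt, he]
    exact hζ

lemma inv_spec (h : EnergyCond ρ w) {ζ : ℂ} (hζ : ζ ∈ disc) :
    Function.invFunOn (energy ρ w) (energyDomain ρ w) ζ ∈ energyDomain ρ w ∧
      energy ρ w (Function.invFunOn (energy ρ w) (energyDomain ρ w) ζ) = ζ :=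
  ⟨Function.invFunOn_mem (h.bijOn.surjOn hζ), Function.invFunOn_eq (h.bijOn.surjOn hζ)⟩

lemma exists_hasDerivAt_inv (h : EnergyCond ρ w) {ζ : ℂ} (hζ : ζ ∈ disc) :
    ∃ d, HasDerivAt (Function.invFunOn (energy ρ w) (energyDomain ρ w)) d ζ := by
  set J := Function.invFunOn (energy ρ w) (energyDomain ρ w) with hJ
  have hρ := h.ρ_pos
  have hρ0 : (ρ : ℂ) ≠ 0 := by exact_mod_cast hρ.ne'
  have hc : ContinuousAt J ζ := by
    rw [Metric.continuousAt_iff']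
    intro e he
    have h1 : ∀ᶠ y in 𝓝 ζ, dist y ζ < e / (2 * ρ) := Metric.ball_mem_nhds ζ (by positivity)
    filter_upwards [h1, isOpen_disc.mem_nhds hζ] with y hy hyd
    have h2 := h.norm_sub_le' (h.inv_spec hζ).1 (h.inv_spec hyd).1
    rw [(h.inv_spec hζ).2, (h.inv_spec hyd).2, ← dist_eq_norm, ← dist_eq_norm] at h2
    rw [lt_div_iff₀ (by positivity)] at hy
    exact h2.trans_lt (by linarith)
  have hz := (h.inv_spec hζ).1
  have hzb := h.mem_ball_of_mem hz
  have hd : HasDerivAt (energyShift w) (deriv (energyShift w) (J ζ)) (J ζ) :=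
    (h.diff.differentiableAt (isOpen_disc.mem_nhds hz.1)).hasDerivAt
  have hE : HasDerivAt (energy ρ w) ((ρ : ℂ)⁻¹ * (1 - deriv (energyShift w) (J ζ))) (J ζ) := by
    have h1 := ((hasDerivAt_id (J ζ)).sub hd).const_mul (ρ : ℂ)⁻¹
    exact h1.congr_of_eventuallyEq (Eventually.of_forall fun z => energy_eq ρ w z)
  have hne : (ρ : ℂ)⁻¹ * (1 - deriv (energyShift w) (J ζ)) ≠ 0 := by
    refine mul_ne_zero (inv_ne_zero hρ0) fun h0 => ?_
    have h1 := h.norm_deriv_le hzb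
    rw [← sub_eq_zero.1 h0, norm_one] at h1
    norm_num at h1
  refine ⟨_, HasDerivAt.of_local_left_inverse hc hE hne ?_⟩
  filter_upwards [isOpen_disc.mem_nhds hζ] with y hy using (h.inv_spec hy).2

end EnergyCond

/-! ### The family of kernels at the renormalized spectral parameter -/

lemma xiNorm_add_le (ξ : ℝ) {u v : Kernel} (hu : ∀ m n, MemPre (u m n))
    (hv : ∀ m n, MemPre (v m n)) : xiNorm ξ (u + v) ≤ xiNorm ξ u + xiNorm ξ v := by
  rw [xiNorm, xiNorm, xiNorm, ← ENNReal.tsum_add]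
  refine ENNReal.tsum_le_tsum fun mn => ?_
  rw [← mul_add]
  exact mul_le_mul' le_rfl ((hu _ _).sharpNorm_add_le (hv _ _))

lemma xiNorm_smul_le (ξ : ℝ) (c : ℂ) (u : Kernel) : xiNorm ξ (c • u) ≤ ‖c‖ₑ * xiNorm ξ u := by
  rw [xiNorm, xiNorm, ← ENNReal.tsum_mul_left]
  refine ENNReal.tsum_le_tsum fun mn => ?_
  rw [mul_left_comm]
  exact mul_le_mul' le_rfl (sharpNorm_smul_le c _)

lemma MemXi.smul {u : Kernel} (c : ℂ) (hu : MemXi ξ u) : MemXi ξ (c • u) :=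
  ⟨fun m n => (hu.1 m n).smul c, (xiNorm_smul_le ξ c u).trans_lt
    (ENNReal.mul_lt_top (by simp) hu.2)⟩

/-- The chain rule for the composition of an analytic family with the inverse energy map. -/
lemma MemAnalytic.comp_differentiable (hw : MemAnalytic ξ w) {J : ℂ → ℂ} {d ζ : ℂ}
    (hζ : ζ ∈ disc) (hJd : ∀ y ∈ disc, J y ∈ disc) (hinj : Set.InjOn J disc)
    (hJ : HasDerivAt J d ζ) : ∃ W' : Kernel, MemXi ξ W' ∧
      Tendsto (fun h : ℂ => xiNorm ξ (h⁻¹ • (w (J (ζ + h)) - w (J ζ)) - W')) (𝓝[≠] 0) (𝓝 0) := by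
  obtain ⟨w', hw', ht⟩ := hw.differentiable (J ζ) (hJd ζ hζ)
  refine ⟨d • w', hw'.smul d, ?_⟩
  have hslope := hasDerivAt_iff_tendsto_slope_zero.1 hJ
  -- the increments of `J` do not vanish, so that they may serve in difference quotients of `w`
  have hk : Tendsto (fun h : ℂ => J (ζ + h) - J ζ) (𝓝[≠] 0) (𝓝[≠] 0) := by
    refine tendsto_nhdsWithin_iff.2 ⟨?_, ?_⟩
    · have h1 : Tendsto (fun h : ℂ => J (ζ + h)) (𝓝 0) (𝓝 (J ζ)) := by
        have h2 : Tendsto (fun h : ℂ => ζ + h) (𝓝 0) (𝓝 ζ) := by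
          simpa using (continuous_const_add ζ).tendsto 0
        exact hJ.continuousAt.tendsto.comp h2
      have h3 := (h1.sub_const (J ζ)).mono_left (nhdsWithin_le_nhds (s := {0}ᶜ))
      rwa [sub_self] at h3
    · filter_upwards [eventually_add_mem_disc hζ, self_mem_nhdsWithin] with h hh hne h0
      have := hinj hh hζ (sub_eq_zero.1 h0)
      exact hne (by simpa using this)
  have h1 := ht.comp hk
  have h2 : Tendsto (fun h : ℂ => ‖h⁻¹ • (J (ζ + h) - J ζ)‖ₑ *
      xiNorm ξ ((J (ζ + h) - J ζ)⁻¹ • (w (J ζ + (J (ζ + h) - J ζ)) - w (J ζ)) - w') +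
      ‖h⁻¹ • (J (ζ + h) - J ζ) - d‖ₑ * xiNorm ξ w') (𝓝[≠] 0) (𝓝 (‖d‖ₑ * 0 + 0 * xiNorm ξ w')) := by
    refine Tendsto.add (ENNReal.Tendsto.mul hslope.enorm (Or.inr ?_) h1 (Or.inr ?_))
      (ENNReal.Tendsto.mul_const ?_ (Or.inr hw'.2.ne))
    · exact ENNReal.zero_ne_top
    · simp
    · have h3 := (hslope.sub_const d).enorm
      rwa [sub_self, enorm_zero] at h3
  rw [mul_zero, zero_mul, add_zero] at h2
  refine tendsto_of_tendsto_of_tendsto_of_le_of_le' tendsto_const_nhds h2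
    (Eventually.of_forall fun _ => zero_le) ?_
  filter_upwards [eventually_add_mem_disc hζ, tendsto_nhdsWithin_iff.1 hk |>.2,
    self_mem_nhdsWithin] with h hh hk0 hne
  have hne' : h ≠ 0 := hne
  have hk0' : J (ζ + h) - J ζ ≠ 0 := hk0
  obtain ⟨k, hkdef⟩ : ∃ k, k = J (ζ + h) - J ζ := ⟨_, rfl⟩
  have e : h⁻¹ • (w (J (ζ + h)) - w (J ζ)) - d • w' =
      (h⁻¹ • k) • (k⁻¹ • (w (J ζ + k) - w (J ζ)) - w') + (h⁻¹ • k - d) • w' := by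
    have hJk : J ζ + k = J (ζ + h) := by rw [hkdef]; ring
    rw [← hkdef] at hk0'
    rw [hJk, smul_sub (h⁻¹ • k), smul_smul (h⁻¹ • k), smul_eq_mul, mul_assoc,
      mul_inv_cancel₀ hk0', mul_one]
    module
  rw [e, ← hkdef]
  have hJk : J ζ + k = J (ζ + h) := by rw [hkdef]; ring
  refine (xiNorm_add_le ξ (fun m n => ?_) fun m n => ?_).trans
    (add_le_add (xiNorm_smul_le ξ _ _) (xiNorm_smul_le ξ _ _))
  · rw [hJk]
    exact (((((hw.mem _ (hJd _ hh)).1 m n).memPre.sub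
      ((hw.mem _ (hJd _ hζ)).1 m n).memPre).smul k⁻¹).sub (hw'.1 m n).memPre).smul _
  · exact (hw'.1 m n).memPre.smul _

end

/-! ### The contraction property -/

section

variable {χ χbar : ℝ → ℝ} {ρ ξ ε δ₁ δ₂ : ℝ} {w : ℂ → Kernel}

namespace MemEvenBall

lemma energyCond (hρ : 0 < ρ) (hρ1 : ρ ≤ 1 / 48) (hξ : 0 < ξ) (hδ₁ : δ₁ ≤ ρ / 32)
    (hw : MemEvenBall ξ ε δ₁ δ₂ w) : EnergyCond ρ w where
  ρ_pos := hρ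
  ρ_le := hρ1
  diff := fun z hz => by
    obtain ⟨d, hd⟩ := hw.ball.analytic.exists_hasDerivAt_value hξ hz
    exact (hd.differentiableAt.add differentiableAt_id).differentiableWithinAt
  small := fun z hz => (hw.ball.value_le z hz).trans hδ₁

lemma goodKernel (hε : ε ≤ 1 / 100) (hw : MemEvenBall ξ ε δ₁ δ₂ w) {z : ℂ}
    (hz : z ∈ energyDomain ρ w) : GoodKernel ρ ξ δ₂ (w z) where
  mem := (hw.ball.analytic.mem z hz.1).1
  free :=
    { contDiff := (MemPre.zero_spec ((hw.ball.analytic.mem z hz.1).1 0 0).memPre).1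
      deriv_le := fun r hr => (hw.ball.deriv_le z hz.1 r hr).trans hε
      value_le := hz.2.le }
  norm_le := hw.ball.norm_le z hz.1
  odd := fun m n h => by
    rw [sharpNorm_congr (g := 0) (hw.even z hz.1 m n h), sharpNorm_zero]

end MemEvenBall

lemma orderSum_lt_top (hχ : IsCutoffPair χ χbar) {γ : ℝ} (hs : ScaleCond χ ρ ξ γ) {u : Kernel}
    (hu : GoodKernel ρ ξ γ u) (M N : ℕ) : orderSum χ χbar ρ u M N < ⊤ := by
  have h1 := (ENNReal.le_tsum (f := fun MN : ℕ × ℕ => ENNReal.ofReal (ρ * ξ⁻¹) ^ (MN.1 + MN.2) *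
    orderSum χ χbar ρ u MN.1 MN.2) (M, N)).trans (tsum_orderSum_le hχ hs hu)
  have h2 : ENNReal.ofReal (ρ * ξ⁻¹) ^ (M + N) ≠ 0 :=
    pow_ne_zero _ (ENNReal.ofReal_pos.2 (mul_pos hs.ρ_pos (inv_pos.2 hs.ξ_pos))).ne'
  rw [lt_top_iff_ne_top]
  intro h
  simp only [h, ENNReal.mul_top h2, top_le_iff, ENNReal.ofReal_ne_top] at h1

lemma sharpNorm_zero_zero_le_xiNorm (ξ : ℝ) (u : Kernel) : sharpNorm (u 0 0) ≤ xiNorm ξ u := by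
  have := ENNReal.le_tsum (f := fun mn : ℕ × ℕ => ENNReal.ofReal ξ⁻¹ ^ (mn.1 + mn.2) *
    sharpNorm (u mn.1 mn.2)) (0, 0)
  simpa [xiNorm] using this

/-- The renormalized kernels are uniformly bounded in terms of the free part. -/
lemma renormSharp_spec (hχ : IsCutoffPair χ χbar) {γ : ℝ} (hs : ScaleCond χ ρ ξ γ) {u : Kernel}
    (hu : GoodKernel ρ ξ γ u) : (∀ M N, MemSharp (renormSharp χ χbar ρ u M N)) ∧
      xiNorm ξ (renormSharp χ χbar ρ u) ≤
        ENNReal.ofReal (2 / ρ) * sharpNorm (u 0 0) + ENNReal.ofReal (γ / 2) :=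
  symmetrize_spec hs.ρ_pos (by linarith [hs.ρ_le']) hs.ξ_pos (hu.mem 0 0).memPre
    (fun _ _ j => hatTerm_spec hχ hs hu j) ENNReal.ofReal_ne_top
    (tsum_tsum_hatTerm_le hχ hs hu) (ae_hatKernel_eq hχ hs hu)

/-- The kernels at the preimages of the spectral parameter form a holomorphic family. -/
lemma MemEvenBall.goodFamily (hρ : 0 < ρ) (hρ1 : ρ ≤ 1 / 48) (hξ : 0 < ξ) (hδ₁ : δ₁ ≤ ρ / 32)
    (hε : ε ≤ 1 / 100) (hw : MemEvenBall ξ ε δ₁ δ₂ w) : GoodFamily ρ ξ δ₂ fun ζ =>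
      w (Function.invFunOn (energy ρ w) (energyDomain ρ w) ζ) := by
  have hE := hw.energyCond hρ hρ1 hξ hδ₁
  refine ⟨fun ζ hζ => hw.goodKernel hε (hE.inv_spec hζ).1, fun ζ hζ => ?_⟩
  -- injectivity of the inverse keeps the increments of the spectral parameter away from zero
  obtain ⟨d, hd⟩ := hE.exists_hasDerivAt_inv hζ
  exact hw.ball.analytic.comp_differentiable hζ (fun y hy => (hE.inv_spec hy).1.1)
    (fun x hx y hy hxy => by
      rw [← (hE.inv_spec hx).2, ← (hE.inv_spec hy).2]
      exact congrArg (energy ρ w) hxy) hd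

/-- Boundedness and analyticity of the renormalized kernels. -/
lemma MemEvenBall.renorm_memAnalytic (hχ : IsCutoffPair χ χbar) (hs : ScaleCond χ ρ ξ δ₂)
    (hδ₁ : δ₁ ≤ ρ / 32) (hε : ε ≤ 1 / 100) (hw : MemEvenBall ξ ε δ₁ δ₂ w) :
    MemAnalytic ξ (renorm χ χbar ρ w) := by
  have hF := hw.goodFamily hs.ρ_pos hs.ρ_le' hs.ξ_pos hδ₁ hε
  have hE := hw.energyCond hs.ρ_pos hs.ρ_le' hs.ξ_pos hδ₁
  have hb : ∀ ζ ∈ disc, xiNorm ξ (renorm χ χbar ρ w ζ) ≤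
      ENNReal.ofReal (2 / ρ) * (⨆ z ∈ disc, xiNorm ξ (w z)) + ENNReal.ofReal (δ₂ / 2) :=
    fun ζ hζ => (renormSharp_spec hχ hs (hF.good ζ hζ)).2.trans <|
      add_le_add (mul_le_mul' le_rfl ((sharpNorm_zero_zero_le_xiNorm ξ _).trans
        (le_iSup₂ (f := fun z (_ : z ∈ disc) => xiNorm ξ (w z)) _ (hE.inv_spec hζ).1.1))) le_rfl
  have hfin : ENNReal.ofReal (2 / ρ) * (⨆ z ∈ disc, xiNorm ξ (w z)) +
      ENNReal.ofReal (δ₂ / 2) < ⊤ :=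
    ENNReal.add_lt_top.2 ⟨ENNReal.mul_lt_top ENNReal.ofReal_lt_top hw.ball.analytic.bounded,
      ENNReal.ofReal_lt_top⟩
  exact ⟨fun ζ hζ => ⟨(renormSharp_spec hχ hs (hF.good ζ hζ)).1, (hb ζ hζ).trans_lt hfin⟩,
    (iSup₂_le hb).trans_lt hfin, fun ζ hζ => hF.renormSharp_differentiable hχ hs hζ⟩

/-- The renormalized kernels lie in the smaller ball. The spectral parameter is rescaled so that the
old value at energy zero becomes `-ζ`, and only the error `δ₂/2` of the interacting terms remains.
-/
lemma MemEvenBall.renorm_mem (hχ : IsCutoffPair χ χbar) (hs : ScaleCond χ ρ ξ δ₂)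
    (hδ₁ : δ₁ ≤ ρ / 32) (hε : ε ≤ 1 / 100) (hw : MemEvenBall ξ ε δ₁ δ₂ w) :
    MemEvenBall ξ (ε + δ₂ / 2) (δ₂ / 2) (δ₂ / 2) (renorm χ χbar ρ w) := by
  have hF := hw.goodFamily hs.ρ_pos hs.ρ_le' hs.ξ_pos hδ₁ hε
  have hE := hw.energyCond hs.ρ_pos hs.ρ_le' hs.ξ_pos hδ₁
  refine ⟨⟨hw.renorm_memAnalytic hχ hs hδ₁ hε, fun ζ hζ r hr => ?_, fun ζ hζ => ?_, fun ζ hζ => ?_⟩,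
    fun ζ hζ m n h => ?_⟩
  · exact norm_deriv_renormSharp_le hχ hs (hF.good ζ hζ)
      (fun s hs' => hw.ball.deriv_le _ (hE.inv_spec hζ).1.1 s hs') hr
  · -- `ζ` is `-ρ⁻¹` times the value of the kernel at its preimage
    have h1 := norm_value_renormSharp_le hχ hs (hF.good ζ hζ)
    have h2 := (hE.inv_spec hζ).2
    rw [energy] at h2
    rw [sub_eq_add_neg, h2] at h1
    exact h1
  · exact xiNorm_geOne_renormSharp_le hχ hs (hF.good ζ hζ)
  · have h1 := sharpNorm_renormSharp_odd hχ hs (hF.good ζ hζ) h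
    rw [sharpNorm, add_eq_zero] at h1
    filter_upwards [ae_le_supNorm (renorm χ χbar ρ w ζ m n)] with K hK r hr
    have h2 := (hK r hr).trans h1.1.le
    rwa [nonpos_iff_eq_zero, enorm_eq_zero] at h2

/-- The contraction property for all admissible scaling parameters. -/
theorem contractionProperty_of_le (hχ : IsCutoffPair χ χbar) {ε₀ : ℝ} (hρ : 0 < ρ)
    (hρ1 : ρ ≤ 1 / (16 * cTheta χ)) (hξ : 0 < ξ)
    (hξ1 : ξ ≤ (ρ / (2 * cTheta χ)) ^ ((1 : ℝ) / 4)) (hε₀ : ε₀ ≤ ρ / 32) :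
    ContractionProperty χ χbar ρ ξ ε₀ := by
  intro ε hε δ₁ hδ₁ δ₂ hδ₂ w hw
  have hs : ScaleCond χ ρ ξ δ₂ := ⟨hρ, hρ1, hξ, hξ1, hδ₂.1, hδ₂.2.le.trans hε₀⟩
  have hρ2 := hs.ρ_le'
  have hε1 : ε ≤ 1 / 100 := by linarith [hε.2]
  have hδ₁' : δ₁ ≤ ρ / 32 := hδ₁.2.le.trans hε₀
  exact ⟨⟨(hw.energyCond hρ hρ2 hξ hδ₁').bijOn,
    fun z hz M N => orderSum_lt_top hχ hs (hw.goodKernel hε1 hz) M N⟩,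
    hw.renorm_mem hχ hs hδ₁' hε1⟩

end

end SpinBoson

end

theorem mainTheorem7 (χ χbar : ℝ → ℝ) (hχ : SpinBoson.IsCutoffPair χ χbar) :
    (∀ ρ ξ ε₀ : ℝ,
      0 < ρ → ρ ≤ 1 / (16 * SpinBoson.cTheta χ) →
      0 < ξ → ξ ≤ (ρ / (2 * SpinBoson.cTheta χ)) ^ ((1 : ℝ) / 4) →
      0 < ε₀ → ε₀ ≤ ρ / 32 →
      SpinBoson.ContractionProperty χ χbar ρ ξ ε₀) ∧
    (∀ ρ₀ ξ₀ : ℝ, 0 < ρ₀ → ρ₀ ≤ 1 / 2 → 0 < ξ₀ → ξ₀ ≤ 1 / 2 →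
      ∃ ρ ξ ε₀ : ℝ, ρ ∈ Set.Ioc 0 ρ₀ ∧ ξ ∈ Set.Ioc 0 ξ₀ ∧ ε₀ ∈ Set.Ioc 0 (ρ / 8) ∧
        SpinBoson.ContractionProperty χ χbar ρ ξ ε₀) := by
  refine ⟨fun ρ ξ ε₀ hρ hρ1 hξ hξ1 _ hε₀ =>
    SpinBoson.contractionProperty_of_le hχ hρ hρ1 hξ hξ1 hε₀, fun ρ₀ ξ₀ hρ₀ _ hξ₀ _ => ?_⟩
  have hC : 0 < SpinBoson.cTheta χ := by linarith [SpinBoson.three_le_cTheta χ]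
  obtain ⟨ρ, hρdef⟩ : ∃ ρ, ρ = min ρ₀ (1 / (16 * SpinBoson.cTheta χ)) := ⟨_, rfl⟩
  have hρ : 0 < ρ := hρdef ▸ lt_min hρ₀ (by positivity)
  have hξ : 0 < min ξ₀ ((ρ / (2 * SpinBoson.cTheta χ)) ^ ((1 : ℝ) / 4)) :=
    lt_min hξ₀ (by positivity)
  exact ⟨ρ, _, ρ / 32, ⟨hρ, hρdef ▸ min_le_left _ _⟩, ⟨hξ, min_le_left _ _⟩,
    ⟨by positivity, by linarith⟩, SpinBoson.contractionProperty_of_le hχ hρ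
      (hρdef ▸ min_le_right _ _) hξ (min_le_right _ _) le_rfl⟩
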